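/- Let $\mathcal K$ be a field of characteristic $p>2$, let $n\ge 3$ and $q\in\mathcal K$. Let $\mathcal O(n;\underline 1)$ be the truncated divided power algebra with basis $x^{(\alpha)}$, $0\le\alpha\le\tau=(p-1,\dots,p-1)$, and product $x^{(\alpha)}x^{(\beta)}=\binom{\alpha+\beta}{\alpha}x^{(\alpha+\beta)}$ (where $x^{(\gamma)}=0$ unless $0\le\gamma\le\tau$). Let $D_i$ be its derivation $x^{(\alpha)}\mapsto x^{(\alpha-\epsilon_i)}$, and put $D_{ij}(f)=D_j(f)D_i-D_i(f)D_j$. Let $\mathbf S(n;\underline 1)$ be the derived algebra of the Lie algebra of divergence-free derivations of $\mathcal O(n;\underline 1)$; it contains all $D_{ij}(f)$. Let $\mathbf u(\mathbf S(n;\underline 1))$ be its restricted enveloping algebra, that is, the quotient of $U(\mathbf S(n;\underline 1))$ by the ideal generated by $(D_{ij}(x^{(\epsilon_i+\epsilon_j)}))^p-D_{ij}(x^{(\epsilon_i+\epsilon_j)})$ and $(D_{ij}(x^{(\alpha)}))^p$ for $\alpha\ne\epsilon_i+\epsilon_j$, where $i<j$ and $0\le\alpha\le\tau$. Put $\mathcal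 K[t]_p^{(q)}=\mathcal K[t]/(t^p-qt)$ and $\mathbf u_{t,q}(\mathbf S(n;\underline 1))=\mathbf u(\mathbf S(n;\underline 1))\otimes_{\mathcal K}\mathcal K[t]_p^{(q)}$. Let $k,k',m,m'\in\{1,\dots,n\}$ with $k\ne k'$, $m\ne m'$, $k\ne m,m'$ and $k'\ne m$. For $(a,b)\in\{(k,k'),(m,m')\}$ put $$h(a,b)=D_{ab}(x^{(\epsilon_a+\epsilon_b)}),\qquad e(a,b)=2D_{ab}(x^{(2\epsilon_a+\epsilon_b)}),\qquad d_{ab}^{(\ell)}=\tfrac1{\ell!}(\mathrm{ad}\,e(a,b))^\ell\quad(0\le\ell\le p-1).$$ For given $i,j,\alpha$ put $\alpha(a,b)=\alpha_a-\delta_{ia}-\delta_{ja}-\alpha_b+\delta_{ib}+\delta_{jb}$. Write $y_c^{\langle\ell\rangle}=(y+c)(y+c+1)\cdots(y+c+\ell-1)$ and $y^{\langle\ell\rangle}=y_0^{\langle\ell\rangle}$. The elements $1-e(k,k')t$ and $1-e(m,m')t$ are invertible in $\mathbf u_{t,q}(\mathbf S(n;\underline 1))$. Then the algebra $\mathbf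 u_{t,q}(\mathbf S(n;\underline 1))$ is noncommutative and has $\dim_{\mathcal K}\mathbf u_{t,q}(\mathbf S(n;\underline 1))=p^{1+(n-1)(p^n-1)}$. With its product and unit unchanged, it carries a noncocommutative Hopf algebra structure over $\mathcal K[t]_p^{(q)}$ such that, for all $1\le i,j\le n$ and $0\le\alpha\le\tau$, $$\Delta(D_{ij}(x^{(\alpha)}))=D_{ij}(x^{(\alpha)})\otimes(1-e(k,k')t)^{\alpha(k,k')}(1-e(m,m')t)^{\alpha(m,m')}$$ $$\quad+\sum_{r,\ell=0}^{p-1}(-1)^{\ell+r}h(k,k')^{\langle\ell\rangle}h(m,m')^{\langle r\rangle}\otimes(1-e(k,k')t)^{-\ell}(1-e(m,m')t)^{-r}\,d_{kk'}^{(\ell)}d_{mm'}^{(r)}(D_{ij}(x^{(\alpha)}))\,t^{\ell+r},$$ $$S(D_{ij}(x^{(\alpha)}))=-(1-e(k,k')t)^{-\alpha(k,k')}(1-e(m,m')t)^{-\alpha(m,m')}\sum_{r,\ell=0}^{p-1}d_{kk'}^{(\ell)}d_{mm'}^{(r)}(D_{ij}(x^{(\alpha)}))\,h(k,k')_1^{\langle\ell\rangle}h(m,m')_1^{\langle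 r\rangle}t^{\ell+r},$$ $$\varepsilon(D_{ij}(x^{(\alpha)}))=0.$$ -/

import Mathlib

open scoped TensorProduct Polynomial

set_option linter.unusedSectionVars false

noncomputable section

namespace SpecialLie

/-- The truncated divided power algebra `O(n;1)` over `K`, with basis `x^(α)`, `0 ≤ α ≤ τ`;
an element is the function sending `α` to its coefficient at `x^(α)`. -/
def TruncDP (K : Type*) (n p : ℕ) : Type _ := (Fin n → Fin p) → K

namespace TruncDP

variable {K : Type*} [Field K] {n p : ℕ}

instance : AddCommGroup (TruncDP K n p) :=
  inferInstanceAs (AddCommGroup ((Fin n → Fin p) → K))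

instance : Module K (TruncDP K n p) :=
  inferInstanceAs (Module K ((Fin n → Fin p) → K))

/-- The basis element `x^(α)`, with the convention that it is `0` unless all `α_i < p`. -/
def mono (α : Fin n → ℕ) : TruncDP K n p :=
  fun γ => if ∀ i, (γ i : ℕ) = α i then 1 else 0

/-- The coefficient of `x^(γ)` in `x^(α) x^(β)`: the product of the binomials `C(γ_i, α_i)` if
`γ = α + β`, and `0` otherwise. -/
def structureConst (α β γ : Fin n → Fin p) : ℕ :=
  ∏ i, if (α i : ℕ) + β i = γ i then (γ i : ℕ).choose (α i) else 0

instance : Mul (TruncDP K n p) :=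
  ⟨fun f g γ => ∑ α, ∑ β, (structureConst α β γ : K) * (f α * g β)⟩

instance : One (TruncDP K n p) := ⟨mono 0⟩

theorem mul_apply (f g : TruncDP K n p) (γ : Fin n → Fin p) :
    (f * g) γ = ∑ α, ∑ β, (structureConst α β γ : K) * (f α * g β) := rfl

theorem one_apply (γ : Fin n → Fin p) :
    (1 : TruncDP K n p) γ = if ∀ i, (γ i : ℕ) = 0 then 1 else 0 := rfl

theorem add_apply (f g : TruncDP K n p) (γ : Fin n → Fin p) : (f + g) γ = f γ + g γ := rfl

theorem smul_apply (c : K) (f : TruncDP K n p) (γ : Fin n → Fin p) :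
    (c • f) γ = c * f γ := rfl

@[ext] theorem ext {f g : TruncDP K n p} (h : ∀ γ, f γ = g γ) : f = g := funext h

theorem structureConst_comm (α β γ : Fin n → Fin p) :
    structureConst α β γ = structureConst β α γ := by
  refine Finset.prod_congr rfl fun i _ => ?_
  by_cases h : (α i : ℕ) + β i = γ i
  · rw [if_pos h, if_pos (by omega)]
    exact Nat.choose_symm_of_eq_add (by omega)
  · rw [if_neg h, if_neg (by omega)]

theorem structureConst_assoc (α β δ γ : Fin n → Fin p) :
    ∑ μ, structureConst α β μ * structureConst μ δ γ =
      ∑ μ, structureConst β δ μ * structureConst α μ γ := by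
  simp only [structureConst, ← Finset.prod_mul_distrib]
  rw [← Fintype.piFinset_univ,
    Finset.sum_prod_piFinset (Finset.univ : Finset (Fin p))
      (fun i m => (if (α i : ℕ) + β i = m then (m : ℕ).choose (α i) else 0) *
        (if (m : ℕ) + δ i = γ i then (γ i : ℕ).choose m else 0)),
    Finset.sum_prod_piFinset (Finset.univ : Finset (Fin p))
      (fun i m => (if (β i : ℕ) + δ i = m then (m : ℕ).choose (β i) else 0) *
        (if (α i : ℕ) + m = γ i then (γ i : ℕ).choose (α i) else 0))]
  refine Finset.prod_congr rfl fun i _ => ?_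
  by_cases h : (α i : ℕ) + β i + δ i = γ i
  · have hγ := (γ i).isLt
    rw [Finset.sum_eq_single (⟨α i + β i, by omega⟩ : Fin p),
      Finset.sum_eq_single (⟨β i + δ i, by omega⟩ : Fin p)]
    · simp only [if_true]
      rw [if_pos h, if_pos (by omega)]
      have := Nat.choose_mul (n := (γ i : ℕ)) (k := α i + β i) (s := α i) (by omega)
      have h2 : (γ i : ℕ) - α i = β i + δ i := by omega
      rw [h2, Nat.add_sub_cancel_left] at this
      rw [mul_comm, this, mul_comm]
    · intro b _ hb
      rw [if_neg (fun h' => hb (Fin.ext h'.symm)), zero_mul]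
    · simp
    · intro b _ hb
      rw [if_neg (fun h' => hb (Fin.ext h'.symm)), zero_mul]
    · simp
  · rw [Finset.sum_eq_zero, Finset.sum_eq_zero]
    · intro m _
      by_cases h1 : (β i : ℕ) + δ i = m
      · rw [if_neg (by omega : ¬ ((α i : ℕ) + m = γ i)), mul_zero]
      · rw [if_neg h1, zero_mul]
    · intro m _
      by_cases h1 : (α i : ℕ) + β i = m
      · rw [if_neg (by omega : ¬ ((m : ℕ) + δ i = γ i)), mul_zero]
      · rw [if_neg h1, zero_mul]

theorem structureConst_zero_left (α β γ : Fin n → Fin p) (hα : ∀ i, (α i : ℕ) = 0) :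
    structureConst α β γ = if β = γ then 1 else 0 := by
  by_cases h : β = γ
  · subst h
    simp [structureConst, hα]
  · rw [if_neg h]
    obtain ⟨i, hi⟩ := Function.ne_iff.mp h
    refine Finset.prod_eq_zero (Finset.mem_univ i) (if_neg ?_)
    rw [hα, zero_add]
    exact fun h' => hi (Fin.ext h')

protected theorem mul_comm' (f g : TruncDP K n p) : f * g = g * f := by
  ext γ
  rw [mul_apply, mul_apply, Finset.sum_comm]
  refine Finset.sum_congr rfl fun β _ => Finset.sum_congr rfl fun α _ => ?_
  rw [structureConst_comm, mul_comm (f α)]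

protected theorem one_mul' (f : TruncDP K n p) : 1 * f = f := by
  ext γ
  have hz : ∃ z : Fin n → Fin p, ∀ i, (z i : ℕ) = 0 :=
    ⟨fun i => ⟨0, (Nat.zero_le _).trans_lt (γ i).isLt⟩, fun _ => rfl⟩
  obtain ⟨z, hz⟩ := hz
  rw [mul_apply, Finset.sum_eq_single z]
  · rw [Finset.sum_eq_single γ]
    · simp [one_apply, hz, structureConst_zero_left z _ _ hz]
    · intro b _ hb
      simp [structureConst_zero_left z _ _ hz, hb]
    · simp
  · intro b _ hb
    have : ¬ ∀ i, (b i : ℕ) = 0 := fun h =>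
      hb (funext fun i => Fin.ext ((h i).trans (hz i).symm))
    simp [one_apply, this]
  · simp

theorem sum_rotate {ι : Type*} [Fintype ι] (G : ι → ι → ι → ι → K) :
    ∑ a, ∑ b, ∑ c, ∑ d, G a b c d = ∑ c, ∑ d, ∑ b, ∑ a, G a b c d := by
  calc ∑ a, ∑ b, ∑ c, ∑ d, G a b c d = ∑ a, ∑ c, ∑ b, ∑ d, G a b c d :=
        Finset.sum_congr rfl fun a _ => Finset.sum_comm
    _ = ∑ c, ∑ a, ∑ b, ∑ d, G a b c d := Finset.sum_comm
    _ = ∑ c, ∑ a, ∑ d, ∑ b, G a b c d :=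
        Finset.sum_congr rfl fun c _ => Finset.sum_congr rfl fun a _ => Finset.sum_comm
    _ = ∑ c, ∑ d, ∑ a, ∑ b, G a b c d := Finset.sum_congr rfl fun c _ => Finset.sum_comm
    _ = ∑ c, ∑ d, ∑ b, ∑ a, G a b c d :=
        Finset.sum_congr rfl fun c _ => Finset.sum_congr rfl fun d _ => Finset.sum_comm

protected theorem mul_assoc' (f g h : TruncDP K n p) : f * g * h = f * (g * h) := by
  ext γ
  have e1 : (f * g * h) γ = ∑ α, ∑ β, ∑ δ,
      ((∑ μ, structureConst α β μ * structureConst μ δ γ : ℕ) : K) * (f α * g β * h δ) := by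
    simp only [mul_apply, Finset.mul_sum, Finset.sum_mul, Nat.cast_sum, Nat.cast_mul]
    rw [sum_rotate]
    refine Finset.sum_congr rfl fun α _ => Finset.sum_congr rfl fun β _ =>
      Finset.sum_congr rfl fun δ _ => Finset.sum_congr rfl fun μ _ => ?_
    ring
  have e2 : (f * (g * h)) γ = ∑ α, ∑ β, ∑ δ,
      ((∑ μ, structureConst β δ μ * structureConst α μ γ : ℕ) : K) * (f α * g β * h δ) := by
    simp only [mul_apply, Finset.mul_sum, Finset.sum_mul, Nat.cast_sum, Nat.cast_mul]
    refine Finset.sum_congr rfl fun α _ => ?_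
    rw [Finset.sum_comm]
    refine Finset.sum_congr rfl fun β _ => ?_
    rw [Finset.sum_comm]
    refine Finset.sum_congr rfl fun δ _ => Finset.sum_congr rfl fun μ _ => ?_
    ring
  rw [e1, e2]
  simp only [structureConst_assoc]

instance : CommRing (TruncDP K n p) :=
  { (inferInstance : AddCommGroup (TruncDP K n p)),
    (inferInstance : Mul (TruncDP K n p)),
    (inferInstance : One (TruncDP K n p)) with
    mul_assoc := TruncDP.mul_assoc'
    mul_comm := TruncDP.mul_comm'
    one_mul := TruncDP.one_mul'
    mul_one := fun f => by rw [TruncDP.mul_comm', TruncDP.one_mul']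
    left_distrib := fun f g h => by
      ext γ
      simp only [mul_apply, add_apply, mul_add, Finset.sum_add_distrib]
    right_distrib := fun f g h => by
      ext γ
      simp only [mul_apply, add_apply, add_mul, mul_add, Finset.sum_add_distrib]
    zero_mul := fun f => by
      ext γ
      rw [mul_apply]
      exact Finset.sum_eq_zero fun α _ => Finset.sum_eq_zero fun β _ => by
        change _ * ((0 : K) * _) = 0
        rw [zero_mul, mul_zero]
    mul_zero := fun f => by
      ext γ
      rw [mul_apply]
      exact Finset.sum_eq_zero fun α _ => Finset.sum_eq_zero fun β _ => by
        change _ * (_ * (0 : K)) = 0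
        rw [mul_zero, mul_zero] }

theorem smul_mul' (c : K) (f g : TruncDP K n p) : c • f * g = c • (f * g) := by
  ext γ
  simp only [mul_apply, smul_apply, Finset.mul_sum]
  exact Finset.sum_congr rfl fun α _ => Finset.sum_congr rfl fun β _ => by ring

instance : Algebra K (TruncDP K n p) :=
  Algebra.ofModule smul_mul' fun c f g => by
    rw [mul_comm, smul_mul', mul_comm]

/-- The multi-index `ε_j`. -/
abbrev eps (j : Fin n) : Fin n → ℕ := Pi.single j 1

/-- The matrix of `D_j`: the entry is `1` if `α = γ + ε_j` and `0` otherwise. -/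
def shiftConst (j : Fin n) (α γ : Fin n → Fin p) : ℕ :=
  ∏ i, if (α i : ℕ) = γ i + eps j i then 1 else 0

/-- The linear map `D_j`, `x^(α) ↦ x^(α - ε_j)`: the coefficient of `D_j f` at `x^(γ)` is the
coefficient of `f` at `x^(γ + ε_j)`. -/
def partialLin (j : Fin n) : TruncDP K n p →ₗ[K] TruncDP K n p where
  toFun f := fun γ => ∑ α, (shiftConst j α γ : K) * f α
  map_add' f g := by
    ext γ
    change ∑ α, (shiftConst j α γ : K) * (f α + g α) = (∑ α, _) + (∑ α, _)
    simp only [mul_add, Finset.sum_add_distrib]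
  map_smul' c f := by
    ext γ
    change ∑ α, (shiftConst j α γ : K) * (c * f α) = c * (∑ α, _)
    rw [Finset.mul_sum]
    exact Finset.sum_congr rfl fun α _ => by ring

theorem partialLin_apply (j : Fin n) (f : TruncDP K n p) (γ : Fin n → Fin p) :
    partialLin j f γ = ∑ α, (shiftConst j α γ : K) * f α := rfl

theorem sum_prod_eq (F : Fin n → Fin p → K) :
    ∑ μ : Fin n → Fin p, ∏ i, F i (μ i) = ∏ i, ∑ m, F i m := by
  rw [← Fintype.piFinset_univ, Finset.sum_prod_piFinset]

theorem mono_apply (α : Fin n → ℕ) (γ : Fin n → Fin p) :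
    (mono α : TruncDP K n p) γ = if ∀ i, (γ i : ℕ) = α i then 1 else 0 := rfl

theorem mono_val_apply (α γ : Fin n → Fin p) :
    (mono (fun i => (α i : ℕ)) : TruncDP K n p) γ = if γ = α then 1 else 0 := by
  rw [mono_apply]
  congr 1
  simp only [funext_iff, Fin.ext_iff]

theorem eq_sum_mono (f : TruncDP K n p) :
    f = ∑ α : Fin n → Fin p, f α • (mono (fun i => (α i : ℕ)) : TruncDP K n p) := by
  ext γ
  have : (∑ α : Fin n → Fin p, f α • (mono (fun i => (α i : ℕ)) : TruncDP K n p)) γ =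
      ∑ α : Fin n → Fin p, f α * (mono (fun i => (α i : ℕ)) : TruncDP K n p) γ :=
    Finset.sum_apply γ Finset.univ
      (fun α => (f α • (mono (fun i => (α i : ℕ)) : TruncDP K n p) : (Fin n → Fin p) → K))
  rw [this, Finset.sum_eq_single γ]
  · simp [mono_val_apply]
  · intro b _ hb
    simp [mono_val_apply, hb.symm]
  · simp

/-- `x^(α) x^(β) = C(α+β, α) x^(α+β)`. -/
theorem mono_mul_mono (α β : Fin n → ℕ) (hα : ∀ i, α i < p) (hβ : ∀ i, β i < p) :
    (mono α * mono β : TruncDP K n p) =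
      ((∏ i, (α i + β i).choose (α i) : ℕ) : K) • mono (α + β) := by
  obtain ⟨a, rfl⟩ : ∃ a : Fin n → Fin p, α = fun i => (a i : ℕ) := ⟨fun i => ⟨α i, hα i⟩, rfl⟩
  obtain ⟨b, rfl⟩ : ∃ b : Fin n → Fin p, β = fun i => (b i : ℕ) := ⟨fun i => ⟨β i, hβ i⟩, rfl⟩
  ext γ
  have e : (mono (fun i => (a i : ℕ)) * mono (fun i => (b i : ℕ)) : TruncDP K n p) γ =
      structureConst a b γ := by
    rw [mul_apply, Finset.sum_eq_single a, Finset.sum_eq_single b]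
    · simp [mono_val_apply]
    · intro c _ hc
      simp [mono_val_apply, hc]
    · simp
    · intro c _ hc
      simp [mono_val_apply, hc]
    · simp
  rw [e, smul_apply, mono_apply]
  split_ifs with h
  · rw [mul_one, structureConst]
    congr 1
    refine Finset.prod_congr rfl fun i _ => ?_
    have := h i
    simp only [Pi.add_apply] at this
    rw [if_pos this.symm, this]
  · rw [mul_zero]
    obtain ⟨i, hi⟩ := not_forall.mp h
    rw [structureConst, Finset.prod_eq_zero (Finset.mem_univ i), Nat.cast_zero]
    exact if_neg fun h' => hi h'.symm

variable [Fact p.Prime] [CharP K p]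

theorem leibniz_aux (a b g : Fin p) :
    (∑ m : Fin p, (if (m : ℕ) = g + 1 then (1 : K) else 0) *
        (if (a : ℕ) + b = m then ((m : ℕ).choose a : K) else 0)) =
      (∑ m : Fin p, (if (a : ℕ) = m + 1 then (1 : K) else 0) *
        (if (m : ℕ) + b = g then ((g : ℕ).choose m : K) else 0)) +
      (∑ m : Fin p, (if (b : ℕ) = m + 1 then (1 : K) else 0) *
        (if (a : ℕ) + m = g then ((g : ℕ).choose a : K) else 0)) := by
  have ha := a.isLt
  have hb := b.isLt
  have hg := g.isLt
  have hp : p.Prime := Fact.out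
  by_cases h : (a : ℕ) + b = g + 1
  · have eL : (∑ m : Fin p, (if (m : ℕ) = g + 1 then (1 : K) else 0) *
        (if (a : ℕ) + b = m then ((m : ℕ).choose a : K) else 0)) =
        if (g : ℕ) + 1 < p then (((g : ℕ) + 1).choose a : K) else 0 := by
      split_ifs with h1
      · rw [Finset.sum_eq_single (⟨g + 1, h1⟩ : Fin p)]
        · simp [h]
        · intro m _ hm
          rw [if_neg (fun h' => hm (Fin.ext h')), zero_mul]
        · simp
      · refine Finset.sum_eq_zero fun m _ => ?_
        have := m.isLt
        rw [if_neg (by omega), zero_mul]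
    have eR1 : (∑ m : Fin p, (if (a : ℕ) = m + 1 then (1 : K) else 0) *
        (if (m : ℕ) + b = g then ((g : ℕ).choose m : K) else 0)) =
        if 0 < (a : ℕ) then ((g : ℕ).choose (a - 1) : K) else 0 := by
      split_ifs with h1
      · rw [Finset.sum_eq_single (⟨a - 1, by omega⟩ : Fin p)]
        · simp only
          rw [if_pos (by omega), if_pos (by omega), one_mul]
        · intro m _ hm
          rw [if_neg (fun h' => hm (Fin.ext (by simp only; omega))), zero_mul]
        · simp
      · refine Finset.sum_eq_zero fun m _ => ?_
        rw [if_neg (by omega), zero_mul]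
    have eR2 : (∑ m : Fin p, (if (b : ℕ) = m + 1 then (1 : K) else 0) *
        (if (a : ℕ) + m = g then ((g : ℕ).choose a : K) else 0)) =
        if 0 < (b : ℕ) then ((g : ℕ).choose a : K) else 0 := by
      split_ifs with h1
      · rw [Finset.sum_eq_single (⟨b - 1, by omega⟩ : Fin p)]
        · simp only
          rw [if_pos (by omega), if_pos (by omega), one_mul]
        · intro m _ hm
          rw [if_neg (fun h' => hm (Fin.ext (by simp only; omega))), zero_mul]
        · simp
      · refine Finset.sum_eq_zero fun m _ => ?_
        rw [if_neg (by omega), zero_mul]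
    rw [eL, eR1, eR2]
    rcases Nat.eq_zero_or_pos (a : ℕ) with h0 | h0
    · rw [if_pos (by omega), if_neg (by omega), if_pos (by omega), h0]
      simp
    · rcases Nat.eq_zero_or_pos (b : ℕ) with h1 | h1
      · rw [if_pos (by omega), if_pos (by omega), if_neg (by omega)]
        have h2 : (a : ℕ) = g + 1 := by omega
        simp [h2]
      · rw [if_pos h0, if_pos h1]
        obtain ⟨a', ha'⟩ : ∃ a', (a : ℕ) = a' + 1 := ⟨a - 1, by omega⟩
        have pascal : (((g : ℕ).choose (a - 1) : ℕ) : K) + ((g : ℕ).choose a : ℕ) =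
            (((g : ℕ) + 1).choose a : ℕ) := by
          rw [ha', Nat.add_sub_cancel, Nat.choose_succ_succ, Nat.cast_add]
        rw [pascal]
        split_ifs with h2
        · rfl
        · have h3 : (g : ℕ) + 1 = p := by omega
          rw [h3]
          exact ((CharP.cast_eq_zero_iff K p _).mpr
            (hp.dvd_choose_self h0.ne' ha)).symm
  · rw [Finset.sum_eq_zero, Finset.sum_eq_zero, Finset.sum_eq_zero, add_zero]
    · intro m _
      by_cases h1 : (b : ℕ) = m + 1
      · rw [if_neg (by omega : ¬ ((a : ℕ) + m = g)), mul_zero]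
      · rw [if_neg h1, zero_mul]
    · intro m _
      by_cases h1 : (a : ℕ) = m + 1
      · rw [if_neg (by omega : ¬ ((m : ℕ) + b = g)), mul_zero]
      · rw [if_neg h1, zero_mul]
    · intro m _
      by_cases h1 : (m : ℕ) = g + 1
      · rw [if_neg (by omega : ¬ ((a : ℕ) + b = m)), mul_zero]
      · rw [if_neg h1, zero_mul]

theorem shiftConst_structureConst (j : Fin n) (α β γ : Fin n → Fin p) :
    (∑ μ, (shiftConst j μ γ : K) * structureConst α β μ) =
      (∑ μ, (shiftConst j α μ : K) * structureConst μ β γ) +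
      ∑ μ, (shiftConst j β μ : K) * structureConst α μ γ := by
  simp only [shiftConst, structureConst, Nat.cast_prod, ← Finset.prod_mul_distrib]
  simp only [Nat.cast_ite, Nat.cast_one, Nat.cast_zero]
  rw [sum_prod_eq (fun i m => (if (m : ℕ) = γ i + eps j i then (1 : K) else 0) *
      (if (α i : ℕ) + β i = m then ((m : ℕ).choose (α i) : K) else 0)),
    sum_prod_eq (fun i m => (if (α i : ℕ) = m + eps j i then (1 : K) else 0) *
      (if (m : ℕ) + β i = γ i then ((γ i : ℕ).choose m : K) else 0)),
    sum_prod_eq (fun i m => (if (β i : ℕ) = m + eps j i then (1 : K) else 0) *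
      (if (α i : ℕ) + m = γ i then ((γ i : ℕ).choose (α i) : K) else 0))]
  rw [← Finset.mul_prod_erase _ _ (Finset.mem_univ j), ← Finset.mul_prod_erase _ _ (Finset.mem_univ j),
    ← Finset.mul_prod_erase _ _ (Finset.mem_univ j)]
  have key : ∀ i ∈ Finset.univ.erase j, eps j i = 0 := fun i hi =>
    Pi.single_eq_of_ne (Finset.ne_of_mem_erase hi) _
  have single : ∀ (c : Fin p) (G : Fin p → K),
      ∑ m : Fin p, (if (m : ℕ) = c then (1 : K) else 0) * G m = G c := by
    intro c G
    rw [Finset.sum_eq_single c]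
    · simp
    · intro m _ hm
      rw [if_neg (fun h => hm (Fin.ext h)), zero_mul]
    · simp
  have single' : ∀ (c : Fin p) (G : Fin p → K),
      ∑ m : Fin p, (if (c : ℕ) = m then (1 : K) else 0) * G m = G c := by
    intro c G
    simp only [eq_comm (a := (c : ℕ))]
    exact single c G
  have e1 := Finset.prod_congr (rfl : Finset.univ.erase j = Finset.univ.erase j) fun i hi =>
    show (∑ m : Fin p, (if (m : ℕ) = γ i + eps j i then (1 : K) else 0) *
      (if (α i : ℕ) + β i = m then ((m : ℕ).choose (α i) : K) else 0)) =
      (if (α i : ℕ) + β i = γ i then ((γ i : ℕ).choose (α i) : K) else 0) by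
    rw [key i hi]
    exact single _ fun m => if (α i : ℕ) + β i = m then ((m : ℕ).choose (α i) : K) else 0
  have e2 := Finset.prod_congr (rfl : Finset.univ.erase j = Finset.univ.erase j) fun i hi =>
    show (∑ m : Fin p, (if (α i : ℕ) = m + eps j i then (1 : K) else 0) *
      (if (m : ℕ) + β i = γ i then ((γ i : ℕ).choose m : K) else 0)) =
      (if (α i : ℕ) + β i = γ i then ((γ i : ℕ).choose (α i) : K) else 0) by
    rw [key i hi]
    exact single' _ fun m => if (m : ℕ) + β i = γ i then ((γ i : ℕ).choose m : K) else 0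
  have e3 := Finset.prod_congr (rfl : Finset.univ.erase j = Finset.univ.erase j) fun i hi =>
    show (∑ m : Fin p, (if (β i : ℕ) = m + eps j i then (1 : K) else 0) *
      (if (α i : ℕ) + m = γ i then ((γ i : ℕ).choose (α i) : K) else 0)) =
      (if (α i : ℕ) + β i = γ i then ((γ i : ℕ).choose (α i) : K) else 0) by
    rw [key i hi]
    exact single' _ fun m => if (α i : ℕ) + m = γ i then ((γ i : ℕ).choose (α i) : K) else 0
  rw [e1, e2, e3, ← add_mul]
  congr 1
  have hj : eps j j = 1 := Pi.single_eq_same _ _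
  rw [hj]
  exact leibniz_aux _ _ _

/-- `D_j` is a derivation of `O(n;1)`. -/
def pd (j : Fin n) : Derivation K (TruncDP K n p) (TruncDP K n p) :=
  Derivation.mk' (partialLin j) fun f g => by
    ext γ
    have eL : partialLin j (f * g) γ = ∑ α, ∑ β,
        (∑ μ, (shiftConst j μ γ : K) * structureConst α β μ) * (f α * g β) := by
      simp only [partialLin_apply, mul_apply, Finset.mul_sum, Finset.sum_mul]
      rw [Finset.sum_comm]
      refine Finset.sum_congr rfl fun α _ => ?_
      rw [Finset.sum_comm]
      exact Finset.sum_congr rfl fun β _ => Finset.sum_congr rfl fun μ _ => by ring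
    have eR1 : (f * partialLin j g) γ = ∑ α, ∑ β,
        (∑ μ, (shiftConst j β μ : K) * structureConst α μ γ) * (f α * g β) := by
      simp only [partialLin_apply, mul_apply, Finset.mul_sum, Finset.sum_mul]
      refine Finset.sum_congr rfl fun α _ => ?_
      rw [Finset.sum_comm]
      exact Finset.sum_congr rfl fun β _ => Finset.sum_congr rfl fun μ _ => by ring
    have eR2 : (g * partialLin j f) γ = ∑ α, ∑ β,
        (∑ μ, (shiftConst j α μ : K) * structureConst μ β γ) * (f α * g β) := by
      rw [mul_comm]
      simp only [partialLin_apply, mul_apply, Finset.mul_sum, Finset.sum_mul]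
      refine (Finset.sum_congr rfl fun μ _ => Finset.sum_comm).trans ?_
      refine Finset.sum_comm.trans ?_
      refine Finset.sum_congr rfl fun α _ => Finset.sum_comm.trans ?_
      exact Finset.sum_congr rfl fun β _ => Finset.sum_congr rfl fun μ _ => by ring
    change partialLin j (f * g) γ = (f * partialLin j g) γ + (g * partialLin j f) γ
    rw [eL, eR1, eR2, ← Finset.sum_add_distrib]
    refine Finset.sum_congr rfl fun α _ => ?_
    rw [← Finset.sum_add_distrib]
    refine Finset.sum_congr rfl fun β _ => ?_
    rw [shiftConst_structureConst]
    ring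

theorem pd_apply (j : Fin n) (f : TruncDP K n p) (γ : Fin n → Fin p) :
    pd j f γ = ∑ α, (shiftConst j α γ : K) * f α := rfl

theorem eps_lt (j i : Fin n) : eps j i < p := by
  have := (Fact.out : p.Prime).two_le
  by_cases h : i = j
  · subst h; rw [eps, Pi.single_eq_same]; omega
  · rw [eps, Pi.single_eq_of_ne h]; omega

/-- `D_j x^(α + ε_j) = x^(α)`. -/
theorem pd_mono_add (j : Fin n) (α : Fin n → ℕ) (hα : ∀ i, α i + eps j i < p) :
    pd j (mono (α + eps j) : TruncDP K n p) = mono α := by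
  obtain ⟨a, ha⟩ : ∃ a : Fin n → Fin p, α + eps j = fun i => (a i : ℕ) :=
    ⟨fun i => ⟨_, hα i⟩, rfl⟩
  ext γ
  rw [pd_apply, ha, Finset.sum_eq_single a]
  · rw [mono_val_apply, if_pos rfl, mul_one, mono_apply]
    have h2 : ∀ i, (a i : ℕ) = α i + eps j i := fun i => (congrFun ha i).symm
    split_ifs with h
    · rw [shiftConst, Finset.prod_eq_one, Nat.cast_one]
      intro i _
      rw [if_pos (by rw [h2, h])]
    · obtain ⟨i, hi⟩ := not_forall.mp h
      rw [shiftConst, Finset.prod_eq_zero (Finset.mem_univ i), Nat.cast_zero]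
      rw [if_neg]
      rw [h2]
      intro h'
      exact hi (by omega)
  · intro c _ hc
    rw [mono_val_apply, if_neg hc, mul_zero]
  · simp

/-- `D_j x^(α) = 0` if `α_j = 0`. -/
theorem pd_mono_zero (j : Fin n) (α : Fin n → ℕ) (hα : α j = 0) :
    pd j (mono α : TruncDP K n p) = 0 := by
  ext γ
  rw [pd_apply]
  refine Finset.sum_eq_zero fun c _ => ?_
  rw [mono_apply]
  by_cases h : ∀ i, (c i : ℕ) = α i
  · rw [shiftConst, Finset.prod_eq_zero (Finset.mem_univ j), Nat.cast_zero, zero_mul]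
    rw [if_neg]
    rw [h, hα, eps, Pi.single_eq_same]
    omega
  · rw [if_neg h, mul_zero]

/-- `x_i = x^(ε_i)`. -/
abbrev var (i : Fin n) : TruncDP K n p := mono (eps i)

theorem pd_var (i j : Fin n) :
    pd j (var i : TruncDP K n p) = if i = j then 1 else 0 := by
  split_ifs with h
  · subst h
    have := pd_mono_add (K := K) (p := p) i 0 (fun l => by simpa using eps_lt i l)
    rw [zero_add] at this
    exact this
  · exact pd_mono_zero j _ (Pi.single_eq_of_ne (Ne.symm h) _)

theorem var_mul_mono (i : Fin n) (α : Fin n → ℕ) (hα : ∀ l, α l + eps i l < p) :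
    (var i * mono α : TruncDP K n p) = ((α i + 1 : ℕ) : K) • mono (α + eps i) := by
  rw [mono_mul_mono _ _ (eps_lt i) (fun l => (Nat.le_add_right _ _).trans_lt (hα l)),
    add_comm (eps i) α]
  congr 2
  rw [Finset.prod_eq_single i]
  · rw [eps, Pi.single_eq_same, add_comm, Nat.choose_one_right]
  · intro b _ hb
    rw [eps, Pi.single_eq_of_ne hb, Nat.choose_zero_right]
  · simp

theorem exists_sub_eps (α : Fin n → ℕ) (i : Fin n) (hi : α i ≠ 0) :
    ∃ β : Fin n → ℕ, α = β + eps i ∧ β i + 1 = α i := by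
  refine ⟨α - eps i, ?_, ?_⟩
  · ext l
    by_cases h : l = i
    · subst h
      simp only [Pi.add_apply, Pi.sub_apply, eps, Pi.single_eq_same]
      omega
    · simp [eps, Pi.single_eq_of_ne h]
  · simp only [Pi.sub_apply, eps, Pi.single_eq_same]
    omega

/-- The Euler operators: `x_i D_i x^(α) = α_i x^(α)`. -/
theorem var_mul_pd_mono (i : Fin n) (α : Fin n → ℕ) (hα : ∀ l, α l < p) :
    (var i * pd i (mono α) : TruncDP K n p) = (α i : K) • mono α := by
  by_cases h : α i = 0
  · rw [pd_mono_zero i α h, h, mul_zero, Nat.cast_zero, zero_smul]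
  · obtain ⟨β, rfl, hb⟩ := exists_sub_eps α i h
    rw [pd_mono_add i β hα, var_mul_mono i β hα, hb]

/-- A derivation of `O(n;1)` is determined by its values on the `x_i`. -/
theorem derivation_ext (E F : Derivation K (TruncDP K n p) (TruncDP K n p))
    (h : ∀ i, E (var i) = F (var i)) : E = F := by
  have key : ∀ (s : ℕ) (α : Fin n → ℕ), ∑ i, α i = s → (∀ i, α i < p) →
      E (mono α) = F (mono α) := by
    intro s
    induction s with
    | zero =>
      intro α hs _
      have : α = 0 := funext fun i => by
        have := (Finset.sum_eq_zero_iff.mp hs) i (Finset.mem_univ i)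
        simpa using this
      subst this
      have h1 : (mono 0 : TruncDP K n p) = 1 := rfl
      rw [h1, Derivation.map_one_eq_zero, Derivation.map_one_eq_zero]
    | succ s ih =>
      intro α hs hα
      obtain ⟨i, hi⟩ : ∃ i, α i ≠ 0 := by
        by_contra hcon
        push Not at hcon
        simp [hcon] at hs
      obtain ⟨β, rfl, hb⟩ := exists_sub_eps α i hi
      have hβ : ∀ l, β l < p := fun l => (Nat.le_add_right _ _).trans_lt (hα l)
      have hsum : ∑ l, β l = s := by
        have : ∑ l, (β + eps i) l = ∑ l, β l + 1 := by
          simp [Finset.sum_add_distrib]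
        omega
      have hne : ((β i + 1 : ℕ) : K) ≠ 0 := by
        rw [Ne, CharP.cast_eq_zero_iff K p]
        intro hd
        have := Nat.le_of_dvd (Nat.succ_pos _) hd
        have := hα i
        omega
      have hv := var_mul_mono (K := K) i β hα
      have e1 := congrArg E hv
      have e2 := congrArg F hv
      rw [Derivation.leibniz, Derivation.map_smul, ih β hsum hβ, h i] at e1
      rw [Derivation.leibniz, Derivation.map_smul, e1] at e2
      exact smul_right_injective _ hne e2
  refine Derivation.ext fun f => ?_
  rw [eq_sum_mono f, map_sum, map_sum]
  refine Finset.sum_congr rfl fun α _ => ?_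
  rw [Derivation.map_smul, Derivation.map_smul, key _ _ rfl fun i => (α i).isLt]

theorem pd_pd_comm (i j : Fin n) (f : TruncDP K n p) :
    pd i (pd j f) = pd j (pd i f) := by
  have : ⁅(pd i : Derivation K (TruncDP K n p) (TruncDP K n p)),
      (pd j : Derivation K (TruncDP K n p) (TruncDP K n p))⁆ = 0 := by
    refine derivation_ext _ _ fun l => ?_
    rw [Derivation.commutator_apply, pd_var, pd_var]
    split_ifs <;> simp
  have h := congrArg
    (fun E : Derivation K (TruncDP K n p) (TruncDP K n p) => E f) this
  rw [Derivation.commutator_apply] at h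
  exact sub_eq_zero.mp h

theorem sum_derivation_apply (F : Fin n → Derivation K (TruncDP K n p) (TruncDP K n p))
    (f : TruncDP K n p) : (∑ i, F i) f = ∑ i, F i f := by
  rw [← Derivation.coeFnAddMonoidHom_apply, map_sum, Finset.sum_apply]
  rfl

theorem derivation_apply (E : Derivation K (TruncDP K n p) (TruncDP K n p))
    (f : TruncDP K n p) : E f = ∑ i, E (var i) * pd i f := by
  have : E = ∑ i, E (var i) • pd i := by
    refine derivation_ext _ _ fun l => ?_
    rw [sum_derivation_apply, Finset.sum_eq_single l]
    · simp [pd_var]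
    · intro b _ hb
      simp [pd_var, hb.symm]
    · simp
  conv_lhs => rw [this]
  rw [sum_derivation_apply]
  rfl

end TruncDP

open TruncDP

/-- The Jacobson-Witt algebra `W(n;1) = Der_K O(n;1)`. -/
abbrev WittAlg (K : Type*) [Field K] (n p : ℕ) : Type _ :=
  Derivation K (TruncDP K n p) (TruncDP K n p)

/-- A Hopf algebra structure on an `R`-algebra `A` whose product and unit are the given ones. -/
structure HopfStructure (R A : Type*) [CommRing R] [Ring A] [Algebra R A] extends
    Coalgebra R A where
  counit_one : counit 1 = 1
  counit_mul : ∀ a b, counit (a * b) = counit a * counit b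
  comul_one : comul 1 = 1
  comul_mul : ∀ a b, comul (a * b) = comul a * comul b
  antipode : A →ₗ[R] A
  mul_antipode_rTensor_comul :
    LinearMap.mul' R A ∘ₗ antipode.rTensor A ∘ₗ comul = Algebra.linearMap R A ∘ₗ counit
  mul_antipode_lTensor_comul :
    LinearMap.mul' R A ∘ₗ antipode.lTensor A ∘ₗ comul = Algebra.linearMap R A ∘ₗ counit

/-- The corresponding Hopf algebra in the sense of Mathlib. -/
abbrev HopfStructure.toHopfAlgebra {R A : Type*} [CommRing R] [Ring A] [Algebra R A]
    (H : HopfStructure R A) : HopfAlgebra R A :=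
  letI := H.toCoalgebra
  letI := Bialgebra.mk' R A H.counit_one (H.counit_mul _ _) H.comul_one (H.comul_mul _ _)
  { antipode := H.antipode
    mul_antipode_rTensor_comul := H.mul_antipode_rTensor_comul
    mul_antipode_lTensor_comul := H.mul_antipode_lTensor_comul }

section SpecialAlgebra

variable {K : Type*} [Field K] {n p : ℕ} [Fact p.Prime] [CharP K p]

/-- The divergence `Div (∑ a_i D_i) = ∑ D_i a_i`; note that `a_i = E x_i` for
`E = ∑ a_i D_i`. -/
def Div : WittAlg K n p →ₗ[K] TruncDP K n p where
  toFun E := ∑ i, pd i (E (var i))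
  map_add' E F := by simp [Finset.sum_add_distrib]
  map_smul' c E := by simp [Finset.smul_sum]

theorem Div_apply (E : WittAlg K n p) : Div E = ∑ i, pd i (E (var i)) := rfl

theorem Div_lie (E F : WittAlg K n p) : Div ⁅E, F⁆ = E (Div F) - F (Div E) := by
  have aux : ∀ A B : WittAlg K n p, ∑ i, pd i (A (B (var i))) =
      (∑ i, ∑ j, pd i (A (var j)) * pd j (B (var i))) + A (Div B) := by
    intro A B
    have h1 : ∀ i, pd i (A (B (var i))) =
        (∑ j, pd i (A (var j)) * pd j (B (var i))) +
          ∑ j, A (var j) * pd j (pd i (B (var i))) := by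
      intro i
      rw [derivation_apply A, map_sum, ← Finset.sum_add_distrib]
      refine Finset.sum_congr rfl fun j _ => ?_
      rw [Derivation.leibniz, pd_pd_comm i j, smul_eq_mul, smul_eq_mul]
      ring
    rw [Finset.sum_congr rfl fun i _ => h1 i, Finset.sum_add_distrib, Div_apply, map_sum]
    congr 1
    exact Finset.sum_congr rfl fun i _ => (derivation_apply A _).symm
  rw [Div_apply]
  simp only [Derivation.commutator_apply, map_sub, Finset.sum_sub_distrib]
  rw [aux E F, aux F E, Finset.sum_comm]
  have : ∀ i j, pd j (E (var i)) * pd i (F (var j)) = pd i (F (var j)) * pd j (E (var i)) :=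
    fun i j => mul_comm _ _
  simp only [this]
  ring

variable (K n p) in
/-- `S'(n;1)`, the subalgebra of divergence-free elements of `W(n;1)`. -/
def SpecialPrime : LieSubalgebra K (WittAlg K n p) where
  __ := LinearMap.ker (Div : WittAlg K n p →ₗ[K] TruncDP K n p)
  lie_mem' := by
    intro E F hE hF
    change Div E = 0 at hE
    change Div F = 0 at hF
    change Div ⁅E, F⁆ = 0
    rw [Div_lie, hE, hF, map_zero, map_zero, sub_zero]

theorem mem_SpecialPrime (E : WittAlg K n p) : E ∈ SpecialPrime K n p ↔ Div E = 0 := Iff.rfl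

variable (K n p) in
/-- The special algebra `S(n;1) = [S'(n;1), S'(n;1)]`, as a subalgebra of `W(n;1)`. -/
def Special : LieSubalgebra K (WittAlg K n p) :=
  (LieAlgebra.derivedSeries K (SpecialPrime K n p) 1).toLieSubalgebra.map
    (SpecialPrime K n p).incl

theorem lie_mem_Special {E F : WittAlg K n p} (hE : Div E = 0) (hF : Div F = 0) :
    ⁅E, F⁆ ∈ Special K n p := by
  refine (LieSubalgebra.mem_map _ _ _).mpr ⟨⁅(⟨E, hE⟩ : SpecialPrime K n p), ⟨F, hF⟩⁆, ?_, rfl⟩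
  exact LieSubmodule.lie_mem_lie (LieSubmodule.mem_top _) (LieSubmodule.mem_top _)

/-- `D_ij(f) = D_j(f) D_i - D_i(f) D_j`. -/
def Dij (i j : Fin n) : TruncDP K n p →ₗ[K] WittAlg K n p where
  toFun f := pd j f • pd i - pd i f • pd j
  map_add' f g := by
    rw [map_add, map_add, add_smul, add_smul]
    abel
  map_smul' c f := by
    rw [Derivation.map_smul, Derivation.map_smul, smul_assoc, smul_assoc, smul_sub]
    rfl

theorem Dij_apply (i j : Fin n) (f g : TruncDP K n p) :
    Dij i j f g = pd j f * pd i g - pd i f * pd j g := rfl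

theorem Dij_swap (i j : Fin n) (f : TruncDP K n p) : Dij j i f = -Dij i j f := by
  refine Derivation.ext fun g => ?_
  rw [Derivation.neg_apply, Dij_apply, Dij_apply, neg_sub]

theorem Dij_self (i : Fin n) (f : TruncDP K n p) : Dij i i f = 0 :=
  sub_self _

theorem Div_Dij (i j : Fin n) (f : TruncDP K n p) : Div (Dij i j f) = 0 := by
  have h : ∀ l, pd l (Dij i j f (var l)) =
      (if l = i then pd i (pd j f) else 0) - if l = j then pd j (pd i f) else 0 := by
    intro l
    rw [Dij_apply, pd_var, pd_var, map_sub]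
    congr 1
    · split_ifs with h
      · subst h; rw [mul_one]
      · rw [mul_zero, map_zero]
    · split_ifs with h
      · subst h; rw [mul_one]
      · rw [mul_zero, map_zero]
  rw [Div_apply, Finset.sum_congr rfl fun l _ => h l, Finset.sum_sub_distrib,
    Finset.sum_ite_eq', Finset.sum_ite_eq']
  simp [pd_pd_comm i j]

theorem Div_pd (i : Fin n) : Div (pd i : WittAlg K n p) = 0 := by
  rw [Div_apply]
  refine Finset.sum_eq_zero fun l _ => ?_
  rw [pd_var]
  split_ifs <;> simp

theorem lie_pd_Dij (l i j : Fin n) (f : TruncDP K n p) :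
    ⁅(pd l : WittAlg K n p), Dij i j f⁆ = Dij i j (pd l f) := by
  refine Derivation.ext fun g => ?_
  rw [Derivation.commutator_apply, Dij_apply, Dij_apply, Dij_apply, map_sub,
    Derivation.leibniz, Derivation.leibniz]
  simp only [smul_eq_mul, pd_pd_comm l i, pd_pd_comm l j]
  ring

theorem exists_ne_ne (hn : 3 ≤ n) (i j : Fin n) : ∃ l, l ≠ i ∧ l ≠ j := by
  by_contra hcon
  push Not at hcon
  have : (Finset.univ : Finset (Fin n)) ⊆ {i, j} := fun l _ => by
    by_cases h : l = i
    · simp [h]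
    · simp [hcon l h]
  have h2 := (Finset.card_le_card this).trans Finset.card_le_two
  simp at h2
  omega

/-- For `n ≥ 3` all `D_ij(f)` lie in the special algebra. -/
theorem Dij_mem (hn : 3 ≤ n) (i j : Fin n) (f : TruncDP K n p) :
    Dij i j f ∈ Special K n p := by
  rcases eq_or_ne i j with rfl | hij
  · rw [Dij_self]; exact zero_mem _
  rw [eq_sum_mono f, map_sum]
  refine sum_mem fun a _ => ?_
  rw [map_smul]
  refine (Special K n p).smul_mem _ ?_
  by_cases htop : ∃ l, (a l : ℕ) + 1 < p
  · obtain ⟨l, hl⟩ := htop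
    rw [← pd_mono_add l, ← lie_pd_Dij]
    · exact lie_mem_Special (Div_pd l) (Div_Dij i j _)
    · intro r
      by_cases hr : r = l
      · subst hr; rw [eps, Pi.single_eq_same]; exact hl
      · rw [eps, Pi.single_eq_of_ne hr]; exact (a r).isLt
  · push Not at htop
    obtain ⟨l, hli, hlj⟩ := exists_ne_ne hn i j
    have hp := (Fact.out : p.Prime).two_le
    have ha : ∀ r, (a r : ℕ) + 1 = p := fun r => le_antisymm (a r).isLt (htop r)
    have hcast : ∀ r, ((a r : ℕ) : K) = -1 := fun r => by
      have := congrArg (fun x : ℕ => (x : K)) (ha r)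
      simp only [Nat.cast_add, Nat.cast_one, CharP.cast_eq_zero] at this
      exact eq_neg_of_add_eq_zero_left this
    set H : WittAlg K n p := (var i : TruncDP K n p) • (pd i : WittAlg K n p) -
      (var l : TruncDP K n p) • (pd l : WittAlg K n p) with hH
    have hDh : Div H = 0 := by
      have h : ∀ r, pd r (H (var r)) =
          ((if r = i then 1 else 0 : TruncDP K n p)) - if r = l then 1 else 0 := by
        intro r
        change pd r ((var i : TruncDP K n p) * pd i (var r : TruncDP K n p) -
          (var l : TruncDP K n p) * pd l (var r : TruncDP K n p)) = _
        rw [pd_var, pd_var, map_sub]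
        congr 1
        · split_ifs with h
          · subst h; rw [mul_one, pd_var, if_pos rfl]
          · rw [mul_zero, map_zero]
        · split_ifs with h
          · subst h; rw [mul_one, pd_var, if_pos rfl]
          · rw [mul_zero, map_zero]
      rw [Div_apply, Finset.sum_congr rfl fun r _ => h r, Finset.sum_sub_distrib]
      simp
    have hbr : ⁅H, (Dij i j (mono fun r => (a r : ℕ)) : WittAlg K n p)⁆ =
        -(Dij i j (mono fun r => (a r : ℕ)) : WittAlg K n p) := by
      set f : TruncDP K n p := mono fun r => (a r : ℕ) with hf
      have hE : ∀ r, (var r : TruncDP K n p) * pd r f = -f := fun r => by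
        rw [hf, var_mul_pd_mono r _ fun s => (a s).isLt, hcast, neg_one_smul]
      have h0 : (var i : TruncDP K n p) * pd i f - (var l : TruncDP K n p) * pd l f = 0 := by
        rw [hE, hE, sub_self]
      have hj := congrArg (pd j : WittAlg K n p) h0
      have hi := congrArg (pd i : WittAlg K n p) h0
      have c1 := pd_pd_comm j i f
      have c2 := pd_pd_comm j l f
      have c3 := pd_pd_comm i l f
      simp only [map_sub, Derivation.leibniz, pd_var, if_neg hij, if_neg hlj, if_neg hli,
        if_true, smul_eq_mul, mul_zero, mul_one, add_zero, map_zero, c1, c2, c3] at hj hi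
      clear_value f
      refine derivation_ext _ _ fun r => ?_
      rw [Derivation.commutator_apply, Derivation.neg_apply]
      change (var i : TruncDP K n p) * pd i (Dij i j f (var r)) -
          (var l : TruncDP K n p) * pd l (Dij i j f (var r)) -
        Dij i j f ((var i : TruncDP K n p) * pd i (var r : TruncDP K n p) -
          (var l : TruncDP K n p) * pd l (var r : TruncDP K n p)) = _
      simp only [Dij_apply, pd_var]
      have hvi : ∀ (s : Fin n) (x : TruncDP K n p), pd s (x * if r = i then 1 else 0) =
          pd s x * if r = i then 1 else 0 := by
        intro s x; split_ifs <;> simp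
      have hvj : ∀ (s : Fin n) (x : TruncDP K n p), pd s (x * if r = j then 1 else 0) =
          pd s x * if r = j then 1 else 0 := by
        intro s x; split_ifs <;> simp
      have hvl : ∀ (s : Fin n) (x : TruncDP K n p), pd s (x * if r = l then 1 else 0) =
          pd s x * if r = l then 1 else 0 := by
        intro s x; split_ifs <;> simp
      simp only [map_sub, hvi, hvj, hvl, pd_var, if_true, if_neg hij, if_neg hli, if_neg hlj,
        zero_mul, mul_zero, sub_zero, one_mul]
      linear_combination (if r = i then 1 else 0) * hj - (if r = j then 1 else 0) * hi
    have := (Special K n p).neg_mem (lie_mem_Special hDh (Div_Dij i j (mono fun r => (a r : ℕ))))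
    rwa [hbr, neg_neg] at this

/-- `D_ij(x^(α))` as an element of the special algebra. -/
def gen (hn : 3 ≤ n) (i j : Fin n) (α : Fin n → ℕ) : Special K n p :=
  ⟨Dij i j (mono α), Dij_mem hn i j _⟩

/-- The canonical generators of the kernel of `U(S(n;1)) → u(S(n;1))`:
`D_ij(x^(ε_i+ε_j))^p - D_ij(x^(ε_i+ε_j))`, and `D_ij(x^(α))^p` for `α ≠ ε_i+ε_j`, where `i < j`
and `0 ≤ α ≤ τ`. -/
inductive RestrictedRel (K : Type*) [Field K] (n p : ℕ) [Fact p.Prime] [CharP K p] :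
    UniversalEnvelopingAlgebra K (Special K n p) →
    UniversalEnvelopingAlgebra K (Special K n p) → Prop
  | toral (i j : Fin n) (hij : i < j) (x : Special K n p)
      (hx : (x : WittAlg K n p) = Dij i j (mono (eps i + eps j))) :
      RestrictedRel K n p (UniversalEnvelopingAlgebra.ι K x ^ p) (UniversalEnvelopingAlgebra.ι K x)
  | nilpotent (i j : Fin n) (hij : i < j) (α : Fin n → ℕ) (hα : ∀ l, α l < p)
      (hne : α ≠ eps i + eps j) (x : Special K n p)
      (hx : (x : WittAlg K n p) = Dij i j (mono α)) :
      RestrictedRel K n p (UniversalEnvelopingAlgebra.ι K x ^ p) 0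

/-- The restricted universal enveloping algebra `u(S(n;1))`. -/
abbrev RestrictedEnv (K : Type*) [Field K] (n p : ℕ) [Fact p.Prime] [CharP K p] : Type _ :=
  RingQuot (RestrictedRel K n p)

/-- The truncated polynomial ring `K[t]/(t^p - q t)`. -/
abbrev TruncPoly (K : Type*) [Field K] (p : ℕ) (q : K) : Type _ :=
  AdjoinRoot (Polynomial.X ^ p - Polynomial.C q * Polynomial.X : Polynomial K)

/-- The class of `t` in `K[t]/(t^p - q t)`. -/
abbrev tvar (K : Type*) [Field K] (p : ℕ) (q : K) : TruncPoly K p q :=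
  AdjoinRoot.root (Polynomial.X ^ p - Polynomial.C q * Polynomial.X : Polynomial K)

/-- `u_{t,q}(S(n;1)) = u(S(n;1)) ⊗ K[t]/(t^p - q t)`, as an algebra over the second factor. -/
abbrev UTQ (K : Type*) [Field K] (n p : ℕ) [Fact p.Prime] [CharP K p] (q : K) : Type _ :=
  TruncPoly K p q ⊗[K] RestrictedEnv K n p

/-- The canonical map `S(n;1) → u_{t,q}(S(n;1))`. -/
def el (q : K) : Special K n p →ₗ[K] UTQ K n p q where
  toFun x := (1 : TruncPoly K p q) ⊗ₜ[K]
    RingQuot.mkAlgHom K (RestrictedRel K n p) (UniversalEnvelopingAlgebra.ι K x)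
  map_add' x y := by
    let _ : LieRing (UniversalEnvelopingAlgebra K (Special K n p)) := LieRing.ofAssociativeRing
    let _ : LieAlgebra K (UniversalEnvelopingAlgebra K (Special K n p)) :=
      LieAlgebra.ofAssociativeAlgebra
    rw [map_add (UniversalEnvelopingAlgebra.ι K), map_add, TensorProduct.tmul_add]
  map_smul' c x := by
    let _ : LieRing (UniversalEnvelopingAlgebra K (Special K n p)) := LieRing.ofAssociativeRing
    let _ : LieAlgebra K (UniversalEnvelopingAlgebra K (Special K n p)) :=
      LieAlgebra.ofAssociativeAlgebra
    rw [map_smul (UniversalEnvelopingAlgebra.ι K), map_smul, TensorProduct.tmul_smul, RingHom.id_apply]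

theorem el_apply (q : K) (x : Special K n p) : el q x = (1 : TruncPoly K p q) ⊗ₜ[K]
    RingQuot.mkAlgHom K (RestrictedRel K n p) (UniversalEnvelopingAlgebra.ι K x) := rfl

/-- `h(k,k') = D_kk'(x^(ε_k+ε_k'))`. -/
def hElt (hn : 3 ≤ n) (k k' : Fin n) : Special K n p := gen hn k k' (eps k + eps k')

/-- `e(k,k') = 2 D_kk'(x^(2ε_k+ε_k'))`. -/
def eElt (hn : 3 ≤ n) (k k' : Fin n) : Special K n p :=
  (2 : K) • gen hn k k' (2 • eps k + eps k')

/-- `d_kk'^(ℓ) = (1/ℓ!) (ad e(k,k'))^ℓ`. -/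
def dOp (hn : 3 ≤ n) (k k' : Fin n) (ℓ : ℕ) : Special K n p →ₗ[K] Special K n p :=
  ((ℓ.factorial : K)⁻¹) • (LieAlgebra.ad K (Special K n p) (eElt hn k k')) ^ ℓ

/-- `α(k,k') = α_k - δ_ik - δ_jk - α_k' + δ_ik' + δ_jk'`. -/
def wt (α : Fin n → ℕ) (i j k k' : Fin n) : ℤ :=
  α k - (if i = k then 1 else 0) - (if j = k then 1 else 0) - α k' +
    (if i = k' then 1 else 0) + (if j = k' then 1 else 0)

/-- The rising factorial `x_a^⟨ℓ⟩ = (x + a)(x + a + 1) ⋯ (x + a + ℓ - 1)`. -/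
def rising {R : Type*} [Ring R] (x : R) (a ℓ : ℕ) : R :=
  ((List.range ℓ).map fun j : ℕ => x + (a : R) + (j : R)).prod

theorem el_gen_pow (hn : 3 ≤ n) (q : K) (i j : Fin n) (hij : i ≠ j) (α : Fin n → ℕ)
    (hα : α ≠ eps i + eps j) : el q (gen hn i j α : Special K n p) ^ p = 0 := by
  have hp : p ≠ 0 := (Fact.out : p.Prime).ne_zero
  have key : ∀ i j : Fin n, i < j → α ≠ eps i + eps j →
      el q (gen hn i j α : Special K n p) ^ p = 0 := by
    intro i j hlt hne
    by_cases hr : ∀ l, α l < p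
    · have h := RingQuot.mkAlgHom_rel K
        (RestrictedRel.nilpotent i j hlt α hr hne (gen hn i j α : Special K n p) rfl)
      rw [map_pow, map_zero] at h
      rw [el_apply, Algebra.TensorProduct.tmul_pow, ← map_pow, map_pow, h, TensorProduct.tmul_zero]
    · have h0 : (mono α : TruncDP K n p) = 0 := by
        ext γ
        rw [mono_apply, if_neg]
        · rfl
        · intro h
          exact hr fun l => (h l) ▸ (γ l).isLt
      have : (gen hn i j α : Special K n p) = 0 :=
        Subtype.ext (by change Dij i j (mono α) = 0; rw [h0, map_zero])
      rw [this, map_zero, zero_pow hp]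
  rcases lt_or_gt_of_ne hij with h | h
  · exact key i j h hα
  · have h2 := key j i h (by rwa [add_comm])
    have : (gen hn i j α : Special K n p) = -gen hn j i α :=
      Subtype.ext (Dij_swap j i (mono α))
    rw [this, map_neg, neg_pow (el q (gen hn j i α : Special K n p)), h2, mul_zero]

theorem eElt_pow (hn : 3 ≤ n) (q : K) (k k' : Fin n) (hk : k ≠ k') :
    el q (eElt hn k k' : Special K n p) ^ p = 0 := by
  rw [eElt, map_smul, smul_pow, el_gen_pow hn q k k' hk, smul_zero]
  intro h
  have := congrFun h k
  simp [eps, Pi.single_eq_of_ne hk] at this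

theorem isUnit_one_sub (hn : 3 ≤ n) (q : K) (k k' : Fin n) (hk : k ≠ k') :
    IsUnit (1 - tvar K p q • el q (eElt hn k k' : Special K n p)) := by
  refine IsNilpotent.isUnit_one_sub ⟨p, ?_⟩
  rw [smul_pow, eElt_pow hn q k k' hk, smul_zero]

/-- The unit `1 - e(k,k') t` of `u_{t,q}(S(n;1))`. -/
def oneSub (hn : 3 ≤ n) (q : K) (k k' : Fin n) (hk : k ≠ k') : (UTQ K n p q)ˣ :=
  (isUnit_one_sub hn q k k' hk).unit

theorem coe_oneSub (hn : 3 ≤ n) (q : K) (k k' : Fin n) (hk : k ≠ k') :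
    (oneSub hn q k k' hk : UTQ K n p q) =
      1 - tvar K p q • el q (eElt hn k k' : Special K n p) := rfl

/-- The integral powers of `1 - e(k,k') t` in `u_{t,q}(S(n;1))`. -/
def oneSubPow (hn : 3 ≤ n) (q : K) (k k' : Fin n) (hk : k ≠ k') (z : ℤ) : UTQ K n p q :=
  ((oneSub hn q k k' hk ^ z : (UTQ K n p q)ˣ) : UTQ K n p q)

end SpecialAlgebra

end SpecialLie

end

open SpecialLie SpecialLie.TruncDP

/-! Let A be `UTQ K n p q`, an algebra over R = K[t]/(t^p - qt). The defining relations of u(S(n;1))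
are compatible with making every Lie algebra element primitive, so A has a standard Hopf structure
(`exists_standard_hopfData`). The required structure is a Drinfeld twist of it.

For one pair of indices put h = h(a,b) and g = 1 - e(a,b)t. Then h^p = h, g^p = 1 and [h,g] = g - 1.
The element h has eigenidempotents E_c = 1 - (h-c)^(p-1) for c in F_p, and the twist is F = Σ E_c ⊗
g^c. As g - 1 has weight 1 under h, F conjugates Δ(g) to g ⊗ g, and this yields the cocycle
identity. The conditions on k, k', m, m' make the data of the two pairs commute, so F₁F₂ is again a
twist, indexed by F_p × F_p (`IsPrimitivePair.isTwistData`). By `IsTwistData.isHopfData`, FΔF⁻¹ with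
the old counit and the antipode x ↦ U S(x) V is a Hopf structure, where U = Σ E_c S(G_c), V = Σ E_c
G_c, and G_c is the product of the powers of the two units.

The formulas come from moving an element x of weight w across F and V. For one pair, F(x ⊗ 1) = (x ⊗
g^w)F. Moving powers of g past x produces the divided powers of ad e with falling factorial
coefficients; on the eigenspaces of h these coefficients are signed rising factorials of h
(`IsTwistPair.tw_mul_one_tmul`). The same comparison for V gives the antipode
(`IsTwistPair.mul_twV`). Two pairs are treated by doing this twice (`comul_eq`, `antipode_eq`).

For the dimension, S(n;1) is shown to be both the span of the D_ij(x^(α)) and the kernel of a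
surjective map onto a space of dimension p^n - 1 + n, so that its dimension is (n-1)(p^n-1)
(`finrank_Special`). The tautological representation makes S(n;1) embed in u(S(n;1))
(`uι_injective`), and a PBW argument that uses only the coproduct shows that the restricted ordered
monomials form a basis (`finrank_eq_pow_of_primitive`).

Noncommutativity is [h,e] = e ≠ 0. For noncocommutativity, the new coproduct of h(k,k') is 1 ⊗ h + h
⊗ g⁻¹; a functional taking the value 1 at h and killing (1-g)A shows that symmetry would force g =
1, whereas te ≠ 0. -/

/-! ### Drinfeld twists of the form Σ E_a ⊗ G_a -/

section Twist

open TensorProduct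

/-- The Hopf algebra axioms for a coproduct and a counit given as algebra homomorphisms. -/
structure IsHopfData {R A : Type*} [CommRing R] [Ring A] [Algebra R A]
    (Δ : A →ₐ[R] A ⊗[R] A) (ε : A →ₐ[R] R) (S : A →ₗ[R] A) : Prop where
  coassoc : ∀ x, Algebra.TensorProduct.assoc R R R A A A
      (Algebra.TensorProduct.map Δ (AlgHom.id R A) (Δ x)) =
    Algebra.TensorProduct.map (AlgHom.id R A) Δ (Δ x)
  counit_left : ∀ x, Algebra.TensorProduct.map ε (AlgHom.id R A) (Δ x) = 1 ⊗ₜ x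
  counit_right : ∀ x, Algebra.TensorProduct.map (AlgHom.id R A) ε (Δ x) = x ⊗ₜ 1
  antipode_left : ∀ x, LinearMap.mul' R A (S.rTensor A (Δ x)) = algebraMap R A (ε x)
  antipode_right : ∀ x, LinearMap.mul' R A (S.lTensor A (Δ x)) = algebraMap R A (ε x)

variable {R A : Type*} [CommRing R] [Ring A] [Algebra R A]

/-- The Hopf algebra structure with the given coproduct, counit and antipode. -/
def IsHopfData.toHopfStructure {Δ : A →ₐ[R] A ⊗[R] A} {ε : A →ₐ[R] R} {S : A →ₗ[R] A}
    (H : IsHopfData Δ ε S) : HopfStructure R A where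
  comul := Δ.toLinearMap
  counit := ε.toLinearMap
  coassoc := LinearMap.ext H.coassoc
  rTensor_counit_comp_comul := LinearMap.ext H.counit_left
  lTensor_counit_comp_comul := LinearMap.ext H.counit_right
  counit_one := map_one ε
  counit_mul := map_mul ε
  comul_one := map_one Δ
  comul_mul := map_mul Δ
  antipode := S
  mul_antipode_rTensor_comul := LinearMap.ext H.antipode_left
  mul_antipode_lTensor_comul := LinearMap.ext H.antipode_right

/-- Conjugation by a unit, given with its inverse, after an algebra homomorphism. -/
def conjAlgHom {B : Type*} [Ring B] [Algebra R B] (Δ : A →ₐ[R] B) (F F' : B)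
    (h : F * F' = 1) (h' : F' * F = 1) : A →ₐ[R] B where
  toFun x := F * Δ x * F'
  map_one' := by rw [map_one, mul_one, h]
  map_mul' x y := by
    rw [map_mul]
    calc F * (Δ x * Δ y) * F' = F * Δ x * 1 * Δ y * F' := by noncomm_ring
      _ = F * Δ x * (F' * F) * Δ y * F' := by rw [h']
      _ = _ := by noncomm_ring
  map_zero' := by rw [map_zero, mul_zero, zero_mul]
  map_add' x y := by rw [map_add]; noncomm_ring
  commutes' r := by
    rw [AlgHom.commutes, ← Algebra.commutes, mul_assoc, h, mul_one]

variable {Z : Type*} [Fintype Z] [AddCommGroup Z] [DecidableEq Z]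

/-- A complete family of orthogonal idempotents indexed by a finite abelian group, together with a
representation of the group, for which `∑ E a ⊗ G a` is a Drinfeld twist. -/
structure IsTwistData (Δ : A →ₐ[R] A ⊗[R] A) (ε : A →ₐ[R] R) (S : A →ₗ[R] A)
    (E G : Z → A) : Prop where
  S_mul : ∀ a b, S (a * b) = S b * S a
  S_one : S 1 = 1
  E_mul : ∀ a b, E a * E b = if a = b then E a else 0
  E_sum : ∑ a, E a = 1
  G_zero : G 0 = 1
  G_add : ∀ a b, G (a + b) = G a * G b
  comul_E : ∀ c, Δ (E c) = ∑ a, E a ⊗ₜ E (c - a)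
  counit_E : ∀ a, ε (E a) = if a = 0 then 1 else 0
  counit_G : ∀ a, ε (G a) = 1
  S_E : ∀ a, S (E a) = E (-a)
  twist : ∀ z, (∑ a, E a ⊗ₜ[R] G a) * Δ (G z) = (G z ⊗ₜ G z) * ∑ a, E a ⊗ₜ[R] G a

namespace IsTwistData

variable {Δ : A →ₐ[R] A ⊗[R] A} {ε : A →ₐ[R] R} {S : A →ₗ[R] A} {E G : Z → A}

variable (R) in
/-- The twist `∑ E a ⊗ G a`. -/
def tw (E G : Z → A) : A ⊗[R] A := ∑ a, E a ⊗ₜ G a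

variable (R) in
/-- The inverse twist `∑ E a ⊗ G (-a)`. -/
def twInv (E G : Z → A) : A ⊗[R] A := ∑ a, E a ⊗ₜ G (-a)

/-- The element `∑ E a * S (G a)`. -/
def twU (S : A →ₗ[R] A) (E G : Z → A) : A := ∑ a, E a * S (G a)

/-- The element `∑ E a * G a`. -/
def twV (E G : Z → A) : A := ∑ a, E a * G a

/-- Orthogonality of the `E a` makes f ↦ Σ E a ⊗ f a multiplicative, so invertibility of the twist
reduces to that of each `G a`. -/
theorem tmul_sum_mul_sum (T : IsTwistData Δ ε S E G) (f f' : Z → A) :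
    (∑ a, E a ⊗ₜ[R] f a) * (∑ a, E a ⊗ₜ[R] f' a) = ∑ a, E a ⊗ₜ[R] (f a * f' a) := by
  rw [Finset.sum_mul_sum]
  refine Finset.sum_congr rfl fun a _ => ?_
  rw [Finset.sum_eq_single a]
  · rw [Algebra.TensorProduct.tmul_mul_tmul, T.E_mul, if_pos rfl]
  · intro b _ hb
    rw [Algebra.TensorProduct.tmul_mul_tmul, T.E_mul, if_neg hb.symm, TensorProduct.zero_tmul]
  · simp

theorem sum_E_tmul_one (T : IsTwistData Δ ε S E G) : ∑ a, E a ⊗ₜ[R] (1 : A) = 1 := by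
  rw [← TensorProduct.sum_tmul, T.E_sum]; rfl

theorem G_mul_neg (T : IsTwistData Δ ε S E G) (a : Z) : G a * G (-a) = 1 := by
  rw [← T.G_add, add_neg_cancel, T.G_zero]

theorem G_neg_mul (T : IsTwistData Δ ε S E G) (a : Z) : G (-a) * G a = 1 := by
  rw [← T.G_add, neg_add_cancel, T.G_zero]

theorem tw_mul_twInv (T : IsTwistData Δ ε S E G) : tw R E G * twInv R E G = 1 := by
  rw [tw, twInv, T.tmul_sum_mul_sum, ← T.sum_E_tmul_one]
  simp only [T.G_mul_neg]

theorem twInv_mul_tw (T : IsTwistData Δ ε S E G) : twInv R E G * tw R E G = 1 := by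
  rw [tw, twInv, T.tmul_sum_mul_sum, ← T.sum_E_tmul_one]
  simp only [T.G_neg_mul]

/-- The twisted coproduct. -/
def comul (T : IsTwistData Δ ε S E G) : A →ₐ[R] A ⊗[R] A :=
  conjAlgHom Δ (tw R E G) (twInv R E G) T.tw_mul_twInv T.twInv_mul_tw

theorem comul_apply (T : IsTwistData Δ ε S E G) (x : A) :
    T.comul x = tw R E G * Δ x * twInv R E G := rfl

/-- The twisted antipode. -/
def antipode (_ : IsTwistData Δ ε S E G) : A →ₗ[R] A :=
  LinearMap.mulLeft R (twU S E G) ∘ₗ LinearMap.mulRight R (twV E G) ∘ₗ S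

theorem antipode_apply (T : IsTwistData Δ ε S E G) (x : A) :
    T.antipode x = twU S E G * (S x * twV E G) := rfl

theorem E_mul_twV (T : IsTwistData Δ ε S E G) (a : Z) : E a * twV E G = E a * G a := by
  rw [twV, Finset.mul_sum, Finset.sum_eq_single a]
  · rw [← mul_assoc, T.E_mul, if_pos rfl]
  · intro b _ hb
    rw [← mul_assoc, T.E_mul, if_neg hb.symm, zero_mul]
  · simp

theorem E_mul_twU (T : IsTwistData Δ ε S E G) (a : Z) : E a * twU S E G = E a * S (G a) := by
  rw [twU, Finset.mul_sum, Finset.sum_eq_single a]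
  · rw [← mul_assoc, T.E_mul, if_pos rfl]
  · intro b _ hb
    rw [← mul_assoc, T.E_mul, if_neg hb.symm, zero_mul]
  · simp

/-- Since `S` is an antihomomorphism, a pure tensor a ⊗ b on the right only wraps S(a) and b around
the antipode axiom for `y`. -/
theorem rTensor_comul_mul (H : IsHopfData Δ ε S) (T : IsTwistData Δ ε S E G) (y : A)
    (W : A ⊗[R] A) :
    LinearMap.mul' R A (S.rTensor A (Δ y * W)) = ε y • LinearMap.mul' R A (S.rTensor A W) := by
  induction W with
  | zero => simp
  | add W₁ W₂ h₁ h₂ => rw [mul_add, map_add, map_add, map_add, map_add, smul_add, h₁, h₂]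
  | tmul a b =>
    have key : ∀ Y : A ⊗[R] A, LinearMap.mul' R A (S.rTensor A (Y * a ⊗ₜ b)) =
        S a * LinearMap.mul' R A (S.rTensor A Y) * b := by
      intro Y
      induction Y with
      | zero => simp
      | add W₁ W₂ h₁ h₂ => rw [add_mul, map_add, map_add, map_add, map_add, h₁, h₂]; noncomm_ring
      | tmul c d =>
        simp only [Algebra.TensorProduct.tmul_mul_tmul, LinearMap.rTensor_tmul,
          LinearMap.mul'_apply, T.S_mul, mul_assoc]
    rw [key, H.antipode_left, LinearMap.rTensor_tmul, LinearMap.mul'_apply,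
      Algebra.algebraMap_eq_smul_one, mul_smul_comm, smul_mul_assoc, mul_one]

/-- V is the image of F⁻¹ under m(S ⊗ id). Applying m(S ⊗ id) to F⁻¹(G a ⊗ G a) = Δ(G a)F⁻¹ gives
S(G a) V G a on the left and ε(G a) V = V on the right. -/
theorem S_G_mul_twV (H : IsHopfData Δ ε S) (T : IsTwistData Δ ε S E G) (a : Z) :
    S (G a) * twV E G = twV E G * G (-a) := by
  have hV : LinearMap.mul' R A (S.rTensor A (twInv R E G)) = twV E G := by
    -- `S` sends `E b` to `E (-b)`, so the sum is reindexed by negation.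
    rw [twInv, twV, map_sum, map_sum, ← Equiv.sum_comp (Equiv.neg Z)]
    refine Finset.sum_congr rfl fun b _ => ?_
    simp only [Equiv.neg_apply, LinearMap.rTensor_tmul, LinearMap.mul'_apply, T.S_E, neg_neg]
  have h1 : twInv R E G * (G a ⊗ₜ G a) = Δ (G a) * twInv R E G := by
    calc twInv R E G * (G a ⊗ₜ G a)
        = twInv R E G * ((G a ⊗ₜ G a) * tw R E G) * twInv R E G := by
          rw [mul_assoc, mul_assoc, T.tw_mul_twInv, mul_one]
      _ = twInv R E G * (tw R E G * Δ (G a)) * twInv R E G := by rw [tw, T.twist]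
      _ = _ := by rw [← mul_assoc, T.twInv_mul_tw, one_mul]
  have h2 := rTensor_comul_mul H T (G a) (twInv R E G)
  rw [← h1, T.counit_G, one_smul, hV] at h2
  have h3 : LinearMap.mul' R A (S.rTensor A (twInv R E G * (G a ⊗ₜ G a))) =
      S (G a) * twV E G * G a := by
    rw [← hV, twInv, Finset.sum_mul, map_sum, map_sum, map_sum, map_sum, Finset.mul_sum,
      Finset.sum_mul]
    refine Finset.sum_congr rfl fun b _ => ?_
    simp only [Algebra.TensorProduct.tmul_mul_tmul, LinearMap.rTensor_tmul,
          LinearMap.mul'_apply, T.S_mul, mul_assoc]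
  rw [h3] at h2
  calc S (G a) * twV E G = S (G a) * twV E G * (G a * G (-a)) := by rw [T.G_mul_neg, mul_one]
    _ = _ := by rw [← mul_assoc, h2]

/-- The previous lemma moves S(G a) through V as G(-a), which cancels the G a coming from E a V.
Both antipode axioms and the antipode formula need only this one-sided inverse. -/
theorem twU_mul_twV (H : IsHopfData Δ ε S) (T : IsTwistData Δ ε S E G) :
    twU S E G * twV E G = 1 := by
  rw [twU, Finset.sum_mul, ← T.E_sum]
  refine Finset.sum_congr rfl fun a _ => ?_
  rw [mul_assoc, S_G_mul_twV H T, ← mul_assoc, T.E_mul_twV, mul_assoc, T.G_mul_neg, mul_one]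

/-- Both sides equal Σ E a ⊗ (G a E d) ⊗ G(a+d): on the left by the coproduct of the idempotents, on
the right because F turns Δ(G a) into G a ⊗ G a. -/
theorem cocycle (T : IsTwistData Δ ε S E G) :
    Algebra.TensorProduct.assoc R R R A A A ((tw R E G ⊗ₜ 1) *
      Algebra.TensorProduct.map Δ (AlgHom.id R A) (tw R E G)) =
    (1 ⊗ₜ tw R E G) * Algebra.TensorProduct.map (AlgHom.id R A) Δ (tw R E G) := by
  have lhs : Algebra.TensorProduct.assoc R R R A A A ((tw R E G ⊗ₜ 1) *
      Algebra.TensorProduct.map Δ (AlgHom.id R A) (tw R E G)) =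
      ∑ a, ∑ d, E a ⊗ₜ ((G a * E d) ⊗ₜ G (a + d)) := by
    have h1 : Algebra.TensorProduct.map Δ (AlgHom.id R A) (tw R E G) =
        ∑ c, (∑ b, E b ⊗ₜ[R] E (c - b)) ⊗ₜ[R] G c := by
      rw [tw, map_sum]
      refine Finset.sum_congr rfl fun c _ => ?_
      rw [Algebra.TensorProduct.map_tmul, T.comul_E]; rfl
    have h2 : (tw R E G ⊗ₜ[R] (1 : A)) * ∑ c, (∑ b, E b ⊗ₜ[R] E (c - b)) ⊗ₜ[R] G c =
        ∑ c, (∑ a, E a ⊗ₜ[R] (G a * E (c - a))) ⊗ₜ[R] G c := by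
      rw [Finset.mul_sum]
      refine Finset.sum_congr rfl fun c _ => ?_
      rw [Algebra.TensorProduct.tmul_mul_tmul, one_mul, tw, T.tmul_sum_mul_sum]
    rw [h1, h2, map_sum]
    simp only [TensorProduct.sum_tmul, map_sum, Algebra.TensorProduct.assoc_tmul]
    rw [Finset.sum_comm]
    refine Finset.sum_congr rfl fun a _ => ?_
    rw [← Equiv.sum_comp (Equiv.addLeft a)]
    refine Finset.sum_congr rfl fun d _ => ?_
    rw [Equiv.coe_addLeft, add_sub_cancel_left]
  have rhs : (1 ⊗ₜ tw R E G) * Algebra.TensorProduct.map (AlgHom.id R A) Δ (tw R E G) =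
      ∑ a, ∑ d, E a ⊗ₜ[R] ((G a * E d) ⊗ₜ[R] G (a + d)) := by
    conv_lhs => rw [tw, map_sum]
    rw [Finset.mul_sum]
    refine Finset.sum_congr rfl fun a _ => ?_
    rw [Algebra.TensorProduct.map_tmul, Algebra.TensorProduct.tmul_mul_tmul, one_mul, T.twist,
      AlgHom.id_apply, Finset.mul_sum, TensorProduct.tmul_sum]
    refine Finset.sum_congr rfl fun d _ => ?_
    rw [Algebra.TensorProduct.tmul_mul_tmul, T.G_add]
  rw [lhs, rhs]

/-- The left-hand side is a left inverse, and the right-hand side a right inverse, of the element in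
`cocycle`; hence they agree. -/
theorem cocycle_inv (T : IsTwistData Δ ε S E G) :
    Algebra.TensorProduct.assoc R R R A A A (
      Algebra.TensorProduct.map Δ (AlgHom.id R A) (twInv R E G) * (twInv R E G ⊗ₜ 1)) =
    Algebra.TensorProduct.map (AlgHom.id R A) Δ (twInv R E G) * (1 ⊗ₜ twInv R E G) := by
  have h1 : Algebra.TensorProduct.assoc R R R A A A (
      Algebra.TensorProduct.map Δ (AlgHom.id R A) (twInv R E G) * (twInv R E G ⊗ₜ 1)) *
      Algebra.TensorProduct.assoc R R R A A A ((tw R E G ⊗ₜ 1) *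
        Algebra.TensorProduct.map Δ (AlgHom.id R A) (tw R E G)) = 1 := by
    rw [← map_mul]
    have : (Algebra.TensorProduct.map Δ (AlgHom.id R A) (twInv R E G) * (twInv R E G ⊗ₜ 1)) *
      ((tw R E G ⊗ₜ 1) * Algebra.TensorProduct.map Δ (AlgHom.id R A) (tw R E G)) =
      Algebra.TensorProduct.map Δ (AlgHom.id R A) (twInv R E G) *
      ((twInv R E G ⊗ₜ 1) * (tw R E G ⊗ₜ 1)) *
        Algebra.TensorProduct.map Δ (AlgHom.id R A) (tw R E G) := by noncomm_ring
    rw [this, Algebra.TensorProduct.tmul_mul_tmul, T.twInv_mul_tw, one_mul,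
      ← Algebra.TensorProduct.one_def, mul_one, ← map_mul, T.twInv_mul_tw, map_one, map_one]
  have h2 : (1 ⊗ₜ tw R E G) * Algebra.TensorProduct.map (AlgHom.id R A) Δ (tw R E G) *
      (Algebra.TensorProduct.map (AlgHom.id R A) Δ (twInv R E G) * (1 ⊗ₜ twInv R E G)) = 1 := by
    have : (1 ⊗ₜ tw R E G) * Algebra.TensorProduct.map (AlgHom.id R A) Δ (tw R E G) *
      (Algebra.TensorProduct.map (AlgHom.id R A) Δ (twInv R E G) * (1 ⊗ₜ twInv R E G)) =
      (1 ⊗ₜ tw R E G) * (Algebra.TensorProduct.map (AlgHom.id R A) Δ (tw R E G) *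
      Algebra.TensorProduct.map (AlgHom.id R A) Δ (twInv R E G)) * (1 ⊗ₜ twInv R E G) := by
        noncomm_ring
    rw [this, ← map_mul, T.tw_mul_twInv, map_one, mul_one, Algebra.TensorProduct.tmul_mul_tmul,
      T.tw_mul_twInv, one_mul]
    rfl
  rw [T.cocycle] at h1
  exact left_inv_eq_right_inv h1 h2

theorem map_comul_left (T : IsTwistData Δ ε S E G) (Y : A ⊗[R] A) :
    Algebra.TensorProduct.map T.comul (AlgHom.id R A) Y =
      (tw R E G ⊗ₜ 1) * Algebra.TensorProduct.map Δ (AlgHom.id R A) Y * (twInv R E G ⊗ₜ 1) := by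
  induction Y with
  | zero => simp
  | add a b ha hb => rw [map_add, map_add, ha, hb, mul_add, add_mul]
  | tmul a b =>
    simp [comul_apply]

theorem map_comul_right (T : IsTwistData Δ ε S E G) (Y : A ⊗[R] A) :
    Algebra.TensorProduct.map (AlgHom.id R A) T.comul Y =
      (1 ⊗ₜ tw R E G) * Algebra.TensorProduct.map (AlgHom.id R A) Δ Y * (1 ⊗ₜ twInv R E G) := by
  induction Y with
  | zero => simp
  | add a b ha hb => rw [map_add, map_add, ha, hb, mul_add, add_mul]
  | tmul a b =>
    simp [comul_apply]

/-- Both iterated twisted coproducts are the old iterated coproduct conjugated by the element of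
`cocycle`. -/
theorem comul_coassoc (H : IsHopfData Δ ε S) (T : IsTwistData Δ ε S E G) (x : A) :
    Algebra.TensorProduct.assoc R R R A A A
      (Algebra.TensorProduct.map T.comul (AlgHom.id R A) (T.comul x)) =
    Algebra.TensorProduct.map (AlgHom.id R A) T.comul (T.comul x) := by
  rw [T.map_comul_left, T.map_comul_right, T.comul_apply]
  have e1 : (tw R E G ⊗ₜ 1) * Algebra.TensorProduct.map Δ (AlgHom.id R A)
      (tw R E G * Δ x * twInv R E G) * (twInv R E G ⊗ₜ 1) =
      ((tw R E G ⊗ₜ 1) * Algebra.TensorProduct.map Δ (AlgHom.id R A) (tw R E G)) *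
      Algebra.TensorProduct.map Δ (AlgHom.id R A) (Δ x) *
      (Algebra.TensorProduct.map Δ (AlgHom.id R A) (twInv R E G) * (twInv R E G ⊗ₜ 1)) := by
    simp only [map_mul, mul_assoc]
  rw [e1, map_mul, map_mul, T.cocycle, T.cocycle_inv, H.coassoc]
  simp only [map_mul, mul_assoc]

theorem sum_tmul_mul_mul (T : IsTwistData Δ ε S E G) (x : A) :
    T.comul x = ∑ b, ∑ a, (E a ⊗ₜ[R] G a) * Δ x * (E b ⊗ₜ G (-b)) := by
  rw [T.comul_apply, tw, twInv, Finset.mul_sum]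
  exact Finset.sum_congr rfl fun b _ => by rw [Finset.sum_mul, Finset.sum_mul]

/-- For fixed b the sum over a collapses by Σ S(E a) V G a = 1, leaving the old antipode axiom
applied to Δ(x). The remaining sum over b rebuilds V, and U V = 1 finishes. -/
theorem antipode_left_aux (H : IsHopfData Δ ε S) (T : IsTwistData Δ ε S E G) (x : A) :
    LinearMap.mul' R A (T.antipode.rTensor A (T.comul x)) = algebraMap R A (ε x) := by
  have hsum : ∑ a, S (E a) * twV E G * G a = 1 := by
    rw [← T.E_sum, ← Equiv.sum_comp (Equiv.neg Z)]
    refine Finset.sum_congr rfl fun a _ => ?_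
    rw [Equiv.neg_apply, T.S_E, neg_neg, T.E_mul_twV, mul_assoc, T.G_mul_neg, mul_one]
  have key : ∀ Y : A ⊗[R] A, ∀ b, ∑ a, LinearMap.mul' R A (T.antipode.rTensor A
      ((E a ⊗ₜ[R] G a) * Y * (E b ⊗ₜ G (-b)))) =
      twU S E G * (E (-b) * (LinearMap.mul' R A (S.rTensor A Y) * G (-b))) := by
    intro Y b
    induction Y with
    | zero => simp
    | add Y₁ Y₂ h₁ h₂ =>
      simp only [mul_add, add_mul, map_add, Finset.sum_add_distrib, h₁, h₂]
    | tmul c d =>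
      simp only [Algebra.TensorProduct.tmul_mul_tmul, LinearMap.rTensor_tmul,
          LinearMap.mul'_apply, antipode_apply, T.S_mul, T.S_E b]
      calc _ = ∑ a, twU S E G * E (-b) * S c * (S (E a) * twV E G * G a) * d * G (-b) :=
            Finset.sum_congr rfl fun a _ => by simp only [mul_assoc]
        _ = _ := by
          rw [← Finset.sum_mul, ← Finset.sum_mul, ← Finset.mul_sum, hsum]
          simp only [mul_assoc, one_mul]
  rw [T.sum_tmul_mul_mul, map_sum, map_sum]
  have : ∀ b, LinearMap.mul' R A (T.antipode.rTensor A
      (∑ a, (E a ⊗ₜ[R] G a) * Δ x * (E b ⊗ₜ G (-b)))) =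
      ε x • (twU S E G * (E (-b) * G (-b))) := by
    intro b
    rw [map_sum, map_sum, key, H.antipode_left, Algebra.algebraMap_eq_smul_one, smul_mul_assoc,
      one_mul, mul_smul_comm, mul_smul_comm]
  have hneg : ∑ b, E (-b) * G (-b) = twV E G :=
    Equiv.sum_comp (Equiv.neg Z) (fun b => E b * G b)
  rw [Finset.sum_congr rfl fun b _ => this b, ← Finset.smul_sum, ← Finset.mul_sum, hneg]
  change ε x • (twU S E G * twV E G) = _
  rw [twU_mul_twV H T, Algebra.algebraMap_eq_smul_one]

/-- Mirror image of the left case: the sum over b collapses first, by Σ E b U S(G(-b)) = 1. -/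
theorem antipode_right_aux (H : IsHopfData Δ ε S) (T : IsTwistData Δ ε S E G) (x : A) :
    LinearMap.mul' R A (T.antipode.lTensor A (T.comul x)) = algebraMap R A (ε x) := by
  have hsum : ∑ b, E b * twU S E G * S (G (-b)) = 1 := by
    rw [← T.E_sum]
    refine Finset.sum_congr rfl fun b _ => ?_
    rw [T.E_mul_twU, mul_assoc, ← T.S_mul, T.G_neg_mul, T.S_one, mul_one]
  have key : ∀ Y : A ⊗[R] A, ∀ a, ∑ b, LinearMap.mul' R A (T.antipode.lTensor A
      ((E a ⊗ₜ[R] G a) * Y * (E b ⊗ₜ G (-b)))) =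
      E a * (LinearMap.mul' R A (S.lTensor A Y) * (S (G a) * twV E G)) := by
    intro Y a
    induction Y with
    | zero => simp
    | add Y₁ Y₂ h₁ h₂ =>
      simp only [mul_add, add_mul, map_add, Finset.sum_add_distrib, h₁, h₂]
    | tmul c d =>
      simp only [Algebra.TensorProduct.tmul_mul_tmul, LinearMap.lTensor_tmul,
          LinearMap.mul'_apply, antipode_apply, T.S_mul]
      calc _ = ∑ b, E a * c * (E b * twU S E G * S (G (-b))) * (S d * S (G a) * twV E G) :=
            Finset.sum_congr rfl fun b _ => by simp only [mul_assoc]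
        _ = _ := by
          rw [← Finset.sum_mul, ← Finset.mul_sum, hsum]
          simp only [mul_assoc, one_mul]
  rw [T.sum_tmul_mul_mul, Finset.sum_comm, map_sum, map_sum]
  have : ∀ a, LinearMap.mul' R A (T.antipode.lTensor A
      (∑ b, (E a ⊗ₜ[R] G a) * Δ x * (E b ⊗ₜ G (-b)))) =
      ε x • (E a * S (G a) * twV E G) := by
    intro a
    rw [map_sum, map_sum, key, H.antipode_right, Algebra.algebraMap_eq_smul_one, smul_mul_assoc,
      one_mul, mul_smul_comm, mul_assoc]
  rw [Finset.sum_congr rfl fun b _ => this b, ← Finset.smul_sum, ← Finset.sum_mul]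
  change ε x • (twU S E G * twV E G) = _
  rw [twU_mul_twV H T, Algebra.algebraMap_eq_smul_one]

/-- Twisting a Hopf algebra structure. -/
theorem isHopfData (H : IsHopfData Δ ε S) (T : IsTwistData Δ ε S E G) :
    IsHopfData T.comul ε T.antipode where
  coassoc := T.comul_coassoc H
  counit_left x := by
    have h1 : Algebra.TensorProduct.map ε (AlgHom.id R A) (tw R E G) = 1 := by
      rw [tw, map_sum, Finset.sum_eq_single 0]
      · rw [Algebra.TensorProduct.map_tmul, T.counit_E, if_pos rfl, T.G_zero]; rfl
      · intro b _ hb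
        rw [Algebra.TensorProduct.map_tmul, T.counit_E, if_neg hb, TensorProduct.zero_tmul]
      · simp
    have h2 := congrArg (Algebra.TensorProduct.map ε (AlgHom.id R A)) T.tw_mul_twInv
    rw [map_mul, h1, one_mul, map_one] at h2
    rw [T.comul_apply, map_mul, map_mul, h1, h2, H.counit_left, one_mul, mul_one]
  counit_right x := by
    have h1 : Algebra.TensorProduct.map (AlgHom.id R A) ε (tw R E G) = 1 := by
      rw [tw, map_sum, Algebra.TensorProduct.one_def, ← T.E_sum, TensorProduct.sum_tmul]
      exact Finset.sum_congr rfl fun a _ => by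
        rw [Algebra.TensorProduct.map_tmul, T.counit_G]; rfl
    have h2 := congrArg (Algebra.TensorProduct.map (AlgHom.id R A) ε) T.tw_mul_twInv
    rw [map_mul, h1, one_mul, map_one] at h2
    rw [T.comul_apply, map_mul, map_mul, h1, h2, H.counit_right, one_mul, mul_one]
  antipode_left := T.antipode_left_aux H
  antipode_right := T.antipode_right_aux H

end IsTwistData

end Twist

/-! ### Eigenidempotents of an element with h^p = h -/

section Idempotents

open TensorProduct

variable {p : ℕ} [Fact p.Prime] (R : Type*) {A : Type*} [CommRing R] [Ring A] [Algebra R A]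
  [CharP R p]

/-- The scalars coming from the prime field. -/
def primeScalar (A : Type*) [Ring A] [Algebra R A] : ZMod p →+* A :=
  (algebraMap R A).comp (ZMod.castHom (dvd_refl p) R)

theorem primeScalar_commutes (a : ZMod p) (x : A) :
    primeScalar R A a * x = x * primeScalar R A a :=
  Algebra.commutes _ _

theorem map_primeScalar {B : Type*} [Ring B] [Algebra R B] (f : A →ₐ[R] B) (a : ZMod p) :
    f (primeScalar R A a) = primeScalar R B a :=
  f.commutes _

/-- The idempotent `1 - (h - a)^(p-1)`, projecting onto the eigenspace of `h` at `a`. -/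
def eigIdem (h : A) (a : ZMod p) : A := 1 - (h - primeScalar R A a) ^ (p - 1)

theorem map_eigIdem {B : Type*} [Ring B] [Algebra R B] (f : A →ₐ[R] B) (h : A) (a : ZMod p) :
    f (eigIdem R h a) = eigIdem R (f h) a := by
  simp only [eigIdem, map_sub, map_one, map_pow, map_primeScalar]

theorem one_sub_pow_card_sub_one (a : ZMod p) : 1 - a ^ (p - 1) = if a = 0 then 1 else 0 := by
  have hp : p - 1 ≠ 0 := Nat.sub_ne_zero_of_lt (Fact.out : p.Prime).one_lt
  split_ifs with h
  · rw [h, zero_pow hp, sub_zero]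
  · rw [ZMod.pow_card_sub_one_eq_one h, sub_self]

theorem sub_pow_mul_of_eigen {h v : A} {a : ZMod p} (hv : h * v = primeScalar R A a * v)
    (b : ZMod p) (n : ℕ) :
    (h - primeScalar R A b) ^ n * v = primeScalar R A ((a - b) ^ n) * v := by
  induction n with
  | zero => simp
  | succ n ih =>
    rw [pow_succ, mul_assoc, sub_mul, hv, ← sub_mul, ← map_sub, primeScalar_commutes, ← mul_assoc,
      ih, mul_assoc, ← primeScalar_commutes, ← mul_assoc, ← map_mul, pow_succ]

/-- On an eigenvector the idempotent is the scalar 1 - (a-b)^(p-1), which by Fermat is the delta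
function on F_p. -/
theorem eigIdem_mul_of_eigen {h v : A} {a : ZMod p} (hv : h * v = primeScalar R A a * v)
    (b : ZMod p) : eigIdem R h b * v = if b = a then v else 0 := by
  rw [eigIdem, sub_mul, sub_pow_mul_of_eigen R hv, one_mul]
  have h1 := one_sub_pow_card_sub_one (a - b)
  have h2 : v - primeScalar R A ((a - b) ^ (p - 1)) * v =
      primeScalar R A (1 - (a - b) ^ (p - 1)) * v := by rw [map_sub, map_one, sub_mul, one_mul]
  rw [h2, h1]
  by_cases hab : b = a
  · simp [hab]
  · rw [if_neg (by rwa [sub_eq_zero, eq_comm]), if_neg hab, map_zero, zero_mul]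

/-- Left multiplication by `x` raises eigenvalues of `h` by `w`. -/
theorem eigIdem_mul_of_commutator {h x : A} {w : ZMod p}
    (hx : h * x = x * h + primeScalar R A w * x) (a : ZMod p) :
    eigIdem R h a * x = x * eigIdem R h (a - w) := by
  have h1 : SemiconjBy x (h - primeScalar R A (a - w)) (h - primeScalar R A a) := by
    rw [SemiconjBy, mul_sub, sub_mul, hx, primeScalar_commutes R w, primeScalar_commutes R a,
      map_sub, mul_sub]
    abel
  have h2 := h1.pow_right (p - 1)
  rw [eigIdem, eigIdem, sub_mul, mul_sub, one_mul, mul_one, h2.eq]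

/-- A polynomial identity over F_p, hence true for every `h`: the sum minus 1 has degree at most p -
1 and vanishes at all p elements of F_p. -/
theorem sum_eigIdem (h : A) : ∑ a : ZMod p, eigIdem R h a = 1 := by
  have hp := (Fact.out : p.Prime).pos
  have key : ∑ a : ZMod p, (1 - (Polynomial.X - Polynomial.C a) ^ (p - 1) : (ZMod p)[X]) = 1 := by
    refine Polynomial.eq_of_degree_sub_lt_of_eval_finset_eq Finset.univ ?_ ?_
    · have h1 : (∑ a : ZMod p, (1 - (Polynomial.X - Polynomial.C a) ^ (p - 1) : (ZMod p)[X]) -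
          1).natDegree ≤ p - 1 := by
        refine (Polynomial.natDegree_sub_le _ _).trans (max_le ?_ (by simp))
        refine Polynomial.natDegree_sum_le_of_forall_le _ _ fun a _ => ?_
        refine (Polynomial.natDegree_sub_le _ _).trans (max_le (by simp) ?_)
        refine Polynomial.natDegree_pow_le.trans ?_
        rw [Polynomial.natDegree_X_sub_C, mul_one]
      refine Polynomial.degree_le_natDegree.trans_lt ?_
      rw [Finset.card_univ, ZMod.card]
      exact_mod_cast h1.trans_lt (Nat.sub_lt hp one_pos)
    · intro b _
      simp only [Polynomial.eval_finsetSum, Polynomial.eval_sub, Polynomial.eval_one,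
        Polynomial.eval_pow, Polynomial.eval_X, Polynomial.eval_C, one_sub_pow_card_sub_one]
      simp [sub_eq_zero]
  have h2 := congrArg (Polynomial.eval₂RingHom' (primeScalar R A) h
    fun a => primeScalar_commutes R a h) key
  rw [map_sum, map_one] at h2
  rw [← h2]
  refine Finset.sum_congr rfl fun a _ => ?_
  rw [map_sub, map_one, map_pow, map_sub]
  simp [eigIdem, Polynomial.eval₂RingHom']

/-- By Frobenius (h-a)^p = h^p - a^p = h - a, so (h-a)(1 - (h-a)^(p-1)) = 0. -/
theorem mul_eigIdem [CharP A p] {h : A} (hh : h ^ p = h) (a : ZMod p) :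
    h * eigIdem R h a = primeScalar R A a * eigIdem R h a := by
  have hp := (Fact.out : p.Prime).pos
  have hc : Commute h (primeScalar R A a) := (primeScalar_commutes R a h).symm
  rw [← sub_eq_zero, ← sub_mul, eigIdem, mul_sub, mul_one, ← pow_succ', Nat.sub_add_cancel hp,
    sub_pow_char_of_commute _ hc, hh, ← map_pow, ZMod.pow_card, sub_self]

theorem eigIdem_mul_eigIdem [CharP A p] {h : A} (hh : h ^ p = h) (a b : ZMod p) :
    eigIdem R h a * eigIdem R h b = if a = b then eigIdem R h a else 0 := by
  rw [eigIdem_mul_of_eigen R (mul_eigIdem R hh b)]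
  split_ifs with hab
  · rw [hab]
  · rfl

theorem commute_eigIdem {h x : A} (hx : Commute h x) (a : ZMod p) : Commute (eigIdem R h a) x :=
  (Commute.one_left x).sub_left ((hx.sub_left (primeScalar_commutes R a x)).pow_left _)

/-- Each E_a ⊗ E_b is an eigenvector of h ⊗ 1 + 1 ⊗ h at a + b, and these tensors sum to 1. This is
the coproduct of an idempotent when `h` is primitive. -/
theorem eigIdem_add [CharP A p] {h : A} (hh : h ^ p = h) (c : ZMod p) :
    eigIdem R (h ⊗ₜ[R] (1 : A) + 1 ⊗ₜ h) c = ∑ a, eigIdem R h a ⊗ₜ eigIdem R h (c - a) := by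
  have h1 : ∀ a b : ZMod p, eigIdem R (h ⊗ₜ[R] (1 : A) + 1 ⊗ₜ h) c *
      eigIdem R h a ⊗ₜ eigIdem R h b =
      if c = a + b then eigIdem R h a ⊗ₜ eigIdem R h b else 0 := by
    intro a b
    refine eigIdem_mul_of_eigen R ?_ c
    have hs : ∀ a : ZMod p, ∀ x y : A, (primeScalar R A a * x) ⊗ₜ[R] y =
        primeScalar R (A ⊗[R] A) a * x ⊗ₜ y := fun a x y => by
      rw [← map_primeScalar R (Algebra.TensorProduct.includeLeft (S := R) (B := A)) a,
        Algebra.TensorProduct.includeLeft_apply, Algebra.TensorProduct.tmul_mul_tmul, one_mul]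
    have hs' : ∀ a : ZMod p, ∀ x y : A, x ⊗ₜ[R] (primeScalar R A a * y) =
        primeScalar R (A ⊗[R] A) a * x ⊗ₜ y := fun a x y => by
      rw [← map_primeScalar R (Algebra.TensorProduct.includeRight (R := R) (A := A) (B := A)) a,
        Algebra.TensorProduct.includeRight_apply, Algebra.TensorProduct.tmul_mul_tmul, one_mul]
    rw [add_mul, Algebra.TensorProduct.tmul_mul_tmul, Algebra.TensorProduct.tmul_mul_tmul,
      one_mul, one_mul, mul_eigIdem R hh, mul_eigIdem R hh, hs, hs', map_add, add_mul]
  calc eigIdem R (h ⊗ₜ[R] (1 : A) + 1 ⊗ₜ h) c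
      = eigIdem R (h ⊗ₜ[R] (1 : A) + 1 ⊗ₜ h) c *
        (∑ a : ZMod p, eigIdem R h a) ⊗ₜ (∑ b : ZMod p, eigIdem R h b) := by
        rw [sum_eigIdem, ← Algebra.TensorProduct.one_def, mul_one]
    _ = ∑ a, ∑ b, if c = a + b then eigIdem R h a ⊗ₜ[R] eigIdem R h b else 0 := by
        simp only [TensorProduct.sum_tmul, TensorProduct.tmul_sum, Finset.mul_sum, h1]
        exact Finset.sum_comm
    _ = _ := by
        refine Finset.sum_congr rfl fun a _ => ?_
        simp only [← sub_eq_iff_eq_add']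
        simp

theorem eigIdem_zero (a : ZMod p) : eigIdem R (0 : A) a = if a = 0 then 1 else 0 := by
  have h := one_sub_pow_card_sub_one (-a)
  have h2 : eigIdem R (0 : A) a = primeScalar R A (1 - (-a) ^ (p - 1)) := by
    rw [eigIdem, map_sub, map_one, map_pow, map_neg, zero_sub]
  rw [h2, h]
  by_cases ha : a = 0 <;> simp [ha]

theorem eigIdem_neg (h : A) (a : ZMod p) : eigIdem R (-h) a = eigIdem R h (-a) := by
  have h1 : primeScalar R A ((-1 : ZMod p) ^ (p - 1)) = 1 := by
    rw [ZMod.pow_card_sub_one_eq_one (neg_ne_zero.mpr one_ne_zero), map_one]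
  have h2 : -h - primeScalar R A a = (-1) * (h - primeScalar R A (-a)) := by
    rw [map_neg]; noncomm_ring
  rw [eigIdem, eigIdem, h2, (Commute.neg_one_left _).mul_pow]
  rw [map_pow, map_neg, map_one] at h1
  rw [h1, one_mul]

end Idempotents

/-! ### Powers of a unit with exponents in F_p -/

section UnitPower

variable {p : ℕ} [Fact p.Prime] {A : Type*} [Ring A]

/-- The powers of a unit of order dividing `p`. -/
def unitPow (g : Aˣ) (a : ZMod p) : A := ((g ^ a.val : Aˣ) : A)

theorem unitPow_intCast {g : Aˣ} (hg : g ^ p = 1) (z : ℤ) :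
    unitPow g (z : ZMod p) = ((g ^ z : Aˣ) : A) := by
  rw [unitPow, ← zpow_natCast, ZMod.val_intCast]
  conv_rhs => rw [← Int.emod_add_mul_ediv z p, zpow_add, zpow_mul, zpow_natCast, hg, one_zpow,
    mul_one]

theorem unitPow_natCast {g : Aˣ} (hg : g ^ p = 1) (z : ℕ) :
    unitPow g (z : ZMod p) = (g : A) ^ z := by
  have := unitPow_intCast hg (z : ℤ)
  rw [Int.cast_natCast] at this
  rw [this, zpow_natCast, Units.val_pow_eq_pow_val]

theorem unitPow_zero (g : Aˣ) : unitPow g (0 : ZMod p) = 1 := by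
  rw [unitPow, ZMod.val_zero, pow_zero, Units.val_one]

theorem unitPow_add {g : Aˣ} (hg : g ^ p = 1) (a b : ZMod p) :
    unitPow g (a + b) = (unitPow g a * unitPow g b : A) := by
  have h1 : a + b = ((a.val + b.val : ℕ) : ZMod p) := by
    rw [Nat.cast_add, ZMod.natCast_zmod_val, ZMod.natCast_zmod_val]
  rw [h1, unitPow_natCast hg, unitPow, unitPow, pow_add, Units.val_pow_eq_pow_val,
    Units.val_pow_eq_pow_val]

theorem commute_unitPow {g : Aˣ} {x : A} (h : Commute (g : A) x) (a : ZMod p) :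
    Commute (unitPow g a) x := by
  rw [unitPow, Units.val_pow_eq_pow_val]
  exact h.pow_left _

end UnitPower

/-! ### Rising and falling factorials -/

section Rising

theorem rising_zero {A : Type*} [Ring A] (x : A) (c : ℕ) : rising x c 0 = 1 := rfl

theorem rising_succ {A : Type*} [Ring A] (x : A) (c n : ℕ) :
    rising x c (n + 1) = rising x c n * (x + c + n) := by
  simp [rising, List.range_succ]

theorem commute_rising {A : Type*} [Ring A] {x y : A} (h : Commute x y) (c n : ℕ) :
    Commute (rising x c n) y := by
  induction n with
  | zero => exact Commute.one_left y
  | succ n ih =>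
    rw [rising_succ]
    exact ih.mul_left ((h.add_left (Nat.cast_commute c y)).add_left (Nat.cast_commute n y))

theorem cast_descFactorial_succ {A : Type*} [Ring A] (s n : ℕ) :
    (s.descFactorial (n + 1) : A) = ((s : A) - n) * s.descFactorial n := by
  rw [Nat.descFactorial_succ]
  rcases le_or_gt n s with h | h
  · push_cast [h]; rfl
  · rw [Nat.descFactorial_eq_zero_iff_lt.mpr h]; simp

/-- At the eigenvalue -s of h, the coefficient (-1)^n h^⟨n⟩ is the falling factorial of s; this is
how rising factorials of h enter the coproduct. -/
theorem neg_one_pow_mul_rising_neg {A : Type*} [CommRing A] (s n : ℕ) :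
    (-1) ^ n * rising (-(s : A)) 0 n = s.descFactorial n := by
  induction n with
  | zero => simp [rising_zero]
  | succ n ih =>
    rw [cast_descFactorial_succ, ← ih, rising_succ]
    push_cast
    ring

/-- The Pascal rule for falling factorials, which drives the induction in `mul_unit_pow`. -/
theorem descFactorial_succ_add (s n : ℕ) : (s + 1).descFactorial (n + 1) =
    s.descFactorial (n + 1) + (n + 1) * s.descFactorial n := by
  rw [Nat.succ_descFactorial_succ, Nat.descFactorial_succ, ← add_mul]
  rcases le_or_gt n s with h | h
  · congr 1; omega
  · rw [Nat.descFactorial_eq_zero_iff_lt.mpr h, mul_zero, mul_zero]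

end Rising

/-! ### The twist of a single pair (h, g) -/

section SingleTwist

open TensorProduct

variable {p : ℕ} [Fact p.Prime] (R : Type*) {A : Type*} [CommRing R] [Ring A] [Algebra R A]
  [CharP R p] [CharP A p]

/-- A toral element `h` and a unit `g` of order `p` with `[h, g] = g - 1`. -/
structure IsTwistPair (p : ℕ) {A : Type*} [Ring A] (h : A) (g : Aˣ) : Prop where
  h_pow : h ^ p = h
  g_pow : g ^ p = 1
  comm : h * g = g * h + g - 1

theorem rising_mul_of_eigen {h v : A} {a : ZMod p} (hv : h * v = primeScalar R A a * v)
    (c n : ℕ) : rising h c n * v = primeScalar R A (rising a c n) * v := by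
  induction n with
  | zero => simp [rising_zero]
  | succ n ih =>
    have h1 : (h + c + n) * v = primeScalar R A (a + c + n) * v := by
      simp only [map_add, map_natCast, add_mul, hv]
    rw [rising_succ, rising_succ, mul_assoc, h1, ← mul_assoc, ← primeScalar_commutes, mul_assoc,
      ih, ← mul_assoc, ← map_mul, mul_comm]

variable (p) in
/-- The family `X n` plays the role of `(1/n!) (ad e)^n x`. -/
def IsDivPowFamily (g : Aˣ) (X : ℕ → A) : Prop :=
  ∀ n, n + 1 < p → X n * g - g * X n = ((n + 1 : ℕ) : A) * X (n + 1)

/-- Induction on `s`: moving one more `g` leftwards past X n creates (n+1) X (n+1), and the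
coefficients add up by the Pascal rule. -/
theorem mul_unit_pow {g : Aˣ} {X : ℕ → A} (hX : IsDivPowFamily p g X) (s : ℕ) (hs : s < p) :
    X 0 * (g : A) ^ s = ∑ n ∈ Finset.range p,
      (s.descFactorial n : A) * (((g ^ ((s : ℤ) - n) : Aˣ) : A) * X n) := by
  obtain ⟨q, rfl⟩ : ∃ q, p = q + 1 := ⟨p - 1, by omega⟩
  induction s with
  | zero =>
    rw [Finset.sum_range_succ', Finset.sum_eq_zero]
    · simp
    · intro n _
      simp
  | succ s ih =>
    have h1 : ∀ n, ((g ^ ((s : ℤ) - n) : Aˣ) : A) * g = (g ^ (((s + 1 : ℕ) : ℤ) - n) : Aˣ) := by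
      intro n
      rw [← Units.val_mul, ← zpow_add_one]
      congr 2; push_cast; ring
    have h2 : ∀ n ∈ Finset.range q, (s.descFactorial n : A) *
        (((g ^ ((s : ℤ) - n) : Aˣ) : A) * X n) * g =
        (s.descFactorial n : A) * (((g ^ (((s + 1 : ℕ) : ℤ) - n) : Aˣ) : A) * X n) +
        (((n + 1) * s.descFactorial n : ℕ) : A) *
          (((g ^ (((s + 1 : ℕ) : ℤ) - (n + 1 : ℕ)) : Aˣ) : A) * X (n + 1)) := by
      intro n hn
      have h3 := hX n (by have := Finset.mem_range.mp hn; omega)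
      rw [sub_eq_iff_eq_add] at h3
      have h4 : (((s + 1 : ℕ) : ℤ) - (n + 1 : ℕ)) = (s : ℤ) - n := by push_cast; ring
      rw [mul_assoc, mul_assoc, h3, h4, mul_add, mul_add, ← h1, add_comm, mul_assoc]
      congr 1
      rw [Nat.cast_mul, ← mul_assoc (_ : A) _ (X (n + 1)), ← Nat.cast_comm (n + 1),
        mul_assoc (((n + 1 : ℕ)) : A), ← mul_assoc, Nat.cast_comm]
    -- Here s < q = p - 1, so the top term vanishes before multiplying by `g`, and no commutation
    -- rule for X (p-1) is needed.
    have h5 : s.descFactorial q = 0 := Nat.descFactorial_eq_zero_iff_lt.mpr (by omega)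
    rw [pow_succ, ← mul_assoc, ih (by omega), Finset.sum_range_succ, h5, Nat.cast_zero, zero_mul,
      add_zero, Finset.sum_mul, Finset.sum_congr rfl h2, Finset.sum_add_distrib,
      Finset.sum_range_succ']
    have h6 : ∑ n ∈ Finset.range q, (s.descFactorial n : A) *
        (((g ^ (((s + 1 : ℕ) : ℤ) - n) : Aˣ) : A) * X n) =
        ∑ n ∈ Finset.range q, (s.descFactorial (n + 1) : A) *
        (((g ^ (((s + 1 : ℕ) : ℤ) - (n + 1 : ℕ)) : Aˣ) : A) * X (n + 1)) +
        (((g ^ (((s + 1 : ℕ) : ℤ) - (0 : ℕ)) : Aˣ) : A) * X 0) := by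
      have h7 := Finset.sum_range_succ (fun n => (s.descFactorial n : A) *
        (((g ^ (((s + 1 : ℕ) : ℤ) - n) : Aˣ) : A) * X n)) q
      rw [h5, Nat.cast_zero, zero_mul, add_zero] at h7
      rw [← h7, Finset.sum_range_succ']
      simp
    rw [h6, Nat.descFactorial_zero, Nat.cast_one, one_mul, add_right_comm,
      ← Finset.sum_add_distrib]
    congr 1
    refine Finset.sum_congr rfl fun n _ => ?_
    rw [descFactorial_succ_add, Nat.cast_add (s.descFactorial (n + 1)), ← add_mul]

namespace IsTwistPair

variable {h : A} {g : Aˣ}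

variable (p) in
/-- The twist attached to a pair. -/
def tw (h : A) (g : Aˣ) : A ⊗[R] A :=
  ∑ a : ZMod p, eigIdem R h a ⊗ₜ unitPow g a

variable (p) in
/-- The element relating the antipode of a twisted algebra to the old antipode. -/
def twV (h : A) (g : Aˣ) : A := ∑ a : ZMod p, eigIdem R h a * unitPow g a

/-- `x` shifts the index of the idempotents by `w`; reindexing turns the shift into the factor g^w
in the other tensor leg. -/
theorem tw_mul_tmul_one {x : A} {w : ZMod p} (hx : h * x = x * h + primeScalar R A w * x)
    (T : IsTwistPair p h g) :
    tw p R h g * x ⊗ₜ 1 = x ⊗ₜ unitPow g w * tw p R h g := by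
  rw [tw, Finset.sum_mul, Finset.mul_sum, ← Equiv.sum_comp (Equiv.addRight w)]
  refine Finset.sum_congr rfl fun a _ => ?_
  rw [Algebra.TensorProduct.tmul_mul_tmul, Algebra.TensorProduct.tmul_mul_tmul, mul_one,
    eigIdem_mul_of_commutator R hx, ← unitPow_add T.g_pow, add_comm w]
  simp only [Equiv.coe_addRight, add_sub_cancel_right]

theorem commute_tw_left {x : A} (hx : Commute h x) (g : Aˣ) :
    Commute (tw p R h g) (x ⊗ₜ 1) := by
  refine Commute.sum_left _ _ _ fun a _ => ?_
  rw [Commute, SemiconjBy, Algebra.TensorProduct.tmul_mul_tmul,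
    Algebra.TensorProduct.tmul_mul_tmul, mul_one, one_mul, (commute_eigIdem R hx a).eq]

theorem commute_tw_right {x : A} (hx : Commute (g : A) x) (h : A) :
    Commute (tw p R h g) (1 ⊗ₜ x) := by
  refine Commute.sum_left _ _ _ fun a _ => ?_
  rw [Commute, SemiconjBy, Algebra.TensorProduct.tmul_mul_tmul,
    Algebra.TensorProduct.tmul_mul_tmul, mul_one, one_mul, (commute_unitPow hx a).eq]

theorem commute_tw {x y : A} (hx : Commute h x) (hy : Commute (g : A) y) :
    Commute (tw p R h g) (x ⊗ₜ y) := by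
  have : x ⊗ₜ[R] y = x ⊗ₜ 1 * 1 ⊗ₜ y := by
    rw [Algebra.TensorProduct.tmul_mul_tmul, mul_one, one_mul]
  rw [this]
  exact (commute_tw_left R hx g).mul_right (commute_tw_right R hy h)

/-- On the eigenspace of `h` at b the second leg is g^b X 0 g^(-b), expanded by `mul_unit_pow`. The
falling factorials obtained there are the values at b of the signed rising factorials of `h`. -/
theorem tw_mul_one_tmul (T : IsTwistPair p h g) {X : ℕ → A} (hX : IsDivPowFamily p g X) :
    tw p R h g * 1 ⊗ₜ X 0 = (∑ n ∈ Finset.range p,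
      ((-1) ^ n * rising h 0 n) ⊗ₜ (((g ^ (-(n : ℤ)) : Aˣ) : A) * X n)) * tw p R h g := by
  rw [tw, Finset.sum_mul, Finset.mul_sum]
  refine Finset.sum_congr rfl fun b _ => ?_
  rw [Algebra.TensorProduct.tmul_mul_tmul, mul_one, Finset.sum_mul]
  -- The residue of -b, not of b: then g^b = g^(-s), and X 0 g^s is expanded with 0 ≤ s < p.
  set s := (-b).val with hs
  have hb : b = -((s : ℕ) : ZMod p) := by rw [hs, ZMod.natCast_zmod_val, neg_neg]
  have hG : unitPow g b = ((g ^ (-(s : ℤ)) : Aˣ) : A) := by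
    rw [hb, ← unitPow_intCast T.g_pow]; push_cast; rfl
  have h1 : ∀ n, ((-1) ^ n * rising h 0 n) * eigIdem R h b =
      (s.descFactorial n : A) * eigIdem R h b := by
    intro n
    rw [mul_assoc, rising_mul_of_eigen R (mul_eigIdem R T.h_pow b), ← mul_assoc]
    congr 1
    rw [← map_natCast (primeScalar R A), ← neg_one_pow_mul_rising_neg, map_mul, map_pow, map_neg,
      map_one, hb]
  have h2 := mul_unit_pow hX s (ZMod.val_lt _)
  have h3 : unitPow g b * X 0 = ∑ n ∈ Finset.range p, (s.descFactorial n : A) *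
      (((g ^ (-(n : ℤ)) : Aˣ) : A) * X n * unitPow g b) := by
    have h4 : (g : A) ^ s * ((g ^ (-(s : ℤ)) : Aˣ) : A) = 1 := by
      rw [← Units.val_pow_eq_pow_val, ← Units.val_mul, ← zpow_natCast, ← zpow_add, add_neg_cancel,
        zpow_zero, Units.val_one]
    calc unitPow g b * X 0 = unitPow g b * (X 0 * (g : A) ^ s) * unitPow g b := by
          rw [hG, mul_assoc, mul_assoc, h4, mul_one]
      _ = _ := by
        rw [h2, Finset.mul_sum, Finset.sum_mul]
        refine Finset.sum_congr rfl fun n _ => ?_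
        have h5 : unitPow g b * ((g ^ ((s : ℤ) - n) : Aˣ) : A) = ((g ^ (-(n : ℤ)) : Aˣ) : A) := by
          rw [hG, ← Units.val_mul, ← zpow_add]
          congr 2; ring
        rw [← mul_assoc, ← Nat.cast_comm, mul_assoc, mul_assoc, ← mul_assoc (unitPow g b),
          ← mul_assoc (unitPow g b), h5]
  rw [h3, TensorProduct.tmul_sum]
  refine Finset.sum_congr rfl fun n _ => ?_
  rw [Algebra.TensorProduct.tmul_mul_tmul, h1, ← nsmul_eq_mul, ← nsmul_eq_mul,
    TensorProduct.tmul_smul, TensorProduct.smul_tmul']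

/-- Write the left factor as (g-1) ⊗ 1 + 1 ⊗ g. The element g - 1 has weight 1, so its term becomes
(g-1) ⊗ g, while 1 ⊗ g commutes with the twist. -/
theorem tw_mul_comul (T : IsTwistPair p h g) :
    tw p R h g * ((g : A) ⊗ₜ[R] (1 : A) + 1 ⊗ₜ (g : A) - 1) =
      ((g : A) ⊗ₜ (g : A)) * tw p R h g := by
  have h1 : h * ((g : A) - 1) = ((g : A) - 1) * h + primeScalar R A 1 * ((g : A) - 1) := by
    rw [map_one, mul_sub, T.comm]; noncomm_ring
  have h2 : ((g : A) ⊗ₜ[R] (1 : A) + 1 ⊗ₜ (g : A) - 1) = ((g : A) - 1) ⊗ₜ 1 + 1 ⊗ₜ (g : A) := by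
    rw [TensorProduct.sub_tmul, Algebra.TensorProduct.one_def]; abel
  have h3 : unitPow g (1 : ZMod p) = (g : A) := by
    have := unitPow_natCast (A := A) T.g_pow 1
    rwa [Nat.cast_one, pow_one] at this
  rw [h2, mul_add, tw_mul_tmul_one R h1 T, (commute_tw_right R (Commute.refl (g : A)) h).eq,
    ← add_mul, h3, ← TensorProduct.add_tmul, sub_add_cancel]

theorem h_mul_pow (T : IsTwistPair p h g) (s : ℕ) :
    h * (g : A) ^ (s + 1) = (g : A) ^ (s + 1) * h +
      ((s + 1 : ℕ) : A) * ((g : A) ^ (s + 1) - (g : A) ^ s) := by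
  induction s with
  | zero => rw [zero_add, pow_one, T.comm, Nat.cast_one, pow_zero]; noncomm_ring
  | succ s ih =>
    rw [pow_succ _ (s + 1), ← mul_assoc, ih, add_mul, mul_assoc, T.comm, mul_assoc, sub_mul,
      ← pow_succ, ← pow_succ]
    push_cast
    rw [mul_sub, mul_add, ← mul_assoc, ← pow_succ]
    noncomm_ring

/-- Moving `h` left through g^s yields (b-s) E_b g^s + s E_b g^(s-1), and b - s = w. At s = 0 the
truncated exponent is harmless, since its coefficient is zero. -/
theorem eigIdem_mul_pow_mul (T : IsTwistPair p h g) {b w : ZMod p} (s : ℕ) (hs : (s : ZMod p) = b - w) :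
    eigIdem R h b * (g : A) ^ s * (h - primeScalar R A w) =
      (s : A) * (eigIdem R h b * (g : A) ^ (s - 1)) := by
  have hE : eigIdem R h b * h = primeScalar R A b * eigIdem R h b := by
    rw [(commute_eigIdem R (Commute.refl h) b).eq, mul_eigIdem R T.h_pow]
  have hb : primeScalar R A b = s + primeScalar R A w := by
    rw [← map_natCast (primeScalar R A), ← map_add, hs, sub_add_cancel]
  rcases s with _ | s
  · rw [Nat.cast_zero, zero_add] at hb
    rw [pow_zero, mul_one, mul_sub, hE, Nat.cast_zero, zero_mul, hb, primeScalar_commutes, sub_self]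
  · have h1 := T.h_mul_pow s
    have h2 : (g : A) ^ (s + 1) * h = h * (g : A) ^ (s + 1) -
        ((s + 1 : ℕ) : A) * ((g : A) ^ (s + 1) - (g : A) ^ s) := by rw [h1, add_sub_cancel_right]
    have h3 : eigIdem R h b * (((s + 1 : ℕ) : A) * ((g : A) ^ (s + 1) - (g : A) ^ s)) =
        ((s + 1 : ℕ) : A) * (eigIdem R h b * (g : A) ^ (s + 1) - eigIdem R h b * (g : A) ^ s) := by
      rw [← mul_assoc, ← Nat.cast_comm, mul_assoc, mul_sub]
    rw [Nat.add_sub_cancel, mul_sub, mul_assoc, h2, mul_sub, ← mul_assoc, hE, h3, hb,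
      ← primeScalar_commutes]
    noncomm_ring

/-- Moved left past `y`, the n factors of the rising factorial become h - w, ..., h - (w+n-1), and
each lowers the exponent of `g` by one. The offset 1 in the rising factorial makes these shifts
match. -/
theorem eigIdem_mul_pow_mul_rising (T : IsTwistPair p h g) {b : ZMod p} {y : A} {v : ZMod p}
    (hy : h * y = y * h + primeScalar R A v * y) (n : ℕ) : ∀ (w : ZMod p) (s : ℕ),
    (s : ZMod p) = b - w → v = w + n →
    eigIdem R h b * (g : A) ^ s * y * rising h 1 n =
      (s.descFactorial n : A) * (eigIdem R h b * ((g ^ ((s : ℤ) - n) : Aˣ) : A) * y) := by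
  induction n with
  | zero =>
    intro w s hs hv
    simp [rising_zero]
  | succ n ih =>
    intro w s hs hv
    -- The weight of `y` is w + n + 1, so the last factor h + 1 + n becomes h - w on the left of
    -- `y`.
    have h1 : y * (h + 1 + n) = (h - primeScalar R A w) * y := by
      have : primeScalar R A v = primeScalar R A w + n + 1 := by
        rw [hv]; push_cast; rw [map_add, map_add, map_one, map_natCast, add_assoc]
      rw [sub_mul, hy, this, add_mul, add_mul, mul_add, mul_add, mul_one, one_mul, Nat.cast_comm]
      abel
    have h2 : y * rising h 1 (n + 1) = (h - primeScalar R A w) * y * rising h 1 n := by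
      have hc : Commute (rising h 1 n) (h + 1 + n) := commute_rising (((Commute.refl h).add_right
        (Commute.one_right h)).add_right (Nat.commute_cast h n)) 1 n
      rw [rising_succ, Nat.cast_one, hc.eq, ← mul_assoc, h1]
    rw [mul_assoc, h2, mul_assoc (h - _), ← mul_assoc, T.eigIdem_mul_pow_mul R s hs]
    rcases s with _ | s
    · simp
    · have h3 : ((s + 1 : ℕ) : ℤ) - (n + 1 : ℕ) = (s : ℤ) - n := by push_cast; ring
      rw [Nat.add_sub_cancel, mul_assoc, ← mul_assoc _ y, ih (w + 1) s
        (by push_cast at hs; linear_combination hs) (by rw [hv]; push_cast; ring),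
        Nat.succ_descFactorial_succ, Nat.cast_mul, h3]
      simp only [mul_assoc]

/-- It suffices to compare after multiplying by E_b on the left. One side becomes E_b X 0 g^s with s
the residue of b - w, expanded by `mul_unit_pow`; the other is E_b g^s Σ X n h_1^⟨n⟩, and
`eigIdem_mul_pow_mul_rising` matches them term by term. -/
theorem mul_twV (T : IsTwistPair p h g) {X : ℕ → A} (hX : IsDivPowFamily p g X) {w : ZMod p}
    (hw : ∀ n, n < p → h * X n = X n * h + primeScalar R A (w + n) * X n) :
    X 0 * twV p R h g = twV p R h g * (unitPow g (-w) *
      ∑ n ∈ Finset.range p, X n * rising h 1 n) := by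
  have hp := (Fact.out : p.Prime).pos
  have hEV : ∀ b, eigIdem R h b * twV p R h g = eigIdem R h b * unitPow g b := by
    intro b
    rw [twV, Finset.mul_sum, Finset.sum_eq_single b]
    · rw [← mul_assoc, eigIdem_mul_eigIdem R T.h_pow, if_pos rfl]
    · intro c _ hc
      rw [← mul_assoc, eigIdem_mul_eigIdem R T.h_pow, if_neg hc.symm, zero_mul]
    · simp
  have h0 := hw 0 hp
  rw [Nat.cast_zero, add_zero] at h0
  have key : ∀ b, eigIdem R h b * (X 0 * twV p R h g) = eigIdem R h b * (twV p R h g *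
      (unitPow g (-w) * ∑ n ∈ Finset.range p, X n * rising h 1 n)) := by
    intro b
    set s := (b - w).val with hs
    have hs' : (s : ZMod p) = b - w := ZMod.natCast_zmod_val _
    have hG : unitPow g (b - w) = (g : A) ^ s := by rw [← hs', unitPow_natCast T.g_pow]
    rw [← mul_assoc, eigIdem_mul_of_commutator R h0, mul_assoc, hEV, ← mul_assoc,
      ← eigIdem_mul_of_commutator R h0, ← mul_assoc, hEV, mul_assoc, mul_assoc, ← mul_assoc _ _
      (∑ n ∈ _, _), ← unitPow_add T.g_pow, ← sub_eq_add_neg, hG, mul_unit_pow hX s (ZMod.val_lt _),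
      Finset.mul_sum, Finset.mul_sum, Finset.mul_sum]
    refine Finset.sum_congr rfl fun n hn => ?_
    have := T.eigIdem_mul_pow_mul_rising R (b := b) (hw n (Finset.mem_range.mp hn)) n w s hs' rfl
    rw [mul_assoc, mul_assoc] at this
    rw [this, ← mul_assoc, ← Nat.cast_comm, mul_assoc, mul_assoc]
  calc X 0 * twV p R h g = (∑ b : ZMod p, eigIdem R h b) * (X 0 * twV p R h g) := by
        rw [sum_eigIdem, one_mul]
    _ = _ := by
        rw [Finset.sum_mul, Finset.sum_congr rfl fun b _ => key b, ← Finset.sum_mul, sum_eigIdem,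
          one_mul]

end IsTwistPair

end SingleTwist

/-! ### The product of two commuting twists, and its coproduct and antipode -/

section DoubleTwist

open TensorProduct

variable {p : ℕ} [Fact p.Prime] {R A : Type*} [CommRing R] [Ring A] [Algebra R A]
  [CharP R p] [CharP A p] {Δ : A →ₐ[R] A ⊗[R] A} {ε : A →ₐ[R] R} {S : A →ₗ[R] A}

/-- A twist pair `(h, g)` with `h` and `g - 1` primitive. -/
structure IsPrimitivePair (p : ℕ) (Δ : A →ₐ[R] A ⊗[R] A) (ε : A →ₐ[R] R) (S : A →ₗ[R] A)
    (h : A) (g : Aˣ) : Prop extends IsTwistPair p h g where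
  comul_h : Δ h = h ⊗ₜ 1 + 1 ⊗ₜ h
  comul_g : Δ g = (g : A) ⊗ₜ 1 + 1 ⊗ₜ (g : A) - 1
  counit_h : ε h = 0
  counit_g : ε g = 1
  antipode_h : S h = -h

/-- Two commuting pairs. -/
structure CommutePairs (h₁ h₂ : A) (g₁ g₂ : Aˣ) : Prop where
  hh : Commute h₁ h₂
  hg : Commute h₁ (g₂ : A)
  gh : Commute (g₁ : A) h₂
  gg : Commute (g₁ : A) (g₂ : A)

theorem map_pow_of_antihom (hS : ∀ a b, S (a * b) = S b * S a) (h1 : S 1 = 1) (x : A) (n : ℕ) :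
    S (x ^ n) = S x ^ n := by
  induction n with
  | zero => rw [pow_zero, pow_zero, h1]
  | succ n ih => rw [pow_succ, hS, ih, pow_succ']

theorem map_eigIdem_of_antihom (hS : ∀ a b, S (a * b) = S b * S a) (h1 : S 1 = 1) (x : A)
    (a : ZMod p) : S (eigIdem R x a) = eigIdem R (S x) a := by
  have : S (primeScalar R A a) = primeScalar R A a := by
    rw [primeScalar, RingHom.comp_apply, Algebra.algebraMap_eq_smul_one, map_smul, h1]
  rw [eigIdem, map_sub, h1, map_pow_of_antihom hS h1, map_sub, this, eigIdem]

namespace IsPrimitivePair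

variable {h₁ h₂ : A} {g₁ g₂ : Aˣ}

variable (R) in
/-- The products of the idempotents of the two pairs. -/
def idem (h₁ h₂ : A) (z : ZMod p × ZMod p) : A := eigIdem R h₁ z.1 * eigIdem R h₂ z.2

/-- The products of the unit powers of the two pairs. -/
def pows (g₁ g₂ : Aˣ) (z : ZMod p × ZMod p) : A := unitPow g₁ z.1 * unitPow g₂ z.2

theorem tw_eq (h₁ h₂ : A) (g₁ g₂ : Aˣ) :
    ∑ z : ZMod p × ZMod p, idem R h₁ h₂ z ⊗ₜ[R] pows g₁ g₂ z =
      IsTwistPair.tw p R h₁ g₁ * IsTwistPair.tw p R h₂ g₂ := by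
  rw [IsTwistPair.tw, IsTwistPair.tw, Finset.sum_mul_sum, Fintype.sum_prod_type]
  simp only [Algebra.TensorProduct.tmul_mul_tmul, idem, pows]

theorem commute_tw_tw (C : CommutePairs h₁ h₂ g₁ g₂) :
    Commute (IsTwistPair.tw p R h₁ g₁) (IsTwistPair.tw p R h₂ g₂) := by
  refine Commute.sum_right _ _ _ fun a _ => IsTwistPair.commute_tw R ?_ ?_
  · exact (commute_eigIdem R C.hh.symm a).symm
  · exact (commute_unitPow C.gg.symm a).symm

/-- Each factor of the twist makes its own unit grouplike and commutes with g ⊗ g for the unit of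
the other pair. -/
theorem semiconj_tw (P₁ : IsPrimitivePair p Δ ε S h₁ g₁) (P₂ : IsPrimitivePair p Δ ε S h₂ g₂)
    (C : CommutePairs h₁ h₂ g₁ g₂) :
    SemiconjBy (IsTwistPair.tw p R h₁ g₁ * IsTwistPair.tw p R h₂ g₂) (Δ g₁)
      ((g₁ : A) ⊗ₜ (g₁ : A)) ∧
    SemiconjBy (IsTwistPair.tw p R h₁ g₁ * IsTwistPair.tw p R h₂ g₂) (Δ g₂)
      ((g₂ : A) ⊗ₜ (g₂ : A)) := by
  have h1 : SemiconjBy (IsTwistPair.tw p R h₁ g₁) (Δ g₁) ((g₁ : A) ⊗ₜ (g₁ : A)) := by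
    rw [SemiconjBy, P₁.comul_g, P₁.tw_mul_comul R]
  have h2 : SemiconjBy (IsTwistPair.tw p R h₂ g₂) (Δ g₂) ((g₂ : A) ⊗ₜ (g₂ : A)) := by
    rw [SemiconjBy, P₂.comul_g, P₂.tw_mul_comul R]
  have h3 : Commute (IsTwistPair.tw p R h₂ g₂) ((g₁ : A) ⊗ₜ[R] (g₁ : A)) :=
    IsTwistPair.commute_tw R C.gh.symm C.gg.symm
  have h4 : Commute (IsTwistPair.tw p R h₁ g₁) ((g₂ : A) ⊗ₜ[R] (g₂ : A)) :=
    IsTwistPair.commute_tw R C.hg C.gg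
  refine ⟨?_, SemiconjBy.mul_left h4 h2⟩
  -- The factors are swapped so that the twist of the first pair meets Δ(g₁) first.
  rw [(commute_tw_tw C).eq]
  exact SemiconjBy.mul_left h3 h1

theorem isTwistData (hS : ∀ a b, S (a * b) = S b * S a) (hS1 : S 1 = 1)
    (P₁ : IsPrimitivePair p Δ ε S h₁ g₁) (P₂ : IsPrimitivePair p Δ ε S h₂ g₂)
    (C : CommutePairs h₁ h₂ g₁ g₂) :
    IsTwistData (Z := ZMod p × ZMod p) Δ ε S (idem R h₁ h₂) (pows g₁ g₂) where
  S_mul := hS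
  S_one := hS1
  E_mul a b := by
    have hc : Commute (eigIdem R h₂ a.2) (eigIdem R h₁ b.1) :=
      commute_eigIdem R (commute_eigIdem R C.hh _).symm _
    calc idem R h₁ h₂ a * idem R h₁ h₂ b
        = (eigIdem R h₁ a.1 * eigIdem R h₁ b.1) * (eigIdem R h₂ a.2 * eigIdem R h₂ b.2) := by
          rw [idem, idem, mul_assoc, ← mul_assoc (eigIdem R h₂ a.2), hc.eq]
          simp only [mul_assoc]
      _ = _ := by
          rw [eigIdem_mul_eigIdem R P₁.h_pow, eigIdem_mul_eigIdem R P₂.h_pow]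
          by_cases h1 : a.1 = b.1
          · by_cases h2 : a.2 = b.2
            · rw [if_pos h1, if_pos h2, if_pos (Prod.ext h1 h2), idem]
            · rw [if_neg h2, mul_zero, if_neg fun h => h2 (congrArg Prod.snd h)]
          · rw [if_neg h1, zero_mul, if_neg fun h => h1 (congrArg Prod.fst h)]
  E_sum := by
    rw [Fintype.sum_prod_type]
    simp only [idem, ← Finset.mul_sum, sum_eigIdem, mul_one]
  G_zero := by
    rw [pows, Prod.fst_zero, Prod.snd_zero, unitPow_zero, unitPow_zero, mul_one]
  G_add a b := by
    have hc : Commute (unitPow g₂ a.2) (unitPow g₁ b.1) :=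
      commute_unitPow (commute_unitPow C.gg _).symm _
    rw [pows, Prod.fst_add, Prod.snd_add, unitPow_add P₁.g_pow, unitPow_add P₂.g_pow, pows, pows,
      mul_assoc, mul_assoc, ← mul_assoc (unitPow g₁ b.1), ← hc.eq]
    simp only [mul_assoc]
  comul_E c := by
    rw [idem, map_mul, map_eigIdem, map_eigIdem, P₁.comul_h, P₂.comul_h,
      eigIdem_add R P₁.h_pow, eigIdem_add R P₂.h_pow, Finset.sum_mul_sum, Fintype.sum_prod_type]
    simp only [Algebra.TensorProduct.tmul_mul_tmul, idem, Prod.fst_sub, Prod.snd_sub]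
  counit_E a := by
    rw [idem, map_mul, map_eigIdem, map_eigIdem, P₁.counit_h, P₂.counit_h, eigIdem_zero,
      eigIdem_zero]
    by_cases h1 : a.1 = 0
    · by_cases h2 : a.2 = 0
      · rw [if_pos h1, if_pos h2, if_pos (Prod.ext h1 h2), mul_one]
      · rw [if_neg h2, mul_zero, if_neg fun h => h2 (congrArg Prod.snd h)]
    · rw [if_neg h1, zero_mul, if_neg fun h => h1 (congrArg Prod.fst h)]
  counit_G a := by
    rw [pows, map_mul, unitPow, unitPow, Units.val_pow_eq_pow_val, Units.val_pow_eq_pow_val,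
      map_pow, map_pow, P₁.counit_g, P₂.counit_g, one_pow, one_pow, mul_one]
  S_E a := by
    rw [idem, hS, map_eigIdem_of_antihom hS hS1, map_eigIdem_of_antihom hS hS1, P₁.antipode_h,
      P₂.antipode_h, eigIdem_neg, eigIdem_neg]
    exact commute_eigIdem R (commute_eigIdem R C.hh _).symm _
  twist z := by
    -- The group is generated by the two units, so intertwining them suffices.
    obtain ⟨h1, h2⟩ := semiconj_tw P₁ P₂ C
    have e : ∀ (g : Aˣ) (n : ℕ), ((g : A) ^ n) ⊗ₜ[R] ((g : A) ^ n) = ((g : A) ⊗ₜ (g : A)) ^ n :=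
      fun g n => (Algebra.TensorProduct.tmul_pow _ _ _).symm
    rw [tw_eq h₁ h₂ g₁ g₂, pows, map_mul, unitPow, unitPow, Units.val_pow_eq_pow_val,
      Units.val_pow_eq_pow_val, map_pow, map_pow, ← Algebra.TensorProduct.tmul_mul_tmul, e, e]
    exact (h1.pow_right _).mul_right (h2.pow_right _)

/-- The second pair stands on the left because in `antipode_eq` an element crosses it first,
producing Y 0 r, to which the first pair then applies. -/
theorem twV_eq (C : CommutePairs h₁ h₂ g₁ g₂) :
    IsTwistData.twV (idem R h₁ h₂) (pows (p := p) g₁ g₂) =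
      IsTwistPair.twV p R h₂ g₂ * IsTwistPair.twV p R h₁ g₁ := by
  rw [IsTwistData.twV, IsTwistPair.twV, IsTwistPair.twV, Finset.sum_mul_sum,
    Fintype.sum_prod_type, Finset.sum_comm]
  refine Finset.sum_congr rfl fun b _ => Finset.sum_congr rfl fun a _ => ?_
  have h1 : Commute (eigIdem R h₁ a) (eigIdem R h₂ b) :=
    commute_eigIdem R (commute_eigIdem R C.hh.symm _).symm _
  have h2 : Commute (unitPow g₁ a) (eigIdem R h₂ b) :=
    commute_unitPow (commute_eigIdem R C.gh.symm b).symm a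
  have h3 : Commute (unitPow g₁ a) (unitPow g₂ b) :=
    commute_unitPow (commute_unitPow C.gg.symm _).symm _
  have h4 : Commute (eigIdem R h₁ a) (unitPow g₂ b) :=
    (commute_unitPow (commute_eigIdem R C.hg a).symm b).symm
  calc eigIdem R h₁ a * eigIdem R h₂ b * (unitPow g₁ a * unitPow g₂ b)
      = eigIdem R h₂ b * eigIdem R h₁ a * (unitPow g₂ b * unitPow g₁ a) := by rw [h1.eq, h3.eq]
    _ = eigIdem R h₂ b * (eigIdem R h₁ a * unitPow g₂ b) * unitPow g₁ a := by
        simp only [mul_assoc]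
    _ = _ := by rw [h4.eq]; simp only [mul_assoc]

/-- The family `Y ℓ r` plays the role of `d₁^(ℓ) d₂^(r) x` for an element `x` of weight
`(w₁, w₂)`. -/
structure IsDoubleFamily (p : ℕ) [Fact p.Prime] (R : Type*) {A : Type*} [CommRing R] [Ring A]
    [Algebra R A] [CharP R p] (h₁ h₂ : A) (g₁ g₂ : Aˣ) (w₁ w₂ : ℤ) (Y : ℕ → ℕ → A) : Prop where
  left : ∀ r, IsDivPowFamily p g₁ fun ℓ => Y ℓ r
  right : IsDivPowFamily p g₂ (Y 0)
  wt_left : ∀ r, ∀ ℓ, ℓ < p → h₁ * Y ℓ r = Y ℓ r * h₁ + primeScalar R A (w₁ + ℓ) * Y ℓ r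
  wt_right : ∀ r, r < p → h₂ * Y 0 r = Y 0 r * h₂ + primeScalar R A (w₂ + r) * Y 0 r

/-- The twist F₁F₂ is moved from the left to the right of Δ(x), where its inverse cancels it. -/
theorem comul_eq (hS : ∀ a b, S (a * b) = S b * S a) (hS1 : S 1 = 1)
    (P₁ : IsPrimitivePair p Δ ε S h₁ g₁) (P₂ : IsPrimitivePair p Δ ε S h₂ g₂)
    (C : CommutePairs h₁ h₂ g₁ g₂) {w₁ w₂ : ℤ} {Y : ℕ → ℕ → A}
    (hY : IsDoubleFamily p R h₁ h₂ g₁ g₂ w₁ w₂ Y)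
    (hx : Δ (Y 0 0) = Y 0 0 ⊗ₜ 1 + 1 ⊗ₜ Y 0 0) :
    (isTwistData hS hS1 P₁ P₂ C).comul (Y 0 0) =
      Y 0 0 ⊗ₜ (((g₁ ^ w₁ : Aˣ) : A) * ((g₂ ^ w₂ : Aˣ) : A)) +
      ∑ r ∈ Finset.range p, ∑ ℓ ∈ Finset.range p,
        (((-1) ^ ℓ * rising h₁ 0 ℓ) * ((-1) ^ r * rising h₂ 0 r)) ⊗ₜ
          (((g₁ ^ (-ℓ : ℤ) : Aˣ) : A) * ((g₂ ^ (-r : ℤ) : Aˣ) : A) * Y ℓ r) := by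
  have hp := (Fact.out : p.Prime).pos
  have hw₁ := hY.wt_left 0 0 hp
  have hw₂ := hY.wt_right 0 hp
  rw [Nat.cast_zero, add_zero] at hw₁ hw₂
  set F₁ := IsTwistPair.tw p R h₁ g₁ with hF₁
  set F₂ := IsTwistPair.tw p R h₂ g₂ with hF₂
  have key : F₁ * F₂ * Δ (Y 0 0) =
      (Y 0 0 ⊗ₜ (((g₁ ^ w₁ : Aˣ) : A) * ((g₂ ^ w₂ : Aˣ) : A)) +
      ∑ r ∈ Finset.range p, ∑ ℓ ∈ Finset.range p,
        (((-1) ^ ℓ * rising h₁ 0 ℓ) * ((-1) ^ r * rising h₂ 0 r)) ⊗ₜ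
          (((g₁ ^ (-ℓ : ℤ) : Aˣ) : A) * ((g₂ ^ (-r : ℤ) : Aˣ) : A) * Y ℓ r)) * (F₁ * F₂) := by
    rw [hx, mul_add, add_mul]
    congr 1
    -- Both twists cross x ⊗ 1, each leaving a power of its unit in the second leg.
    · have e1 : F₁ * 1 ⊗ₜ ((g₂ ^ w₂ : Aˣ) : A) = 1 ⊗ₜ ((g₂ ^ w₂ : Aˣ) : A) * F₁ := by
        refine (IsTwistPair.commute_tw_right R ?_ _).eq
        exact Commute.units_zpow_right C.gg w₂
      have e2 : Y 0 0 ⊗ₜ[R] ((g₂ ^ w₂ : Aˣ) : A) = 1 ⊗ₜ ((g₂ ^ w₂ : Aˣ) : A) * Y 0 0 ⊗ₜ 1 := by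
        rw [Algebra.TensorProduct.tmul_mul_tmul, one_mul, mul_one]
      have e3 : ((g₁ ^ w₁ : Aˣ) : A) * ((g₂ ^ w₂ : Aˣ) : A) =
          ((g₂ ^ w₂ : Aˣ) : A) * ((g₁ ^ w₁ : Aˣ) : A) := by
        exact Commute.units_zpow_right (Commute.units_zpow_left C.gg w₁) w₂
      rw [mul_assoc, IsTwistPair.tw_mul_tmul_one R hw₂ P₂.toIsTwistPair,
        unitPow_intCast P₂.g_pow, ← mul_assoc, e2, ← mul_assoc, e1, mul_assoc _ F₁,
        IsTwistPair.tw_mul_tmul_one R hw₁ P₁.toIsTwistPair, unitPow_intCast P₁.g_pow, ← mul_assoc,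
        Algebra.TensorProduct.tmul_mul_tmul, one_mul, ← e3, mul_assoc]
    -- Crossing F₂ turns 1 ⊗ Y 0 0 into a sum over the Y 0 r; crossing F₁ then expands each of these
    -- into the Y ℓ r.
    · have e1 := P₂.tw_mul_one_tmul R hY.right
      have e2 : ∀ r, F₁ * 1 ⊗ₜ Y 0 r = _ := fun r => P₁.tw_mul_one_tmul R (hY.left r)
      rw [mul_assoc, e1, ← mul_assoc, ← mul_assoc, Finset.mul_sum]
      congr 1
      rw [Finset.sum_mul]
      refine Finset.sum_congr rfl fun r _ => ?_
      have e3 : Commute F₁ (((-1) ^ r * rising h₂ 0 r) ⊗ₜ ((g₂ ^ (-r : ℤ) : Aˣ) : A)) := by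
        refine IsTwistPair.commute_tw R ?_ (Commute.units_zpow_right C.gg _)
        exact ((Commute.neg_one_right _).pow_right r).mul_right (commute_rising C.hh.symm 0 r).symm
      have e4 : ((-1) ^ r * rising h₂ 0 r) ⊗ₜ[R] (((g₂ ^ (-r : ℤ) : Aˣ) : A) * Y 0 r) =
          ((-1) ^ r * rising h₂ 0 r) ⊗ₜ ((g₂ ^ (-r : ℤ) : Aˣ) : A) * 1 ⊗ₜ Y 0 r := by
        rw [Algebra.TensorProduct.tmul_mul_tmul, mul_one]
      rw [e4, ← mul_assoc, e3.eq, mul_assoc, e2, ← mul_assoc]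
      congr 1
      rw [Finset.mul_sum]
      refine Finset.sum_congr rfl fun ℓ _ => ?_
      have e5 : Commute ((-1) ^ r * rising h₂ 0 r) ((-1) ^ ℓ * rising h₁ 0 ℓ) := by
        refine Commute.mul_left (Commute.pow_left (Commute.neg_one_left _) r) ?_
        refine Commute.mul_right ((Commute.neg_one_right _).pow_right ℓ) ?_
        exact commute_rising (commute_rising C.hh 0 ℓ).symm 0 r
      have e6 : Commute ((g₂ ^ (-r : ℤ) : Aˣ) : A) ((g₁ ^ (-ℓ : ℤ) : Aˣ) : A) :=
        Commute.units_zpow_right (Commute.units_zpow_left C.gg.symm _) _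
      rw [Algebra.TensorProduct.tmul_mul_tmul, e5.eq, ← mul_assoc (_ : A) _ (Y ℓ r), e6.eq]
  have hinv := (isTwistData hS hS1 P₁ P₂ C).tw_mul_twInv
  have htw : IsTwistData.tw R (idem R h₁ h₂) (pows (p := p) g₁ g₂) = F₁ * F₂ := tw_eq h₁ h₂ g₁ g₂
  rw [IsTwistData.comul_apply]
  rw [htw] at hinv ⊢
  rw [key, mul_assoc, hinv, mul_one]

/-- The new antipode of x is -U x V. Moving x to the right of V = V₂V₁ by `mul_twV`, once for each
pair, leaves U V = 1 in front. -/
theorem antipode_eq (H : IsHopfData Δ ε S) (hS : ∀ a b, S (a * b) = S b * S a) (hS1 : S 1 = 1)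
    (P₁ : IsPrimitivePair p Δ ε S h₁ g₁) (P₂ : IsPrimitivePair p Δ ε S h₂ g₂)
    (C : CommutePairs h₁ h₂ g₁ g₂) {w₁ w₂ : ℤ} {Y : ℕ → ℕ → A}
    (hY : IsDoubleFamily p R h₁ h₂ g₁ g₂ w₁ w₂ Y) (hx : S (Y 0 0) = -Y 0 0) :
    (isTwistData hS hS1 P₁ P₂ C).antipode (Y 0 0) =
      -(((g₁ ^ (-w₁) : Aˣ) : A) * ((g₂ ^ (-w₂) : Aˣ) : A) *
        ∑ r ∈ Finset.range p, ∑ ℓ ∈ Finset.range p,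
          Y ℓ r * rising h₁ 1 ℓ * rising h₂ 1 r) := by
  set V₁ := IsTwistPair.twV p R h₁ g₁ with hV₁
  set V₂ := IsTwistPair.twV p R h₂ g₂ with hV₂
  have e1 : Y 0 0 * V₂ = _ := P₂.mul_twV R hY.right hY.wt_right
  have e2 : ∀ r, Y 0 r * V₁ = _ := fun r => P₁.mul_twV R (hY.left r) (hY.wt_left r)
  have c1 : ∀ {x : A}, Commute h₁ x → Commute (g₁ : A) x → Commute x V₁ := by
    intro x hx hx'
    refine Commute.sum_right _ _ _ fun a _ => Commute.mul_right ?_ ?_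
    · exact (commute_eigIdem R hx a).symm
    · exact (commute_unitPow hx' a).symm
  have c2 : ∀ r, Commute (rising h₂ 1 r) V₁ := fun r =>
    c1 (commute_rising C.hh.symm 1 r).symm (commute_rising C.gh.symm 1 r).symm
  have c3 : Commute (unitPow g₂ (-w₂ : ZMod p)) V₁ :=
    c1 (commute_unitPow C.hg.symm _).symm (commute_unitPow C.gg.symm _).symm
  have c4 : Commute (unitPow g₂ (-w₂ : ZMod p)) (unitPow g₁ (-w₁ : ZMod p)) :=
    commute_unitPow (commute_unitPow C.gg _).symm _
  have key : Y 0 0 * (V₂ * V₁) = V₂ * V₁ * (unitPow g₁ (-w₁ : ZMod p) *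
      unitPow g₂ (-w₂ : ZMod p) * ∑ r ∈ Finset.range p, ∑ ℓ ∈ Finset.range p,
          Y ℓ r * rising h₁ 1 ℓ * rising h₂ 1 r) := by
    have e3 : (∑ r ∈ Finset.range p, Y 0 r * rising h₂ 1 r) * V₁ =
        V₁ * (unitPow g₁ (-w₁ : ZMod p) * ∑ r ∈ Finset.range p, ∑ ℓ ∈ Finset.range p,
          Y ℓ r * rising h₁ 1 ℓ * rising h₂ 1 r) := by
      rw [Finset.sum_mul, Finset.mul_sum, Finset.mul_sum]
      refine Finset.sum_congr rfl fun r _ => ?_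
      rw [mul_assoc, (c2 r).eq, ← mul_assoc, e2, ← Finset.sum_mul]
      simp only [mul_assoc, ← hV₁]
    calc Y 0 0 * (V₂ * V₁) = V₂ * (unitPow g₂ (-w₂ : ZMod p) *
          ((∑ r ∈ Finset.range p, Y 0 r * rising h₂ 1 r) * V₁)) := by
          rw [← mul_assoc, e1]; simp only [mul_assoc, ← hV₂]
      _ = V₂ * ((unitPow g₂ (-w₂ : ZMod p) * V₁) * (unitPow g₁ (-w₁ : ZMod p) *
          ∑ r ∈ Finset.range p, ∑ ℓ ∈ Finset.range p,
          Y ℓ r * rising h₁ 1 ℓ * rising h₂ 1 r)) := by rw [e3]; simp only [mul_assoc]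
      _ = V₂ * V₁ * ((unitPow g₂ (-w₂ : ZMod p) * unitPow g₁ (-w₁ : ZMod p)) *
          ∑ r ∈ Finset.range p, ∑ ℓ ∈ Finset.range p,
          Y ℓ r * rising h₁ 1 ℓ * rising h₂ 1 r) := by rw [c3.eq]; simp only [mul_assoc]
      _ = _ := by rw [c4.eq]
  have hUV := (isTwistData hS hS1 P₁ P₂ C).twU_mul_twV H
  rw [IsTwistData.antipode_apply, hx, neg_mul, mul_neg]
  rw [twV_eq C] at hUV ⊢
  rw [key, ← mul_assoc, hUV, one_mul, ← Int.cast_neg, ← Int.cast_neg, unitPow_intCast P₁.g_pow,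
    unitPow_intCast P₂.g_pow]

end IsPrimitivePair

end DoubleTwist

/-! ### Multidegrees and the action of D_ij(x^(α)) on monomials -/

section Weights

variable {K : Type*} [Field K] {n p : ℕ}

/-- `f` is homogeneous of multidegree `δ`. -/
def HasWt (δ : Fin n → ℤ) (f : TruncDP K n p) : Prop := ∀ γ, f γ ≠ 0 → ∀ l, ((γ l : ℕ) : ℤ) = δ l

theorem hasWt_mono (α : Fin n → ℕ) :
    HasWt (fun l => (α l : ℤ)) (mono α : TruncDP K n p) := by
  intro γ hγ l
  rw [mono_apply] at hγ
  have := (ite_ne_right_iff.mp hγ).1 l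
  rw [this]

theorem HasWt.sub {δ : Fin n → ℤ} {f g : TruncDP K n p} (hf : HasWt δ f) (hg : HasWt δ g) :
    HasWt δ (f - g) := by
  intro γ hγ
  have : (f - g) γ = f γ - g γ := rfl
  rw [this] at hγ
  by_cases h : f γ = 0
  · exact hg γ fun h' => hγ (by rw [h, h', sub_zero])
  · exact hf γ h

theorem HasWt.mul {δ δ' : Fin n → ℤ} {f g : TruncDP K n p} (hf : HasWt δ f) (hg : HasWt δ' g) :
    HasWt (δ + δ') (f * g) := by
  intro γ hγ l
  rw [mul_apply] at hγ
  obtain ⟨α, _, hα⟩ := Finset.exists_ne_zero_of_sum_ne_zero hγ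
  obtain ⟨β, _, hβ⟩ := Finset.exists_ne_zero_of_sum_ne_zero hα
  have h1 := hf α (left_ne_zero_of_mul (right_ne_zero_of_mul hβ)) l
  have h2 := hg β (right_ne_zero_of_mul (right_ne_zero_of_mul hβ)) l
  have h3 : structureConst α β γ ≠ 0 := fun h =>
    left_ne_zero_of_mul hβ (by rw [h, Nat.cast_zero])
  have h4 := (ite_ne_right_iff.mp (Finset.prod_ne_zero_iff.mp h3 l (Finset.mem_univ l))).1
  rw [Pi.add_apply, ← h1, ← h2, ← h4, Nat.cast_add]

theorem HasWt.eq_zero {δ : Fin n → ℤ} {f : TruncDP K n p} (hf : HasWt δ f) (l : Fin n)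
    (hl : δ l < 0 ∨ (p : ℤ) ≤ δ l) : f = 0 := by
  ext γ
  by_contra h
  have := hf γ h l
  have h2 := (γ l).isLt
  omega

variable [Fact p.Prime] [CharP K p]

theorem HasWt.pd {δ : Fin n → ℤ} {f : TruncDP K n p} (hf : HasWt δ f) (j : Fin n) :
    HasWt (δ - Pi.single j 1) (pd j f) := by
  intro γ hγ l
  rw [pd_apply] at hγ
  obtain ⟨α, _, hα⟩ := Finset.exists_ne_zero_of_sum_ne_zero hγ
  have h1 := hf α (right_ne_zero_of_mul hα) l
  have h3 : shiftConst j α γ ≠ 0 := fun h =>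
    left_ne_zero_of_mul hα (by rw [h, Nat.cast_zero])
  have h4 := (ite_ne_right_iff.mp (Finset.prod_ne_zero_iff.mp h3 l (Finset.mem_univ l))).1
  rw [Pi.sub_apply, ← h1, h4]
  by_cases h : l = j
  · subst h; simp
  · simp [h]

theorem HasWt.euler {δ : Fin n → ℤ} {f : TruncDP K n p} (hf : HasWt δ f) (i : Fin n) :
    var i * TruncDP.pd i f = (δ i : K) • f := by
  conv_lhs => rw [eq_sum_mono f]
  conv_rhs => rw [eq_sum_mono f]
  rw [map_sum, Finset.mul_sum, Finset.smul_sum]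
  refine Finset.sum_congr rfl fun α _ => ?_
  rw [Derivation.map_smul, mul_smul_comm, var_mul_pd_mono i _ fun l => (α l).isLt, smul_comm]
  by_cases h : f α = 0
  · rw [h, zero_smul, smul_zero, smul_zero]
  · rw [← hf α h i, Int.cast_natCast]

theorem linearMap_ext_mono {M : Type*} [AddCommGroup M] [Module K M]
    {F G : TruncDP K n p →ₗ[K] M}
    (h : ∀ α : Fin n → Fin p, F (mono fun i => (α i : ℕ)) = G (mono fun i => (α i : ℕ))) :
    F = G := by
  refine LinearMap.ext fun f => ?_
  rw [eq_sum_mono f, map_sum, map_sum]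
  exact Finset.sum_congr rfl fun α _ => by rw [map_smul, map_smul, h]

theorem witt_ext_mono {E F : WittAlg K n p}
    (h : ∀ α : Fin n → Fin p, E (mono fun i => (α i : ℕ)) = F (mono fun i => (α i : ℕ))) :
    E = F := by
  have := linearMap_ext_mono (F := E.toLinearMap) (G := F.toLinearMap) h
  exact Derivation.ext fun f => congrArg (fun l : TruncDP K n p →ₗ[K] TruncDP K n p => l f) this

/-- The multidegree of `D_ij(x^(α))`. -/
def degDij (i j : Fin n) (α : Fin n → ℕ) : Fin n → ℤ :=
  (fun l => (α l : ℤ)) - Pi.single i 1 - Pi.single j 1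

theorem degDij_apply_sub (i j : Fin n) (α : Fin n → ℕ) (k k' : Fin n) :
    degDij i j α k - degDij i j α k' = wt α i j k k' := by
  simp only [degDij, wt, Pi.sub_apply, Pi.single_apply, eq_comm]
  ring

theorem HasWt.Dij {δ : Fin n → ℤ} {f : TruncDP K n p} (hf : HasWt δ f) (i j : Fin n)
    (α : Fin n → ℕ) : HasWt (degDij i j α + δ) (Dij i j (mono α) f) := by
  rw [Dij_apply]
  have h1 : degDij i j α + δ = (fun l => (α l : ℤ)) - Pi.single j 1 + (δ - Pi.single i 1) := by
    rw [degDij]; abel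
  have h2 : degDij i j α + δ = (fun l => (α l : ℤ)) - Pi.single i 1 + (δ - Pi.single j 1) := by
    rw [degDij]; abel
  refine HasWt.sub ?_ ?_
  · rw [h1]; exact ((hasWt_mono α).pd j).mul (hf.pd i)
  · rw [h2]; exact ((hasWt_mono α).pd i).mul (hf.pd j)

theorem eps_add_eps_lt (k k' : Fin n) (hk : k ≠ k') (i : Fin n) : eps k i + eps k' i < p := by
  have := (Fact.out : p.Prime).two_le
  by_cases h : i = k
  · subst h; rw [eps, eps, Pi.single_eq_same, Pi.single_eq_of_ne hk]; omega
  · rw [eps, Pi.single_eq_of_ne h, zero_add]; exact eps_lt k' i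

/-- The operator is x_k D_k - x_k' D_k', a difference of Euler operators. -/
theorem Dij_toral_apply {k k' : Fin n} (hk : k ≠ k') {δ : Fin n → ℤ} {f : TruncDP K n p}
    (hf : HasWt δ f) :
    Dij k k' (mono (eps k + eps k')) f = ((δ k - δ k' : ℤ) : K) • f := by
  have h1 : TruncDP.pd k' (mono (eps k + eps k') : TruncDP K n p) = var k :=
    pd_mono_add k' _ (eps_add_eps_lt k k' hk)
  have h2 : TruncDP.pd k (mono (eps k + eps k') : TruncDP K n p) = var k' := by
    rw [add_comm]; exact pd_mono_add k _ (eps_add_eps_lt k' k hk.symm)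
  rw [Dij_apply, h1, h2, hf.euler, hf.euler, Int.cast_sub, sub_smul]

theorem two_eps_add_lt (hp : 2 < p) (k k' : Fin n) (hk : k ≠ k') (i : Fin n) :
    (2 • eps k) i + eps k' i < p := by
  by_cases h : i = k
  · subst h; simp [eps, Pi.single_eq_of_ne hk]; omega
  · simp only [Pi.smul_apply, eps, Pi.single_eq_of_ne h, smul_zero, zero_add]
    exact eps_lt k' i

theorem two_smul_mono (hp : 2 < p) (k : Fin n) :
    (2 : K) • (mono (2 • eps k) : TruncDP K n p) = var k * var k := by
  have h : ∀ l, eps k l + eps k l < p := by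
    intro l
    by_cases h : l = k
    · subst h; simpa [eps] using hp
    · simp only [eps, Pi.single_eq_of_ne h]; omega
  rw [var_mul_mono k _ h, two_smul ℕ, eps, Pi.single_eq_same]
  norm_num

/-- The operator is x_k (x_k D_k - 2 x_k' D_k'), that is, a degree-dependent scalar followed by
multiplication by x_k. -/
theorem two_Dij_apply (hp : 2 < p) {k k' : Fin n} (hk : k ≠ k') {δ : Fin n → ℤ}
    {f : TruncDP K n p} (hf : HasWt δ f) :
    (2 : K) • Dij k k' (mono (2 • eps k + eps k')) f =
      ((δ k - 2 * δ k' : ℤ) : K) • (var k * f) := by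
  have h1 : TruncDP.pd k' (mono (2 • eps k + eps k') : TruncDP K n p) = mono (2 • eps k) :=
    pd_mono_add k' _ (two_eps_add_lt hp k k' hk)
  have h2 : TruncDP.pd k (mono (2 • eps k + eps k') : TruncDP K n p) = var k * var k' := by
    have e : 2 • eps k + eps k' = (eps k' + eps k) + eps k := by rw [two_smul]; abel
    rw [e, pd_mono_add k _ fun i => by rw [← Pi.add_apply, ← e]; exact two_eps_add_lt hp k k' hk i,
      var_mul_mono k (eps k') fun l => eps_add_eps_lt k' k hk.symm l, eps,
      Pi.single_eq_of_ne hk, zero_add, Nat.cast_one, one_smul]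
  have h3 := hf.euler k
  have h4 := hf.euler k'
  rw [Dij_apply, h1, h2, smul_sub, ← smul_mul_assoc, two_smul_mono hp, mul_assoc, h3, mul_assoc,
    h4, mul_smul_comm, mul_smul_comm, smul_smul, ← sub_smul]
  push_cast
  rfl

/-- The brackets with a toral element. -/
theorem lie_toral {k k' : Fin n} (hk : k ≠ k') (i j : Fin n) (α : Fin n → ℕ) :
    ⁅(Dij k k' (mono (eps k + eps k')) : WittAlg K n p), (Dij i j (mono α) : WittAlg K n p)⁆ =
      (wt α i j k k' : K) • (Dij i j (mono α) : WittAlg K n p) := by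
  refine witt_ext_mono fun γ => ?_
  have hγ := hasWt_mono (K := K) (p := p) fun i => (γ i : ℕ)
  have hD := hγ.Dij i j α
  rw [Derivation.commutator_apply, Dij_toral_apply hk hγ, Dij_toral_apply hk hD,
    Derivation.map_smul, ← sub_smul, Derivation.smul_apply, ← degDij_apply_sub, ← Int.cast_sub]
  congr 2
  simp only [Pi.add_apply]
  ring

theorem hasWt_var_mul {δ : Fin n → ℤ} {f : TruncDP K n p} (hf : HasWt δ f) (k : Fin n) :
    HasWt ((fun l => ((eps k l : ℕ) : ℤ)) + δ) (var k * f) :=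
  (hasWt_mono (eps k)).mul hf

/-- Each operator multiplies by x_k or x_m with a scalar read from the degrees at k, k' or at m, m'.
The index conditions ensure that neither multiplication changes the other scalar; k' = m' is
allowed. -/
theorem lie_two_Dij (hp : 2 < p) {k k' m m' : Fin n} (hkk' : k ≠ k') (hmm' : m ≠ m')
    (hkm : k ≠ m) (hkm' : k ≠ m') (hk'm : k' ≠ m) :
    ⁅(2 : K) • (Dij k k' (mono (2 • eps k + eps k')) : WittAlg K n p),
      (2 : K) • (Dij m m' (mono (2 • eps m + eps m')) : WittAlg K n p)⁆ = 0 := by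
  refine witt_ext_mono fun γ => ?_
  have hγ := hasWt_mono (K := K) (p := p) fun i => (γ i : ℕ)
  rw [Derivation.commutator_apply]
  simp only [Derivation.smul_apply]
  rw [two_Dij_apply hp hmm' hγ, two_Dij_apply hp hkk' hγ, Derivation.map_smul, Derivation.map_smul,
    smul_comm (2 : K), smul_comm (2 : K), two_Dij_apply hp hkk' (hasWt_var_mul hγ m),
    two_Dij_apply hp hmm' (hasWt_var_mul hγ k), mul_left_comm, smul_comm]
  simp [eps, Pi.single_eq_of_ne hkm, Pi.single_eq_of_ne hkm.symm, Pi.single_eq_of_ne hkm'.symm,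
    Pi.single_eq_of_ne hk'm]

/-- Some coordinate of the degree of the operator is nonzero, so p applications move that exponent
by at least p, out of the range 0, ..., p-1. -/
theorem Dij_pow_of_ne (i j : Fin n) (α : Fin n → ℕ) (hα : α ≠ eps i + eps j) :
    (Dij i j (mono α) : WittAlg K n p).toLinearMap ^ p = 0 := by
  refine linearMap_ext_mono fun γ => ?_
  have key : ∀ s : ℕ, HasWt (s • degDij i j α + fun l => ((γ l : ℕ) : ℤ))
      (((Dij i j (mono α) : WittAlg K n p).toLinearMap ^ s) (mono fun l => (γ l : ℕ))) := by
    intro s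
    induction s with
    | zero => rw [zero_smul, zero_add, pow_zero]; exact hasWt_mono _
    | succ s ih =>
      rw [pow_succ', succ_nsmul', add_assoc]
      exact ih.Dij i j α
  obtain ⟨l, hl⟩ : ∃ l, degDij i j α l ≠ 0 := by
    by_contra hcon
    push Not at hcon
    refine hα (funext fun l => ?_)
    have h := hcon l
    simp only [degDij, Pi.sub_apply, Pi.single_apply] at h
    simp only [Pi.add_apply, eps, Pi.single_apply]
    split_ifs at h ⊢ <;> omega
  rw [LinearMap.zero_apply]
  refine (key p).eq_zero l ?_
  have h2 := (γ l).isLt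
  rw [Pi.add_apply, Pi.smul_apply, nsmul_eq_mul]
  rcases lt_or_gt_of_ne hl with h | h
  · left; nlinarith
  · right; nlinarith

theorem intCast_pow_card (z : ℤ) : (z : K) ^ p = z := by
  have := congrArg (ZMod.castHom (dvd_refl p) K) (ZMod.pow_card (z : ZMod p))
  rwa [map_pow, map_intCast] at this

/-- The operator is diagonal on monomials with eigenvalues in the prime field, which Frobenius
fixes. -/
theorem Dij_toral_pow {i j : Fin n} (hij : i ≠ j) :
    (Dij i j (mono (eps i + eps j)) : WittAlg K n p).toLinearMap ^ p =
      (Dij i j (mono (eps i + eps j)) : WittAlg K n p).toLinearMap := by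
  refine linearMap_ext_mono fun γ => ?_
  have hγ := hasWt_mono (K := K) (p := p) fun i => (γ i : ℕ)
  have h1 : (Dij i j (mono (eps i + eps j)) : WittAlg K n p).toLinearMap (mono fun i => (γ i : ℕ)) =
      (((γ i : ℕ) - (γ j : ℕ) : ℤ) : K) • (mono fun i => (γ i : ℕ)) := Dij_toral_apply hij hγ
  have key : ∀ s : ℕ, ((Dij i j (mono (eps i + eps j)) : WittAlg K n p).toLinearMap ^ s)
      (mono fun i => (γ i : ℕ)) =
      (((γ i : ℕ) - (γ j : ℕ) : ℤ) : K) ^ s • (mono fun i => (γ i : ℕ)) := by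
    intro s
    induction s with
    | zero => rw [pow_zero, pow_zero, one_smul]; rfl
    | succ s ih => rw [pow_succ, Module.End.mul_apply, h1, map_smul, ih, smul_smul, pow_succ']
  rw [key, h1, intCast_pow_card]

end Weights

/-! ### Spanning set, linear equations and dimension of the special algebra -/

section SpecialDimension

variable (K : Type*) [Field K] (n p : ℕ) [Fact p.Prime] [CharP K p]

/-- The spanning set of the special algebra inside the Jacobson-Witt algebra. -/
def genSet : Set (WittAlg K n p) :=
  {E | ∃ i j : Fin n, i < j ∧ ∃ α : Fin n → ℕ, (∀ l, α l < p) ∧ E = Dij i j (mono α)}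

variable {K n p}

theorem mono_eq_zero {α : Fin n → ℕ} (h : ¬ ∀ l, α l < p) : (mono α : TruncDP K n p) = 0 := by
  ext γ
  rw [mono_apply, if_neg]
  · rfl
  · exact fun h' => h fun l => (h' l) ▸ (γ l).isLt

theorem Dij_mem_span_genSet (i j : Fin n) (α : Fin n → ℕ) :
    Dij i j (mono α) ∈ Submodule.span K (genSet K n p) := by
  by_cases hα : ∀ l, α l < p
  · rcases lt_trichotomy i j with h | h | h
    · exact Submodule.subset_span ⟨i, j, h, α, hα, rfl⟩
    · rw [h, Dij_self]; exact zero_mem _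
    · rw [Dij_swap]
      exact neg_mem (Submodule.subset_span ⟨j, i, h, α, hα, rfl⟩)
  · rw [mono_eq_zero hα, map_zero]; exact zero_mem _

/-- The exponent `τ - (p-1) ε_i`. -/
def topExp (i : Fin n) : Fin n → Fin p := fun l =>
  if l = i then ⟨0, (Fact.out : p.Prime).pos⟩
  else ⟨p - 1, Nat.sub_lt (Fact.out : p.Prime).pos one_pos⟩

theorem pd_apply_of_top (j : Fin n) (f : TruncDP K n p) (γ : Fin n → Fin p)
    (hγ : (γ j : ℕ) = p - 1) : pd j f γ = 0 := by
  rw [pd_apply]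
  refine Finset.sum_eq_zero fun α _ => ?_
  rw [shiftConst, Finset.prod_eq_zero (Finset.mem_univ j), Nat.cast_zero, zero_mul]
  have := (α j).isLt
  rw [if_neg]
  rw [eps, Pi.single_eq_same]
  omega

theorem coeff_sum {ι : Type*} (s : Finset ι) (f : ι → TruncDP K n p) (γ : Fin n → Fin p) :
    (∑ i ∈ s, f i) γ = ∑ i ∈ s, f i γ :=
  Finset.sum_apply γ s (fun i => (f i : (Fin n → Fin p) → K))

/-- For divergence-free fields the coefficients of the bracket are divergences of an antisymmetric
array; this form exposes which top coefficients must vanish. -/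
theorem lie_apply_var {E F : WittAlg K n p} (hE : Div E = 0) (hF : Div F = 0) (i : Fin n) :
    ⁅E, F⁆ (var i) = ∑ j, pd j (E (var j) * F (var i) - F (var j) * E (var i)) := by
  have h : ∀ j, pd j (E (var j) * F (var i) - F (var j) * E (var i)) =
      (E (var j) * pd j (F (var i)) - F (var j) * pd j (E (var i))) +
      (F (var i) * pd j (E (var j)) - E (var i) * pd j (F (var j))) := by
    intro j
    rw [map_sub, Derivation.leibniz, Derivation.leibniz]
    simp only [smul_eq_mul]
    ring
  rw [Derivation.commutator_apply, derivation_apply E, derivation_apply F (E _),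
    Finset.sum_congr rfl fun j _ => h j, Finset.sum_add_distrib, Finset.sum_sub_distrib,
    Finset.sum_sub_distrib, ← Finset.mul_sum, ← Finset.mul_sum, ← Div_apply, ← Div_apply, hE, hF,
    mul_zero, mul_zero, sub_zero, add_zero]

/-- The multi-indices other than the top one. -/
abbrev NonTop (n p : ℕ) : Type := {β : Fin n → Fin p // ∃ l, (β l : ℕ) + 1 < p}

variable (K n p) in
/-- The linear conditions cutting out the special algebra: the coefficients of the divergence and
the coefficients at `x^(τ-(p-1)ε_i) D_i`. -/
def specialCond : WittAlg K n p →ₗ[K] (NonTop n p → K) × (Fin n → K) where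
  toFun E := (fun β => Div E β.1, fun i => E (var i) (topExp i))
  map_add' E F := by rw [map_add]; rfl
  map_smul' c E := by rw [map_smul]; rfl

/-- For brackets of divergence-free fields, the coefficient at τ - (p-1)ε_i vanishes: the summand j
= i is zero by antisymmetry, and for j ≠ i nothing in the image of D_j has exponent p - 1 at j. -/
theorem specialCond_eq_zero_of_mem {E : WittAlg K n p} (hE : E ∈ Special K n p) :
    specialCond K n p E = 0 := by
  obtain ⟨F, hF, rfl⟩ := (LieSubalgebra.mem_map _ _ _).mp hE
  have hF' : F ∈ (⁅(⊤ : LieIdeal K (SpecialPrime K n p)), (⊤ : LieIdeal K (SpecialPrime K n p))⁆ :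
      LieIdeal K (SpecialPrime K n p)).toSubmodule := hF
  rw [LieSubmodule.lieIdeal_oper_eq_linear_span'] at hF'
  clear hF hE
  induction hF' using Submodule.span_induction with
  | zero => rw [map_zero, map_zero]
  | add a b _ _ ha hb => rw [map_add, map_add, ha, hb, add_zero]
  | smul c a _ ha => rw [map_smul, map_smul, ha, smul_zero]
  | mem x hx =>
    obtain ⟨⟨A, hA⟩, _, ⟨B, hB⟩, _, rfl⟩ := hx
    have hA' : Div A = 0 := hA
    have hB' : Div B = 0 := hB
    change specialCond K n p ⁅A, B⁆ = 0
    refine Prod.ext (funext fun β => ?_) (funext fun i => ?_)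
    · change Div ⁅A, B⁆ β.1 = 0
      rw [Div_lie, hA', hB', map_zero, map_zero, sub_zero]; rfl
    · change ⁅A, B⁆ (var i) (topExp i) = 0
      rw [lie_apply_var hA' hB', coeff_sum]
      refine Finset.sum_eq_zero fun j _ => ?_
      by_cases hji : j = i
      · rw [hji, mul_comm, sub_self, map_zero]; rfl
      · refine pd_apply_of_top j _ _ ?_
        rw [topExp, if_neg hji]

/-- Modulo the span of the generators, x^(β+ε_i) D_i thus depends on β alone. -/
theorem Dij_mono_add {i j : Fin n} {β : Fin n → ℕ} (hij : i ≠ j) (hβ : ∀ l, β l < p)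
    (hi : β i + 1 < p) (hj : β j + 1 < p) : (Dij i j (mono (β + eps i + eps j)) : WittAlg K n p) =
      (mono (β + eps i) : TruncDP K n p) • (pd i : WittAlg K n p) -
      (mono (β + eps j) : TruncDP K n p) • (pd j : WittAlg K n p) := by
  have h : ∀ l, β l + eps i l + eps j l < p := by
    intro l
    by_cases h1 : l = i
    · subst h1; simpa [eps, Pi.single_eq_of_ne hij] using hi
    · by_cases h2 : l = j
      · subst h2; simpa [eps, Pi.single_eq_of_ne hij.symm] using hj
      · simpa [eps, Pi.single_eq_of_ne h1, Pi.single_eq_of_ne h2] using hβ l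
  have e1 := pd_mono_add (K := K) j (β + eps i) h
  have e2 := pd_mono_add (K := K) i (β + eps j) fun l => by
    have := h l; simp only [Pi.add_apply]; omega
  rw [add_right_comm] at e2
  change pd j _ • (pd i : WittAlg K n p) - pd i _ • (pd j : WittAlg K n p) = _
  rw [e1, e2]

/-- A field x^(γ) D_i with γ_i = 0 therefore lies in the span, except when γ_j = p - 1 for all j ≠
i. -/
theorem Dij_mono_add_of_zero {i j : Fin n} {γ : Fin n → ℕ} (hij : i ≠ j) (hγ : ∀ l, γ l < p)
    (hi : γ i = 0) (hj : γ j + 1 < p) : (Dij i j (mono (γ + eps j)) : WittAlg K n p) =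
      (mono γ : TruncDP K n p) • (pd i : WittAlg K n p) := by
  have h : ∀ l, γ l + eps j l < p := by
    intro l
    by_cases h2 : l = j
    · subst h2; simpa [eps] using hj
    · simpa [eps, Pi.single_eq_of_ne h2] using hγ l
  have e1 := pd_mono_add (K := K) j γ h
  have e2 := pd_mono_zero (K := K) (p := p) i (γ + eps j) (by
    simp [hi, eps, Pi.single_eq_of_ne hij])
  change pd j _ • (pd i : WittAlg K n p) - pd i _ • (pd j : WittAlg K n p) = _
  rw [e1, e2, zero_smul, sub_zero]

theorem eq_sum_smul_pd (E : WittAlg K n p) :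
    E = ∑ i, E (var i) • (pd i : WittAlg K n p) := by
  refine Derivation.ext fun f => ?_
  rw [sum_derivation_apply, derivation_apply]
  rfl

/-- Modulo the span, a field equals its divergence with x^(β) replaced by the common class of the
x^(β+ε_i) D_i, plus its coefficients at the exceptional fields x^(τ-(p-1)ε_i) D_i. The conditions
kill both contributions. -/
theorem mem_span_genSet_of_specialCond {E : WittAlg K n p} (hE : specialCond K n p E = 0) :
    E ∈ Submodule.span K (genSet K n p) := by
  classical
  set N := Submodule.span K (genSet K n p) with hN
  -- The top multi-index is assigned class 0, since no x^(β+ε_i) exists there.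
  set v₀ : (Fin n → Fin p) → WittAlg K n p ⧸ N := fun β =>
    if h : ∃ i, (β i : ℕ) + 1 < p then
      N.mkQ ((mono ((fun l => (β l : ℕ)) + eps h.choose) : TruncDP K n p) •
        (pd h.choose : WittAlg K n p)) else 0 with hv₀
  have hv : ∀ (β : Fin n → Fin p) (i : Fin n), (β i : ℕ) + 1 < p →
      N.mkQ ((mono ((fun l => (β l : ℕ)) + eps i) : TruncDP K n p) • (pd i : WittAlg K n p)) =
        v₀ β := by
    intro β i hi
    have h : ∃ i, (β i : ℕ) + 1 < p := ⟨i, hi⟩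
    simp only [hv₀]
    rw [dif_pos h]
    by_cases hij : i = h.choose
    · rw [← hij]
    · rw [← sub_eq_zero, ← map_sub, ← Dij_mono_add hij (fun l => (β l).isLt) hi h.choose_spec,
        Submodule.mkQ_apply, Submodule.Quotient.mk_eq_zero]
      exact Dij_mem_span_genSet _ _ _
  let v : TruncDP K n p →ₗ[K] WittAlg K n p ⧸ N :=
    { toFun := fun f => ∑ β, f β • v₀ β
      map_add' := fun f g => by
        rw [← Finset.sum_add_distrib]
        exact Finset.sum_congr rfl fun β _ => add_smul _ _ _
      map_smul' := fun c f => by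
        rw [Finset.smul_sum]
        exact Finset.sum_congr rfl fun β _ => mul_smul _ _ _ }
  have hvm : ∀ β : Fin n → Fin p, v (mono fun l => (β l : ℕ)) = v₀ β := by
    intro β
    change ∑ γ, (mono (fun l => (β l : ℕ)) : TruncDP K n p) γ • v₀ γ = _
    rw [Finset.sum_eq_single β]
    · rw [mono_val_apply, if_pos rfl, one_smul]
    · intro γ _ hγ
      rw [mono_val_apply, if_neg hγ, zero_smul]
    · simp
  -- Tested on monomials x^(γ): if γ_i > 0 the divergence term gives the class; if γ_i = 0 the class
  -- is zero or exceptional.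
  have key : ∀ (i : Fin n) (f : TruncDP K n p), N.mkQ (f • (pd i : WittAlg K n p)) =
      v (pd i f) + f (topExp i) • N.mkQ ((mono fun l => (topExp (p := p) i l : ℕ) : TruncDP K n p) •
        (pd i : WittAlg K n p)) := by
    intro i
    let F : TruncDP K n p →ₗ[K] WittAlg K n p ⧸ N := N.mkQ ∘ₗ
      { toFun := fun f => f • (pd i : WittAlg K n p)
        map_add' := fun f g => add_smul _ _ _
        map_smul' := fun c f => smul_assoc _ _ _ }
    let G : TruncDP K n p →ₗ[K] WittAlg K n p ⧸ N :=
      { toFun := fun f => v (pd i f) + f (topExp i) •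
          N.mkQ ((mono fun l => (topExp (p := p) i l : ℕ) : TruncDP K n p) • (pd i : WittAlg K n p))
        map_add' := fun f g => by
          rw [map_add, map_add, TruncDP.add_apply, add_smul]; abel
        map_smul' := fun c f => by
          rw [Derivation.map_smul, map_smul, TruncDP.smul_apply, mul_smul, RingHom.id_apply,
            smul_add] }
    have hFG : F = G := by
      refine linearMap_ext_mono fun γ => ?_
      change N.mkQ ((mono fun l => (γ l : ℕ) : TruncDP K n p) • (pd i : WittAlg K n p)) =
        v (pd i (mono fun l => (γ l : ℕ))) + (mono fun l => (γ l : ℕ) : TruncDP K n p) (topExp i) •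
          N.mkQ ((mono fun l => (topExp (p := p) i l : ℕ) : TruncDP K n p) • (pd i : WittAlg K n p))
      rw [mono_val_apply]
      by_cases h0 : (γ i : ℕ) = 0
      · rw [pd_mono_zero i _ h0, map_zero, zero_add]
        by_cases htop : topExp i = γ
        · rw [if_pos htop, one_smul, htop]
        · rw [if_neg htop, zero_smul]
          obtain ⟨j, hj⟩ := Function.ne_iff.mp htop
          have hij : i ≠ j := by
            rintro rfl
            exact hj (Fin.ext (by rw [topExp, if_pos rfl, h0]))
          have hj' : (γ j : ℕ) + 1 < p := by
            have h1 := (γ j).isLt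
            by_contra h2
            refine hj (Fin.ext ?_)
            rw [topExp, if_neg hij.symm]
            simp only
            omega
          rw [← Dij_mono_add_of_zero hij (fun l => (γ l).isLt) h0 hj', Submodule.mkQ_apply,
            Submodule.Quotient.mk_eq_zero]
          exact Dij_mem_span_genSet _ _ _
      · have htop : topExp i ≠ γ := by
          intro h
          apply h0
          rw [← h, topExp, if_pos rfl]
        obtain ⟨β, hβ, hβi⟩ := exists_sub_eps (fun l => (γ l : ℕ)) i h0
        have hle : ∀ l, β l + eps i l < p := fun l => by
          have := congrFun hβ l
          simp only [Pi.add_apply] at this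
          rw [← this]; exact (γ l).isLt
        rw [if_neg htop, zero_smul, add_zero, hβ, pd_mono_add i β hle]
        obtain ⟨b, rfl⟩ : ∃ b : Fin n → Fin p, β = fun l => (b l : ℕ) :=
          ⟨fun l => ⟨β l, (Nat.le_add_right _ _).trans_lt (hle l)⟩, rfl⟩
        rw [hvm, hv]
        have := hle i
        rwa [eps, Pi.single_eq_same] at this
    intro f
    exact congrArg (fun l => l f) hFG
  rw [← Submodule.Quotient.mk_eq_zero, ← Submodule.mkQ_apply, eq_sum_smul_pd E, map_sum,
    Finset.sum_congr rfl fun i _ => key i _, Finset.sum_add_distrib, ← map_sum]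
  have h1 : ∀ i, E (var i) (topExp i) = 0 := fun i => congrFun (congrArg Prod.snd hE) i
  have h2 : v (Div E) = 0 := by
    change ∑ β, Div E β • v₀ β = 0
    refine Finset.sum_eq_zero fun β _ => ?_
    by_cases h : ∃ i, (β i : ℕ) + 1 < p
    · have : Div E β = 0 := congrFun (congrArg Prod.fst hE) ⟨β, h⟩
      rw [this, zero_smul]
    · simp only [hv₀]
      rw [dif_neg h, smul_zero]
  rw [← Div_apply, h2, zero_add]
  exact Finset.sum_eq_zero fun i _ => by rw [h1, zero_smul]

/-- The inclusions form a cycle: special algebra, kernel of the conditions, span of the generators,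
special algebra. -/
theorem Special_toSubmodule (hn : 3 ≤ n) :
    (Special K n p).toSubmodule = Submodule.span K (genSet K n p) ∧
    (Special K n p).toSubmodule = LinearMap.ker (specialCond K n p) := by
  have h1 : (Special K n p).toSubmodule ≤ LinearMap.ker (specialCond K n p) :=
    fun E hE => specialCond_eq_zero_of_mem hE
  have h2 : LinearMap.ker (specialCond K n p) ≤ Submodule.span K (genSet K n p) :=
    fun E hE => mem_span_genSet_of_specialCond hE
  have h3 : Submodule.span K (genSet K n p) ≤ (Special K n p).toSubmodule := by
    refine Submodule.span_le.mpr ?_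
    rintro _ ⟨i, j, -, α, -, rfl⟩
    exact Dij_mem hn i j _
  exact ⟨le_antisymm (h1.trans h2) h3, le_antisymm h1 (h2.trans h3)⟩

theorem specialCond_smul_pd (f : TruncDP K n p) (i : Fin n) :
    specialCond K n p (f • (pd i : WittAlg K n p)) =
      (fun β => pd i f β.1, Pi.single i (f (topExp i))) := by
  have h : ∀ l, (f • (pd i : WittAlg K n p)) (var l) = if l = i then f else 0 := by
    intro l
    change f * pd i (var l) = _
    rw [pd_var]; split_ifs <;> simp
  refine Prod.ext (funext fun β => ?_) (funext fun l => ?_)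
  · change Div (f • (pd i : WittAlg K n p)) β.1 = pd i f β.1
    rw [Div_apply]
    simp only [h]
    rw [Finset.sum_eq_single i]
    · rw [if_pos rfl]
    · intro l _ hl; rw [if_neg hl, map_zero]
    · simp
  · change (f • (pd i : WittAlg K n p)) (var l) (topExp l) =
      (Pi.single i (f (topExp i)) : Fin n → K) l
    rw [h]
    by_cases hl : l = i
    · subst hl; rw [if_pos rfl, Pi.single_eq_same]
    · rw [if_neg hl, Pi.single_eq_of_ne hl]; rfl

/-- The field x^(β+ε_i) D_i has divergence x^(β) and no exceptional coefficient, its exponent at i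
being positive; the field x^(τ-(p-1)ε_i) D_i has divergence zero. -/
theorem range_specialCond : LinearMap.range (specialCond K n p) = ⊤ := by
  classical
  have h1 : ∀ β : NonTop n p, (Pi.single β 1, 0) ∈ LinearMap.range (specialCond K n p) := by
    rintro ⟨β, i, hi⟩
    refine ⟨(mono ((fun l => (β l : ℕ)) + eps i) : TruncDP K n p) • (pd i : WittAlg K n p), ?_⟩
    rw [specialCond_smul_pd, pd_mono_add]
    · refine Prod.ext (funext fun γ => ?_) (funext fun l => ?_)
      · simp only [mono_val_apply, Pi.single_apply, Subtype.ext_iff]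
      · have : (mono ((fun l => (β l : ℕ)) + eps i) : TruncDP K n p) (topExp i) = 0 := by
          rw [mono_apply, if_neg]
          intro h
          have := h i
          rw [topExp, if_pos rfl] at this
          simp [eps] at this
        simp only [this, Pi.single_zero]
    · intro l
      by_cases hl : l = i
      · subst hl; simpa [eps] using hi
      · simp [eps, Pi.single_eq_of_ne hl]
  have h2 : ∀ i : Fin n, (0, Pi.single i 1) ∈ LinearMap.range (specialCond K n p) := by
    intro i
    refine ⟨(mono (fun l => (topExp (p := p) i l : ℕ)) : TruncDP K n p) • (pd i : WittAlg K n p), ?_⟩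
    rw [specialCond_smul_pd, pd_mono_zero, mono_val_apply, if_pos rfl]
    · rfl
    · rw [topExp, if_pos rfl]
  rw [eq_top_iff]
  rintro ⟨a, b⟩ -
  have e : ((a, b) : (NonTop n p → K) × (Fin n → K)) =
      ∑ β, a β • ((Pi.single β 1, 0) : (NonTop n p → K) × (Fin n → K)) +
      ∑ i, b i • ((0, Pi.single i 1) : (NonTop n p → K) × (Fin n → K)) := by
    refine Prod.ext (funext fun β => ?_) (funext fun i => ?_)
    · simp [Prod.fst_sum, Finset.sum_apply, Pi.single_apply]
    · simp [Prod.snd_sum, Finset.sum_apply, Pi.single_apply]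
  rw [e]
  exact add_mem (sum_mem fun β _ => Submodule.smul_mem _ _ (h1 β))
    (sum_mem fun i _ => Submodule.smul_mem _ _ (h2 i))

variable (K n p) in
/-- A derivation is determined by its values on the variables, which are arbitrary. -/
def wittEquiv : WittAlg K n p ≃ₗ[K] (Fin n → TruncDP K n p) where
  toFun E := fun i => E (var i)
  map_add' _ _ := rfl
  map_smul' _ _ := rfl
  invFun f := ∑ i, f i • (pd i : WittAlg K n p)
  left_inv E := (eq_sum_smul_pd E).symm
  right_inv f := by
    funext l
    change (∑ i, f i • (pd i : WittAlg K n p)) (var l) = f l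
    rw [sum_derivation_apply, Finset.sum_eq_single l]
    · change f l * pd l (var l) = _
      rw [pd_var, if_pos rfl, mul_one]
    · intro i _ hi
      change f i * pd i (var l) = 0
      rw [pd_var, if_neg hi.symm, mul_zero]
    · simp

instance : Module.Finite K (TruncDP K n p) :=
  inferInstanceAs (Module.Finite K ((Fin n → Fin p) → K))

instance : Module.Finite K (WittAlg K n p) :=
  Module.Finite.equiv (wittEquiv K n p).symm

theorem finrank_WittAlg : Module.finrank K (WittAlg K n p) = n * p ^ n := by
  have h : Module.finrank K (TruncDP K n p) = p ^ n := by
    have : Module.finrank K ((Fin n → Fin p) → K) = p ^ n := by simp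
    exact this
  rw [(wittEquiv K n p).finrank_eq, Module.finrank_pi_fintype]
  simp [h]

theorem card_NonTop : Fintype.card (NonTop n p) + 1 = p ^ n := by
  classical
  have hp := (Fact.out : p.Prime).pos
  have h1 := Fintype.card_subtype_compl (fun β : Fin n → Fin p => β = fun _ => ⟨p - 1, by omega⟩)
  rw [Fintype.card_subtype_eq] at h1
  have h2 : Fintype.card (NonTop n p) =
      Fintype.card {β : Fin n → Fin p // ¬ β = fun _ => ⟨p - 1, by omega⟩} := by
    refine Fintype.card_congr (Equiv.subtypeEquivRight fun β => ?_)
    rw [← ne_eq, Function.ne_iff]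
    refine exists_congr fun l => ?_
    rw [ne_eq, Fin.ext_iff]
    have := (β l).isLt
    simp only
    omega
  have h3 : Fintype.card (Fin n → Fin p) = p ^ n := by simp
  have h4 : 0 < p ^ n := Nat.pow_pos hp
  omega

/-- Rank-nullity: n p^n - (p^n - 1) - n. -/
theorem finrank_Special (hn : 3 ≤ n) :
    Module.finrank K (Special K n p) = (n - 1) * (p ^ n - 1) := by
  have h1 := LinearMap.finrank_range_add_finrank_ker (specialCond K n p)
  rw [range_specialCond, finrank_top, ← (Special_toSubmodule hn).2, finrank_WittAlg,
    Module.finrank_prod, Module.finrank_fintype_fun_eq_card, Module.finrank_fintype_fun_eq_card,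
    Fintype.card_fin] at h1
  change _ + Module.finrank K (Special K n p) = _ at h1
  rw [← card_NonTop (n := n) (p := p)] at h1 ⊢
  obtain ⟨t, rfl⟩ : ∃ t, n = t + 1 := ⟨n - 1, by omega⟩
  rw [Nat.add_sub_cancel, Nat.add_sub_cancel]
  generalize Fintype.card (NonTop (t + 1) p) = M at *
  have : (t + 1) * (M + 1) = M + (t + 1) + t * M := by ring
  omega

end SpecialDimension

/-! ### A PBW theorem for algebras generated by primitive elements -/

section RestrictedPBW

variable {K U : Type*} [Field K] [Ring U] [Algebra K U] {d : ℕ} (b : Fin d → U)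

/-- The product of the generators along a list of indices. -/
def word (l : List (Fin d)) : U := (l.map b).prod

variable (K) in
/-- The span of the words of length at most `k`. -/
def wordFil (k : ℕ) : Submodule K U := Submodule.span K {x | ∃ l : List (Fin d), l.length ≤ k ∧ word b l = x}

variable {b}

theorem word_mem_wordFil {l : List (Fin d)} {k : ℕ} (h : l.length ≤ k) :
    word b l ∈ wordFil K b k := Submodule.subset_span ⟨l, h, rfl⟩

theorem wordFil_mono {k k' : ℕ} (h : k ≤ k') : wordFil K b k ≤ wordFil K b k' :=
  Submodule.span_mono fun _ ⟨l, hl, hx⟩ => ⟨l, hl.trans h, hx⟩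

theorem mul_mem_wordFil (i : Fin d) {k : ℕ} {x : U} (hx : x ∈ wordFil K b k) :
    b i * x ∈ wordFil K b (k + 1) := by
  induction hx using Submodule.span_induction with
  | zero => rw [mul_zero]; exact zero_mem _
  | add x y _ _ hx hy => rw [mul_add]; exact add_mem hx hy
  | smul c x _ hx => rw [mul_smul_comm]; exact Submodule.smul_mem _ _ hx
  | mem x hx =>
    obtain ⟨l, hl, rfl⟩ := hx
    have : b i * word b l = word b (i :: l) := by simp [word]
    rw [this]
    exact word_mem_wordFil (by simpa using hl)

theorem mul_word_mem_wordFil {v : U} (hv : v ∈ Submodule.span K (Set.range b))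
    (l : List (Fin d)) : v * word b l ∈ wordFil K b (l.length + 1) := by
  induction hv using Submodule.span_induction with
  | zero => rw [zero_mul]; exact zero_mem _
  | add x y _ _ hx hy => rw [add_mul]; exact add_mem hx hy
  | smul c x _ hx => rw [smul_mul_assoc]; exact Submodule.smul_mem _ _ hx
  | mem x hx =>
    obtain ⟨i, rfl⟩ := hx
    exact mul_mem_wordFil i (word_mem_wordFil le_rfl)

/-- Swapping two neighbouring letters changes a word by a commutator, which is linear in the
generators and so one letter shorter. -/
theorem word_sub_word_mem (hlie : ∀ i j, b i * b j - b j * b i ∈ Submodule.span K (Set.range b))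
    {l l' : List (Fin d)} (h : l.Perm l') : ∀ k, l.length ≤ k + 1 →
      word b l - word b l' ∈ wordFil K b k := by
  induction h with
  | nil => intro k _; rw [sub_self]; exact zero_mem _
  | @cons i l l' h ih =>
    intro k hk
    have e : word b (i :: l) - word b (i :: l') = b i * (word b l - word b l') := by
      simp [word, mul_sub]
    rw [e]
    -- For k = 0 the common letter is the whole word, so the difference is zero.
    rcases k with _ | k
    · have hl : l = [] := by simpa using hk
      subst hl
      rw [List.nil_perm.mp h, sub_self, mul_zero]
      exact zero_mem _
    · exact mul_mem_wordFil i (ih k (by simpa using hk))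
  | swap i j l =>
    intro k hk
    have e : word b (j :: i :: l) - word b (i :: j :: l) = (b j * b i - b i * b j) * word b l := by
      simp [word, sub_mul, mul_assoc]
    rw [e]
    exact wordFil_mono (by simpa using hk) (mul_word_mem_wordFil (hlie j i) l)
  | trans h₁ _ ih₁ ih₂ =>
    intro k hk
    rw [← sub_add_sub_cancel]
    exact add_mem (ih₁ k hk) (ih₂ k (h₁.length_eq ▸ hk))

variable (K b) in
/-- The ordered products of divided powers. -/
def divMono (m : Fin d → ℕ) : U :=
  (List.ofFn fun i => ((m i).factorial : K)⁻¹ • b i ^ m i).prod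

theorem prod_ofFn_smul {N : ℕ} (c : Fin N → K) (x : Fin N → U) :
    (List.ofFn fun i => c i • x i).prod = (∏ i, c i) • (List.ofFn x).prod := by
  induction N with
  | zero => simp
  | succ N ih =>
    rw [List.ofFn_succ, List.prod_cons, ih, List.ofFn_succ, List.prod_cons, Fin.prod_univ_succ,
      smul_mul_smul_comm]

theorem divMono_eq_smul (m : Fin d → ℕ) :
    divMono K b m = (∏ i, ((m i).factorial : K)⁻¹) • (List.ofFn fun i => b i ^ m i).prod :=
  prod_ofFn_smul _ _

theorem word_flatMap (m : Fin d → ℕ) :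
    word b ((List.finRange d).flatMap fun i => List.replicate (m i) i) =
      (List.ofFn fun i => b i ^ m i).prod := by
  rw [word, List.map_flatMap, List.flatMap_def, List.prod_flatten, List.map_map, List.ofFn_eq_map]
  simp [Function.comp_def]

theorem perm_flatMap (l : List (Fin d)) :
    l.Perm ((List.finRange d).flatMap fun i => List.replicate (l.count i) i) := by
  rw [List.perm_iff_count]
  intro a
  rw [List.count_flatMap]
  have : (List.map (List.count a ∘ fun i => List.replicate (l.count i) i) (List.finRange d)) =
      List.ofFn fun i => if i = a then l.count i else 0 := by
    rw [List.ofFn_eq_map]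
    refine List.map_congr_left fun i _ => ?_
    simp [List.count_replicate]
  rw [this, List.sum_ofFn]
  simp

variable {p : ℕ} [Fact p.Prime] [CharP K p]

theorem factorial_ne_zero_of_lt {k : ℕ} (hk : k < p) : (k.factorial : K) ≠ 0 := by
  rw [Ne, CharP.cast_eq_zero_iff K p, (Fact.out : p.Prime).dvd_factorial]
  omega

/-- Induction on length, modulo shorter words: a letter occurring at least p times has p copies
gathered in front, where b_i^p becomes linear; otherwise the word is sorted. Factorials below p are
invertible, so divided and ordinary powers have the same span. -/
theorem wordFil_le_span_divMono
    (hlie : ∀ i j, b i * b j - b j * b i ∈ Submodule.span K (Set.range b))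
    (hpow : ∀ i, b i ^ p ∈ Submodule.span K (Set.range b)) (k : ℕ) :
    wordFil K b k ≤ Submodule.span K
      (Set.range fun m : Fin d → Fin p => divMono K b fun i => (m i : ℕ)) := by
  have hmono : ∀ m : Fin d → ℕ, (∀ i, m i < p) → (List.ofFn fun i => b i ^ m i).prod ∈
      Submodule.span K (Set.range fun m : Fin d → Fin p => divMono K b fun i => (m i : ℕ)) := by
    intro m hm
    have h1 : divMono K b m ∈ Submodule.span K
        (Set.range fun m : Fin d → Fin p => divMono K b fun i => (m i : ℕ)) :=
      Submodule.subset_span ⟨fun i => ⟨m i, hm i⟩, rfl⟩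
    rw [divMono_eq_smul] at h1
    refine (Submodule.smul_mem_iff _ (Finset.prod_ne_zero_iff.mpr fun i _ => ?_)).mp h1
    exact inv_ne_zero (factorial_ne_zero_of_lt (hm i))
  induction k with
  | zero =>
    refine Submodule.span_le.mpr ?_
    rintro _ ⟨l, hl, rfl⟩
    have hl' : l = [] := by simpa using hl
    have := hmono (fun _ => 0) fun _ => (Fact.out : p.Prime).pos
    subst hl'
    simpa [word, List.ofFn_const] using this
  | succ k ih =>
    refine Submodule.span_le.mpr ?_
    rintro _ ⟨l, hl, rfl⟩
    by_cases h : ∃ i, p ≤ l.count i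
    · obtain ⟨i, hi⟩ := h
      obtain ⟨l', hl'⟩ := (List.replicate_sublist_iff.mpr hi).exists_perm_append
      have h1 := word_sub_word_mem hlie hl' k hl
      have h2 : word b (List.replicate p i ++ l') = b i ^ p * word b l' := by simp [word]
      have h3 := mul_word_mem_wordFil (hpow i) l'
      have h4 : l.length = p + l'.length := by rw [hl'.length_eq]; simp
      have h5 := (Fact.out : p.Prime).two_le
      rw [← h2] at h3
      have h6 := add_mem (ih h1) (ih (wordFil_mono (by omega) h3))
      rwa [sub_add_cancel] at h6
    · push Not at h
      have h1 := word_sub_word_mem hlie (perm_flatMap l) k hl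
      rw [word_flatMap] at h1
      have h6 := add_mem (ih h1) (hmono _ h)
      rwa [sub_add_cancel] at h6

/-- The restricted ordered monomials span. -/
theorem span_divMono_eq_top (hgen : Algebra.adjoin K (Set.range b) = ⊤)
    (hlie : ∀ i j, b i * b j - b j * b i ∈ Submodule.span K (Set.range b))
    (hpow : ∀ i, b i ^ p ∈ Submodule.span K (Set.range b)) :
    Submodule.span K (Set.range fun m : Fin d → Fin p => divMono K b fun i => (m i : ℕ)) = ⊤ := by
  have h1 := congrArg Subalgebra.toSubmodule hgen
  rw [Algebra.adjoin_eq_span, Algebra.top_toSubmodule] at h1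
  rw [eq_top_iff, ← h1, Submodule.span_le]
  intro x hx
  have h2 : ∃ l : List (Fin d), word b l = x := by
    induction hx using Submonoid.closure_induction with
    | mem x hx =>
      obtain ⟨i, rfl⟩ := hx
      exact ⟨[i], by simp [word]⟩
    | one => exact ⟨[], rfl⟩
    | mul x y _ _ hx hy =>
      obtain ⟨l, rfl⟩ := hx
      obtain ⟨l', rfl⟩ := hy
      exact ⟨l ++ l', by simp [word]⟩
  obtain ⟨l, rfl⟩ := h2
  exact wordFil_le_span_divMono hlie hpow l.length (word_mem_wordFil le_rfl)

theorem prod_ofFn_sum {ι : Type*} [DecidableEq ι] {B : Type*} [Ring B] {N : ℕ}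
    (s : Fin N → Finset ι) (f : Fin N → ι → B) :
    (List.ofFn fun i => ∑ x ∈ s i, f i x).prod =
      ∑ x ∈ Fintype.piFinset s, (List.ofFn fun i => f i (x i)).prod := by
  induction N with
  | zero => simp
  | succ N ih =>
    rw [List.ofFn_succ, List.prod_cons, ih, Finset.sum_mul_sum, ← Finset.sum_product']
    refine Finset.sum_bij' (fun x _ => Fin.cons x.1 x.2) (fun x _ => (x 0, Fin.tail x)) ?_ ?_ ?_ ?_ ?_
    · intro x hx
      rw [Finset.mem_product, Fintype.mem_piFinset] at hx
      rw [Fintype.mem_piFinset]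
      intro i
      refine Fin.cases ?_ (fun i => ?_) i
      · exact hx.1
      · exact hx.2 i
    · intro x hx
      rw [Fintype.mem_piFinset] at hx
      rw [Finset.mem_product, Fintype.mem_piFinset]
      exact ⟨hx 0, fun i => hx i.succ⟩
    · intro x _; rfl
    · intro x _; exact Fin.cons_self_tail x
    · intro x _
      rw [List.ofFn_succ, List.prod_cons]
      rfl

theorem prod_ofFn_tmul {N : ℕ} (x y : Fin N → U) :
    (List.ofFn fun i => x i ⊗ₜ[K] y i).prod = (List.ofFn x).prod ⊗ₜ (List.ofFn y).prod := by
  induction N with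
  | zero => rfl
  | succ N ih =>
    rw [List.ofFn_succ, List.prod_cons, ih, List.ofFn_succ, List.prod_cons, List.ofFn_succ,
      List.prod_cons, Algebra.TensorProduct.tmul_mul_tmul]

/-- The divided powers absorb the binomial coefficients, so that all coefficients are 1. -/
theorem comul_divPow {Δ : U →ₐ[K] U ⊗[K] U} {x : U} (hx : Δ x = x ⊗ₜ 1 + 1 ⊗ₜ x) {k : ℕ}
    (hk : k < p) : Δ ((k.factorial : K)⁻¹ • x ^ k) = ∑ a ∈ Finset.HasAntidiagonal.antidiagonal k,
      ((a.1.factorial : K)⁻¹ • x ^ a.1) ⊗ₜ ((a.2.factorial : K)⁻¹ • x ^ a.2) := by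
  have hc : Commute (x ⊗ₜ[K] (1 : U)) ((1 : U) ⊗ₜ x) := by
    simp [Commute, SemiconjBy]
  rw [map_smul, map_pow, hx, hc.add_pow', Finset.smul_sum]
  refine Finset.sum_congr rfl fun a ha => ?_
  rw [Finset.HasAntidiagonal.mem_antidiagonal] at ha
  subst ha
  have h1 := factorial_ne_zero_of_lt (K := K) (p := p) (lt_of_le_of_lt (Nat.le_add_right _ _) hk)
  have h2 := factorial_ne_zero_of_lt (K := K) (p := p) (lt_of_le_of_lt (Nat.le_add_left _ _) hk)
  have h3 := factorial_ne_zero_of_lt (K := K) (p := p) hk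
  have h4 : (((a.1 + a.2).choose a.1 : ℕ) : K) * (a.1.factorial : K) * (a.2.factorial : K) =
      ((a.1 + a.2).factorial : K) := by
    have h5 := Nat.choose_mul_factorial_mul_factorial (Nat.le_add_right a.1 a.2)
    rw [Nat.add_sub_cancel_left] at h5
    rw [← Nat.cast_mul, ← Nat.cast_mul, h5]
  have h6 : (((a.1 + a.2).choose a.1 : ℕ) : K) ≠ 0 :=
    left_ne_zero_of_mul (left_ne_zero_of_mul (h4 ▸ h3))
  rw [Algebra.TensorProduct.tmul_pow, Algebra.TensorProduct.tmul_pow, one_pow, one_pow,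
    Algebra.TensorProduct.tmul_mul_tmul, one_mul, mul_one, TensorProduct.smul_tmul_smul,
    ← Nat.cast_smul_eq_nsmul K, smul_smul]
  congr 1
  rw [← h4]
  field_simp

theorem comul_divMono {Δ : U →ₐ[K] U ⊗[K] U} (hΔ : ∀ i, Δ (b i) = b i ⊗ₜ 1 + 1 ⊗ₜ b i)
    {m : Fin d → ℕ} (hm : ∀ i, m i < p) : Δ (divMono K b m) =
      ∑ x ∈ Fintype.piFinset fun i => Finset.HasAntidiagonal.antidiagonal (m i),
        divMono K b (fun i => (x i).1) ⊗ₜ divMono K b (fun i => (x i).2) := by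
  rw [divMono, map_list_prod, List.map_ofFn]
  have : (⇑Δ ∘ fun i => ((m i).factorial : K)⁻¹ • b i ^ m i) = fun i =>
      ∑ a ∈ Finset.HasAntidiagonal.antidiagonal (m i), (((a.1.factorial : K)⁻¹ • b i ^ a.1) ⊗ₜ[K]
        ((a.2.factorial : K)⁻¹ • b i ^ a.2)) :=
    funext fun i => comul_divPow (hΔ i) (hm i)
  rw [this, prod_ofFn_sum]
  exact Finset.sum_congr rfl fun x _ => prod_ofFn_tmul _ _

theorem exists_dual_of_linearIndependent {ι V : Type*} [AddCommGroup V] [Module K V]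
    {v : ι → V} (hv : LinearIndependent K v) (i : ι) [DecidableEq ι] :
    ∃ f : V →ₗ[K] K, ∀ j, f (v j) = if j = i then 1 else 0 := by
  obtain ⟨f, hf⟩ := ((Finsupp.lapply i : (ι →₀ K) →ₗ[K] K) ∘ₗ
    (hv.repr : Submodule.span K (Set.range v) →ₗ[K] (ι →₀ K))).exists_extend
  refine ⟨f, fun j => ?_⟩
  have h1 := LinearMap.congr_fun hf ⟨v j, Submodule.subset_span ⟨j, rfl⟩⟩
  rw [LinearMap.comp_apply, Submodule.subtype_apply] at h1
  rw [h1, LinearMap.comp_apply]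
  simp [hv.repr_eq_single j ⟨v j, Submodule.subset_span ⟨j, rfl⟩⟩ rfl, Finsupp.single_apply]

/-- The degree of a restricted exponent. -/
def expDeg (m : Fin d → Fin p) : ℕ := ∑ i, (m i : ℕ)

theorem divMono_zero : divMono K b 0 = 1 := by
  rw [divMono_eq_smul]
  simp [List.ofFn_const]

theorem prod_ofFn_single {N : ℕ} (i : Fin N) (x : Fin N → U) (h : ∀ j, j ≠ i → x j = 1) :
    (List.ofFn x).prod = x i := by
  induction N with
  | zero => exact i.elim0
  | succ N ih =>
    rw [List.ofFn_succ, List.prod_cons]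
    induction i using Fin.cases with
    | zero =>
      have : (fun j : Fin N => x j.succ) = fun _ => 1 := funext fun j => h _ (Fin.succ_ne_zero j)
      rw [this]
      simp [List.ofFn_const]
    | succ i =>
      rw [h 0 (Fin.succ_ne_zero i).symm, one_mul,
        ih i (fun j => x j.succ) fun j hj => h _ fun h' => hj (Fin.succ_injective _ h')]

theorem divMono_single (i : Fin d) : divMono K b (Pi.single i 1) = b i := by
  rw [divMono, prod_ofFn_single i]
  · simp
  · intro j hj
    simp [Pi.single_eq_of_ne hj]

/-- In degree at most one the only monomials are 1 and the b_i; the counit separates 1 from the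
rest. -/
theorem linearIndependent_divMono_one {ε : U →ₐ[K] K} (hε : ∀ i, ε (b i) = 0)
    (hb : LinearIndependent K b) (c : (Fin d → Fin p) → K) (hc : ∀ m, 1 < expDeg m → c m = 0)
    (hsum : ∑ m, c m • divMono K b (fun i => (m i : ℕ)) = 0) : ∀ m, c m = 0 := by
  have hp := (Fact.out : p.Prime).two_le
  have hp0 : 0 < p := by omega
  let z : Fin d → Fin p := fun _ => ⟨0, hp0⟩
  let e : Fin d → Fin d → Fin p := fun i j => if j = i then ⟨1, by omega⟩ else ⟨0, hp0⟩
  have hz : (fun i => (z i : ℕ)) = 0 := rfl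
  have he : ∀ i, (fun j => (e i j : ℕ)) = Pi.single i 1 := by
    intro i
    funext j
    by_cases h : j = i
    · subst h; simp [e]
    · simp [e, h]
  have hne : ∀ i, e i ≠ z := by
    intro i h
    have := congrArg (fun m : Fin d → Fin p => (m i : ℕ)) h
    simp [e, z] at this
  have hinj : Function.Injective e := by
    intro i j h
    by_contra hij
    have := congrArg (fun m : Fin d → Fin p => (m i : ℕ)) h
    simp [e, hij] at this
  have hcase : ∀ m, m = z ∨ (∃ i, m = e i) ∨ 1 < expDeg m := by
    intro m
    by_cases h0 : ∃ i, (m i : ℕ) ≠ 0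
    · obtain ⟨i, hi⟩ := h0
      right
      by_cases h1 : 1 < expDeg m
      · right; exact h1
      · left
        refine ⟨i, funext fun j => Fin.ext ?_⟩
        have h2 : expDeg m = (m i : ℕ) + ∑ j ∈ Finset.univ.erase i, (m j : ℕ) :=
          (Finset.add_sum_erase _ _ (Finset.mem_univ i)).symm
        by_cases hj : j = i
        · subst hj; simp [e]; omega
        · have h3 : (m j : ℕ) ≤ ∑ j ∈ Finset.univ.erase i, (m j : ℕ) :=
            Finset.single_le_sum (f := fun j => (m j : ℕ)) (fun _ _ => Nat.zero_le _)
              (Finset.mem_erase.mpr ⟨hj, Finset.mem_univ j⟩)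
          have h4 := congrFun (he i) j
          simp only [Pi.single_eq_of_ne hj] at h4
          omega
    · push Not at h0
      left
      exact funext fun i => Fin.ext (h0 i)
  classical
  have hsplit : ∑ m, c m • divMono K b (fun i => (m i : ℕ)) = c z • (1 : U) + ∑ i, c (e i) • b i := by
    have h1 : ∑ m ∈ insert z (Finset.univ.image e), c m • divMono K b (fun i => (m i : ℕ)) =
        ∑ m, c m • divMono K b (fun i => (m i : ℕ)) := by
      refine Finset.sum_subset (Finset.subset_univ _) fun m _ hm => ?_
      rcases hcase m with h | ⟨i, h⟩ | h
      · exact absurd (by simp [h]) hm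
      · exact absurd (by simp [h]) hm
      · rw [hc m h, zero_smul]
    rw [← h1, Finset.sum_insert (by simp [hne]), Finset.sum_image hinj.injOn, hz, divMono_zero]
    simp only [he, divMono_single]
  rw [hsplit] at hsum
  have h0 : c z = 0 := by
    have := congrArg ε hsum
    simpa [hε] using this
  rw [h0, zero_smul, zero_add] at hsum
  have h1 := Fintype.linearIndependent_iff.mp hb (fun i => c (e i)) hsum
  intro m
  rcases hcase m with h | ⟨i, h⟩ | h
  · rw [h, h0]
  · rw [h, h1]
  · exact hc m h

theorem linearIndepOn_divMono_of_forall {N : ℕ}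
    (h : ∀ c : (Fin d → Fin p) → K, (∀ m, N < expDeg m → c m = 0) →
      ∑ m, c m • divMono K b (fun i => (m i : ℕ)) = 0 → ∀ m, c m = 0) :
    LinearIndepOn K (fun m : Fin d → Fin p => divMono K b fun i => (m i : ℕ))
      {m | expDeg m ≤ N} := by
  rw [linearIndepOn_iff'']
  intro s g hs hg hsum i _
  refine h g (fun m hm => hg m fun hm' => ?_) ?_ i
  · exact absurd (hs hm') (not_le.mpr hm)
  · rw [← hsum]
    refine (Finset.sum_subset (Finset.subset_univ s) fun m _ hm => ?_).symm
    rw [hg m hm, zero_smul]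

/-- Induction on the degree. A monomial of top degree is split as j + k into exponents of smaller
degree. By induction there are functionals dual to j and k, and their tensor product applied after Δ
reads off the coefficient at j + k alone. -/
theorem coeff_eq_zero_of_sum_divMono {Δ : U →ₐ[K] U ⊗[K] U} {ε : U →ₐ[K] K}
    (hΔ : ∀ i, Δ (b i) = b i ⊗ₜ 1 + 1 ⊗ₜ b i) (hε : ∀ i, ε (b i) = 0)
    (hb : LinearIndependent K b) (N : ℕ) : ∀ c : (Fin d → Fin p) → K,
      (∀ m, N + 1 < expDeg m → c m = 0) →
      ∑ m, c m • divMono K b (fun i => (m i : ℕ)) = 0 → ∀ m, c m = 0 := by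
  classical
  induction N with
  | zero => exact linearIndependent_divMono_one hε hb
  | succ N ih =>
    intro c hc hsum
    have hind := linearIndepOn_divMono_of_forall ih
    refine ih c (fun m hm => ?_) hsum
    rcases eq_or_ne (expDeg m) (N + 1 + 1) with hdeg | hdeg
    swap
    · exact hc m (by omega)
    obtain ⟨i, hi⟩ : ∃ i, (m i : ℕ) ≠ 0 := by
      by_contra hcon
      push Not at hcon
      rw [expDeg, Finset.sum_eq_zero fun i _ => hcon i] at hdeg
      omega
    have hp := (Fact.out : p.Prime).two_le
    -- One letter is split off `m`, so that j has degree 1 and k degree N + 1, both covered by the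
    -- induction hypothesis.
    let j : Fin d → Fin p := fun l => if l = i then ⟨1, by omega⟩ else ⟨0, by omega⟩
    let k : Fin d → Fin p := fun l => if l = i then ⟨m l - 1, by have := (m l).isLt; omega⟩ else m l
    have hjk : ∀ l, (j l : ℕ) + k l = m l := by
      intro l
      by_cases h : l = i
      · subst h; simp [j, k]; omega
      · simp [j, k, h]
    have hjdeg : expDeg j = 1 := by
      rw [expDeg, Finset.sum_eq_single i]
      · simp [j]
      · intro l _ hl; simp [j, hl]
      · simp
    have hkdeg : expDeg k = N + 1 := by
      have : expDeg j + expDeg k = expDeg m := by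
        rw [expDeg, expDeg, expDeg, ← Finset.sum_add_distrib]
        exact Finset.sum_congr rfl fun l _ => hjk l
      omega
    obtain ⟨f, hf⟩ := exists_dual_of_linearIndependent hind ⟨j, by simp [hjdeg]⟩
    obtain ⟨g, hg⟩ := exists_dual_of_linearIndependent hind ⟨k, hkdeg.le⟩
    have hf' : ∀ a : Fin d → Fin p, expDeg a ≤ N + 1 →
        f (divMono K b fun l => (a l : ℕ)) = if a = j then 1 else 0 := by
      intro a ha
      have := hf ⟨a, ha⟩
      simpa only [Subtype.mk.injEq] using this
    have hg' : ∀ a : Fin d → Fin p, expDeg a ≤ N + 1 →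
        g (divMono K b fun l => (a l : ℕ)) = if a = k then 1 else 0 := by
      intro a ha
      have := hg ⟨a, ha⟩
      simpa only [Subtype.mk.injEq] using this
    -- The functionals are uncontrolled above degree N + 1, but a factor of that degree forces the
    -- other to have degree 0, where its functional vanishes because j and k have positive degree.
    have key : ∀ a a' : Fin d → Fin p, expDeg a + expDeg a' ≤ N + 1 + 1 →
        f (divMono K b fun l => (a l : ℕ)) * g (divMono K b fun l => (a' l : ℕ)) =
          if a = j ∧ a' = k then 1 else 0 := by
      intro a a' haa
      by_cases h1 : expDeg a ≤ N + 1
      · by_cases h2 : expDeg a' ≤ N + 1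
        · rw [hf' a h1, hg' a' h2]
          by_cases e1 : a = j <;> by_cases e2 : a' = k <;> simp [e1, e2]
        · have h3 : a ≠ j := by rintro rfl; omega
          rw [hf' a h1, if_neg h3, zero_mul, if_neg fun h => h3 h.1]
      · have h3 : a' ≠ k := by rintro rfl; omega
        rw [hg' a' (by omega), if_neg h3, mul_zero, if_neg fun h => h3 h.2]
    let Λ : U ⊗[K] U →ₗ[K] K := LinearMap.mul' K K ∘ₗ TensorProduct.map f g
    have hΛ : ∀ m' : Fin d → Fin p, expDeg m' ≤ N + 1 + 1 →
        Λ (Δ (divMono K b fun l => (m' l : ℕ))) = if m' = m then 1 else 0 := by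
      intro m' hm'
      rw [comul_divMono hΔ fun l => (m' l).isLt, map_sum]
      have hterm : ∀ x ∈ Fintype.piFinset fun l => Finset.HasAntidiagonal.antidiagonal (m' l : ℕ),
          Λ (divMono K b (fun l => (x l).1) ⊗ₜ divMono K b (fun l => (x l).2)) =
          if x = (fun l => ((j l : ℕ), (k l : ℕ))) then 1 else 0 := by
        intro x hx
        rw [Fintype.mem_piFinset] at hx
        have hx' : ∀ l, (x l).1 + (x l).2 = m' l := fun l => Finset.HasAntidiagonal.mem_antidiagonal.mp (hx l)
        obtain ⟨a, ha⟩ : ∃ a : Fin d → Fin p, ∀ l, (x l).1 = a l :=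
          ⟨fun l => ⟨(x l).1, by have := hx' l; have := (m' l).isLt; omega⟩, fun l => rfl⟩
        obtain ⟨a', ha'⟩ : ∃ a : Fin d → Fin p, ∀ l, (x l).2 = a l :=
          ⟨fun l => ⟨(x l).2, by have := hx' l; have := (m' l).isLt; omega⟩, fun l => rfl⟩
        have hdeg' : expDeg a + expDeg a' = expDeg m' := by
          rw [expDeg, expDeg, expDeg, ← Finset.sum_add_distrib]
          exact Finset.sum_congr rfl fun l _ => by rw [← ha, ← ha', hx' l]
        have hΛ' : Λ (divMono K b (fun l => (x l).1) ⊗ₜ divMono K b (fun l => (x l).2)) =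
            f (divMono K b fun l => (a l : ℕ)) * g (divMono K b fun l => (a' l : ℕ)) := by
          simp only [ha, ha']
          rfl
        rw [hΛ', key a a' (hdeg'.trans_le hm')]
        congr 1
        rw [eq_iff_iff]
        constructor
        · rintro ⟨rfl, rfl⟩
          exact funext fun l => Prod.ext (ha l) (ha' l)
        · intro h
          refine ⟨funext fun l => Fin.ext ?_, funext fun l => Fin.ext ?_⟩
          · rw [← ha, h]
          · rw [← ha', h]
      rw [Finset.sum_congr rfl hterm, Finset.sum_ite_eq']
      congr 1
      rw [eq_iff_iff, Fintype.mem_piFinset]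
      constructor
      · intro h
        exact funext fun l => Fin.ext ((Finset.HasAntidiagonal.mem_antidiagonal.mp (h l)).symm.trans (hjk l))
      · rintro rfl l
        exact Finset.HasAntidiagonal.mem_antidiagonal.mpr (hjk l)
    have h1 := congrArg (fun x => Λ (Δ x)) hsum
    simp only [map_sum, map_smul, map_zero] at h1
    rw [Finset.sum_eq_single m] at h1
    · rwa [hΛ m hdeg.le, if_pos rfl, smul_eq_mul, mul_one] at h1
    · intro m' _ hm'
      by_cases h2 : expDeg m' ≤ N + 1 + 1
      · rw [hΛ m' h2, if_neg hm', smul_zero]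
      · rw [hc m' (by omega), zero_smul]
    · simp

/-- In a bialgebra generated by a Lie algebra of primitive elements closed under `p`-th powers of
the basis elements, the restricted ordered monomials form a basis. -/
theorem finrank_eq_pow_of_primitive {Δ : U →ₐ[K] U ⊗[K] U} {ε : U →ₐ[K] K}
    (hΔ : ∀ i, Δ (b i) = b i ⊗ₜ 1 + 1 ⊗ₜ b i) (hε : ∀ i, ε (b i) = 0)
    (hb : LinearIndependent K b) (hgen : Algebra.adjoin K (Set.range b) = ⊤)
    (hlie : ∀ i j, b i * b j - b j * b i ∈ Submodule.span K (Set.range b))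
    (hpow : ∀ i, b i ^ p ∈ Submodule.span K (Set.range b)) :
    Module.finrank K U = p ^ d := by
  have hind : LinearIndependent K (fun m : Fin d → Fin p => divMono K b fun i => (m i : ℕ)) := by
    rw [Fintype.linearIndependent_iff]
    intro c hc
    refine coeff_eq_zero_of_sum_divMono hΔ hε hb (∑ _i : Fin d, p) c (fun m hm => ?_) hc
    have : expDeg m ≤ ∑ _i : Fin d, p := Finset.sum_le_sum fun i _ => (m i).isLt.le
    omega
  have B := Module.Basis.mk hind (span_divMono_eq_top hgen hlie hpow).ge
  rw [Module.finrank_eq_card_basis B]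
  simp

end RestrictedPBW

/-! ### Universal property, faithful representation and dimension of u(S(n;1)) -/

section RestrictedEnvelope

variable {K : Type*} [Field K] {n p : ℕ} [Fact p.Prime] [CharP K p]

/-- A linear map from the special algebra to an associative algebra which respects brackets and
the `p`-th powers of the basis elements `D_ij(x^(α))`. -/
structure IsRestrictedMap {B : Type*} [Ring B] [Algebra K B] (f : Special K n p →ₗ[K] B) :
    Prop where
  lie : ∀ x y, f ⁅x, y⁆ = f x * f y - f y * f x
  toral : ∀ i j : Fin n, i < j → ∀ x : Special K n p,
    (x : WittAlg K n p) = Dij i j (mono (eps i + eps j)) → f x ^ p = f x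
  nilpotent : ∀ i j : Fin n, i < j → ∀ α : Fin n → ℕ, (∀ l, α l < p) → α ≠ eps i + eps j →
    ∀ x : Special K n p, (x : WittAlg K n p) = Dij i j (mono α) → f x ^ p = 0

variable (K n p) in
/-- The canonical map from the special algebra to its restricted enveloping algebra. -/
noncomputable def uι : Special K n p →ₗ[K] RestrictedEnv K n p :=
  let _ : LieRing (UniversalEnvelopingAlgebra K (Special K n p)) := LieRing.ofAssociativeRing
  let _ : LieAlgebra K (UniversalEnvelopingAlgebra K (Special K n p)) :=
    LieAlgebra.ofAssociativeAlgebra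
  (RingQuot.mkAlgHom K (RestrictedRel K n p)).toLinearMap ∘ₗ
    (UniversalEnvelopingAlgebra.ι K : Special K n p →ₗ⁅K⁆ _).toLinearMap

theorem uι_apply (x : Special K n p) : uι K n p x =
    RingQuot.mkAlgHom K (RestrictedRel K n p) (UniversalEnvelopingAlgebra.ι K x) := rfl

theorem isRestrictedMap_uι : IsRestrictedMap (uι K n p) where
  lie x y := by
    let _ : LieRing (UniversalEnvelopingAlgebra K (Special K n p)) := LieRing.ofAssociativeRing
    let _ : LieAlgebra K (UniversalEnvelopingAlgebra K (Special K n p)) :=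
      LieAlgebra.ofAssociativeAlgebra
    rw [uι_apply, LieHom.map_lie, LieRing.of_associative_ring_bracket, map_sub, map_mul, map_mul]
    rfl
  toral i j hij x hx := by
    rw [uι_apply, ← map_pow]
    exact RingQuot.mkAlgHom_rel K (RestrictedRel.toral i j hij x hx)
  nilpotent i j hij α hα hne x hx := by
    rw [uι_apply, ← map_pow, ← map_zero (RingQuot.mkAlgHom K (RestrictedRel K n p))]
    exact RingQuot.mkAlgHom_rel K (RestrictedRel.nilpotent i j hij α hα hne x hx)

variable {B C : Type*} [Ring B] [Algebra K B] [Ring C] [Algebra K C]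

theorem IsRestrictedMap.exists_lift {f : Special K n p →ₗ[K] B} (hf : IsRestrictedMap f) :
    ∃ φ : RestrictedEnv K n p →ₐ[K] B, ∀ x, φ (uι K n p x) = f x := by
  let _ : LieRing B := LieRing.ofAssociativeRing
  let _ : LieAlgebra K B := LieAlgebra.ofAssociativeAlgebra
  let F : Special K n p →ₗ⁅K⁆ B := { f with
    map_lie' := fun {x y} => by
      rw [LieRing.of_associative_ring_bracket]
      exact hf.lie x y }
  have hF : ∀ x, UniversalEnvelopingAlgebra.lift K F (UniversalEnvelopingAlgebra.ι K x) = f x :=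
    fun x => UniversalEnvelopingAlgebra.lift_ι_apply K F x
  refine ⟨RingQuot.liftAlgHom K ⟨UniversalEnvelopingAlgebra.lift K F, ?_⟩, fun x => ?_⟩
  · intro a b hab
    cases hab with
    | toral i j hij x hx => rw [map_pow, hF, hf.toral i j hij x hx]
    | nilpotent i j hij α hα hne x hx =>
      rw [map_pow, hF, hf.nilpotent i j hij α hα hne x hx, map_zero]
  · rw [uι_apply, RingQuot.liftAlgHom_mkAlgHom_apply, hF]

/-- The extension of a restricted map to the restricted enveloping algebra. -/
noncomputable def IsRestrictedMap.lift {f : Special K n p →ₗ[K] B} (hf : IsRestrictedMap f) :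
    RestrictedEnv K n p →ₐ[K] B := hf.exists_lift.choose

theorem IsRestrictedMap.lift_uι {f : Special K n p →ₗ[K] B} (hf : IsRestrictedMap f)
    (x : Special K n p) : hf.lift (uι K n p x) = f x := hf.exists_lift.choose_spec x

theorem restrictedEnv_hom_ext {φ ψ : RestrictedEnv K n p →ₐ[K] B}
    (h : ∀ x, φ (uι K n p x) = ψ (uι K n p x)) : φ = ψ := by
  let _ : LieRing B := LieRing.ofAssociativeRing
  let _ : LieAlgebra K B := LieAlgebra.ofAssociativeAlgebra
  refine RingQuot.ringQuot_ext' K φ ψ (UniversalEnvelopingAlgebra.hom_ext K ?_)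
  exact LieHom.ext h

theorem IsRestrictedMap.map {f : Special K n p →ₗ[K] B} (hf : IsRestrictedMap f)
    (φ : B →ₐ[K] C) : IsRestrictedMap (φ.toLinearMap ∘ₗ f) where
  lie x y := by simp [hf.lie]
  toral i j hij x hx := by
    simp only [LinearMap.comp_apply, AlgHom.toLinearMap_apply]
    rw [← map_pow, hf.toral i j hij x hx]
  nilpotent i j hij α hα hne x hx := by
    simp only [LinearMap.comp_apply, AlgHom.toLinearMap_apply]
    rw [← map_pow, hf.nilpotent i j hij α hα hne x hx, map_zero]

theorem isRestrictedMap_zero : IsRestrictedMap (0 : Special K n p →ₗ[K] B) where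
  lie := by simp
  toral i j hij x hx := by simp [(Fact.out : p.Prime).ne_zero]
  nilpotent i j hij α hα hne x hx := by simp [(Fact.out : p.Prime).ne_zero]

-- Frobenius with the characteristic taken from the base field, so that it applies to algebras not
-- known to be nonzero.
variable (K) in
theorem add_pow_prime_of_commute (p : ℕ) [Fact p.Prime] [CharP K p] {x y : B} (h : Commute x y) :
    (x + y) ^ p = x ^ p + y ^ p := by
  obtain ⟨r, hr⟩ := h.exists_add_pow_prime_eq (Fact.out : p.Prime)
  have : ((p : ℕ) : B) = 0 := by
    rw [← map_natCast (algebraMap K B), CharP.cast_eq_zero, map_zero]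
  rw [hr, this, zero_mul, zero_mul, zero_mul, add_zero]

/-- The map `x ↦ f x ⊗ 1 + 1 ⊗ f x`. -/
noncomputable def primitiveMap (R : Type*) [CommRing R] [Algebra K R] [Algebra R B]
    [IsScalarTower K R B] (f : Special K n p →ₗ[K] B) : Special K n p →ₗ[K] B ⊗[R] B where
  toFun x := f x ⊗ₜ 1 + 1 ⊗ₜ f x
  map_add' x y := by
    rw [map_add, TensorProduct.add_tmul, TensorProduct.tmul_add]
    abel
  map_smul' c x := by
    rw [map_smul, RingHom.id_apply, smul_add, TensorProduct.smul_tmul', TensorProduct.tmul_smul]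

/-- The summands f x ⊗ 1 and 1 ⊗ f x commute, so the p-th power is additive and the relations
persist. This yields the standard coproduct. -/
theorem IsRestrictedMap.primitive (R : Type*) [CommRing R] [Algebra K R] [Algebra R B]
    [IsScalarTower K R B] {f : Special K n p →ₗ[K] B} (hf : IsRestrictedMap f) :
    IsRestrictedMap (primitiveMap R f) := by
  have hc : ∀ x y : B, Commute (x ⊗ₜ[R] (1 : B)) ((1 : B) ⊗ₜ[R] y) := fun x y => by
    simp [Commute, SemiconjBy]
  have hpow : ∀ x, primitiveMap R f x ^ p = (f x ^ p) ⊗ₜ 1 + 1 ⊗ₜ (f x ^ p) := fun x => by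
    change (f x ⊗ₜ[R] (1 : B) + (1 : B) ⊗ₜ[R] f x) ^ p = _
    rw [add_pow_prime_of_commute K p (hc _ _), Algebra.TensorProduct.tmul_pow,
      Algebra.TensorProduct.tmul_pow, one_pow]
  refine ⟨fun x y => ?_, fun i j hij x hx => ?_, fun i j hij α hα hne x hx => ?_⟩
  · change f ⁅x, y⁆ ⊗ₜ[R] (1 : B) + (1 : B) ⊗ₜ[R] f ⁅x, y⁆ =
      (f x ⊗ₜ[R] (1 : B) + (1 : B) ⊗ₜ[R] f x) * (f y ⊗ₜ[R] (1 : B) + (1 : B) ⊗ₜ[R] f y) -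
      (f y ⊗ₜ[R] (1 : B) + (1 : B) ⊗ₜ[R] f y) * (f x ⊗ₜ[R] (1 : B) + (1 : B) ⊗ₜ[R] f x)
    rw [hf.lie]
    simp only [mul_add, add_mul, Algebra.TensorProduct.tmul_mul_tmul, one_mul, mul_one,
      TensorProduct.sub_tmul, TensorProduct.tmul_sub]
    abel
  · rw [hpow, hf.toral i j hij x hx]
    rfl
  · rw [hpow, hf.nilpotent i j hij α hα hne x hx, TensorProduct.zero_tmul, TensorProduct.tmul_zero,
      add_zero]

/-- The map `x ↦ - f x` to the opposite algebra. -/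
noncomputable def negOpMap (f : Special K n p →ₗ[K] B) : Special K n p →ₗ[K] Bᵐᵒᵖ where
  toFun x := MulOpposite.op (-f x)
  map_add' x y := by rw [map_add, neg_add, MulOpposite.op_add]
  map_smul' c x := by rw [map_smul, RingHom.id_apply, ← smul_neg, MulOpposite.op_smul]

/-- As p is odd, (-x)^p = -x^p, so negation preserves the toral relation. This yields the standard
antipode. -/
theorem IsRestrictedMap.negOp (hp : 2 < p) {f : Special K n p →ₗ[K] B} (hf : IsRestrictedMap f) :
    IsRestrictedMap (negOpMap f) := by
  have hodd : Odd p := (Fact.out : p.Prime).odd_of_ne_two hp.ne'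
  have hpow : ∀ x, negOpMap f x ^ p = MulOpposite.op (-(f x ^ p)) := fun x => by
    change MulOpposite.op (-f x) ^ p = _
    rw [← MulOpposite.op_pow, hodd.neg_pow]
  refine ⟨fun x y => ?_, fun i j hij x hx => ?_, fun i j hij α hα hne x hx => ?_⟩
  · change MulOpposite.op (-f ⁅x, y⁆) = MulOpposite.op (-f x) * MulOpposite.op (-f y) -
      MulOpposite.op (-f y) * MulOpposite.op (-f x)
    rw [hf.lie, ← MulOpposite.op_mul, ← MulOpposite.op_mul, ← MulOpposite.op_sub]
    congr 1
    noncomm_ring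
  · rw [hpow, hf.toral i j hij x hx]
    rfl
  · rw [hpow, hf.nilpotent i j hij α hα hne x hx, neg_zero, MulOpposite.op_zero]

/-- By the universal property the identity factors through the inclusion of the generated
subalgebra. -/
theorem adjoin_range_uι : Algebra.adjoin K (Set.range (uι K n p)) = ⊤ := by
  let A := Algebra.adjoin K (Set.range (uι K n p))
  let f : Special K n p →ₗ[K] A := (uι K n p).codRestrict (Subalgebra.toSubmodule A)
    fun x => Algebra.subset_adjoin ⟨x, rfl⟩
  have hf : IsRestrictedMap f := by
    refine ⟨fun x y => ?_, fun i j hij x hx => ?_, fun i j hij α hα hne x hx => ?_⟩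
    · exact Subtype.ext (isRestrictedMap_uι.lie x y)
    · exact Subtype.ext (isRestrictedMap_uι.toral i j hij x hx)
    · exact Subtype.ext (isRestrictedMap_uι.nilpotent i j hij α hα hne x hx)
  have h : A.val.comp hf.lift = AlgHom.id K _ := restrictedEnv_hom_ext fun x => by
    rw [AlgHom.comp_apply, hf.lift_uι]
    rfl
  refine eq_top_iff.mpr fun x _ => ?_
  rw [← AlgHom.id_apply (R := K) x, ← h]
  exact (hf.lift x).2

variable (K n p) in
/-- The tautological representation on the divided power algebra, as a linear map. -/
noncomputable def repLin : Special K n p →ₗ[K] Module.End K (TruncDP K n p) where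
  toFun x := ((x : WittAlg K n p) : TruncDP K n p →ₗ[K] TruncDP K n p)
  map_add' _ _ := rfl
  map_smul' _ _ := rfl

theorem isRestrictedMap_repLin : IsRestrictedMap (repLin K n p) where
  lie x y := by
    refine LinearMap.ext fun f => ?_
    exact Derivation.commutator_apply _
  toral i j hij x hx := by
    change ((x : WittAlg K n p) : TruncDP K n p →ₗ[K] TruncDP K n p) ^ p =
      ((x : WittAlg K n p) : TruncDP K n p →ₗ[K] TruncDP K n p)
    rw [hx, Dij_toral_pow hij.ne]
  nilpotent i j hij α hα hne x hx := by
    change ((x : WittAlg K n p) : TruncDP K n p →ₗ[K] TruncDP K n p) ^ p = 0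
    rw [hx, Dij_pow_of_ne i j α hne]

variable (K n p) in
/-- The tautological representation on the divided power algebra. -/
noncomputable def rep : RestrictedEnv K n p →ₐ[K] Module.End K (TruncDP K n p) :=
  isRestrictedMap_repLin.lift

theorem rep_uι_apply (x : Special K n p) (f : TruncDP K n p) :
    rep K n p (uι K n p x) f = (x : WittAlg K n p) f := by
  rw [rep, IsRestrictedMap.lift_uι]
  rfl

/-- An element of the special algebra is recovered from its action on the divided power algebra, on
which u(S(n;1)) acts. -/
theorem uι_injective : Function.Injective (uι K n p) := by
  intro x y h
  refine Subtype.ext (Derivation.ext fun f => ?_)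
  rw [← rep_uι_apply, h, rep_uι_apply]

theorem finrank_RestrictedEnv (hn : 3 ≤ n) :
    Module.finrank K (RestrictedEnv K n p) = p ^ ((n - 1) * (p ^ n - 1)) := by
  -- The basis is extracted from the D_ij(x^(α)), whose p-th powers the relations give; for other
  -- elements they do not do so directly.
  obtain ⟨b, hb, hspan, hind⟩ := Submodule.exists_fun_fin_finrank_span_eq K (genSet K n p)
  have hS := (Special_toSubmodule (K := K) (p := p) hn).1
  have hfin : Module.finrank K (Submodule.span K (genSet K n p)) = (n - 1) * (p ^ n - 1) := by
    rw [← hS]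
    exact finrank_Special hn
  rw [← hfin]
  have hmem : ∀ i, b i ∈ Special K n p := fun i => by
    rw [← LieSubalgebra.mem_toSubmodule, hS]
    exact Submodule.subset_span (hb i)
  let b' : Fin _ → Special K n p := fun i => ⟨b i, hmem i⟩
  have hind' : LinearIndependent K b' :=
    LinearIndependent.of_comp (Special K n p).toSubmodule.subtype hind
  have hspan' : Submodule.span K (Set.range b') = ⊤ := by
    refine Submodule.map_injective_of_injective
      (Special K n p).toSubmodule.injective_subtype ?_
    rw [Submodule.map_span, ← Set.range_comp, Submodule.map_subtype_top]
    exact hspan.trans hS.symm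
  have hrange : Submodule.span K (Set.range (uι K n p ∘ b')) = LinearMap.range (uι K n p) := by
    rw [Set.range_comp, ← Submodule.map_span, hspan', Submodule.map_top]
  have hmem' : ∀ x, uι K n p x ∈ Submodule.span K (Set.range (uι K n p ∘ b')) := fun x => by
    rw [hrange]
    exact ⟨x, rfl⟩
  have hΔ := (isRestrictedMap_uι (K := K) (n := n) (p := p)).primitive K
  refine finrank_eq_pow_of_primitive (b := uι K n p ∘ b') (Δ := hΔ.lift)
    (ε := (isRestrictedMap_zero (B := K)).lift) (fun i => hΔ.lift_uι _)
    (fun i => isRestrictedMap_zero.lift_uι _) ?_ ?_ ?_ ?_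
  · exact hind'.map' _ (LinearMap.ker_eq_bot.mpr uι_injective)
  · refine eq_top_iff.mpr ?_
    rw [← adjoin_range_uι, Algebra.adjoin_le_iff]
    rintro _ ⟨x, rfl⟩
    exact Algebra.span_le_adjoin K _ (hmem' x)
  · intro i j
    have := hmem' ⁅b' i, b' j⁆
    rwa [isRestrictedMap_uι.lie] at this
  · intro i
    obtain ⟨r, s, hrs, α, hα, hi⟩ := hb i
    by_cases hne : α = eps r + eps s
    · have := isRestrictedMap_uι.toral r s hrs (b' i) (by rw [← hne]; exact hi)
      rw [Function.comp_apply, this]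
      exact hmem' _
    · have := isRestrictedMap_uι.nilpotent r s hrs α hα hne (b' i) hi
      rw [Function.comp_apply, this]
      exact zero_mem _

end RestrictedEnvelope

/-! ### Hopf algebras generated by primitive elements -/

section BaseHopf

variable {R A : Type*} [CommRing R] [Ring A] [Algebra R A] {S : A →ₗ[R] A}

/-- Lets the antipode axiom pass to products, so that it need only be checked on generators. -/
theorem antipode_left_mul (hS : ∀ a b, S (a * b) = S b * S a) {u : A ⊗[R] A} {r : R}
    (hu : LinearMap.mul' R A (S.rTensor A u) = algebraMap R A r) (v : A ⊗[R] A) :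
    LinearMap.mul' R A (S.rTensor A (u * v)) = r • LinearMap.mul' R A (S.rTensor A v) := by
  induction v with
  | zero => simp
  | add v w hv hw => rw [mul_add, map_add, map_add, hv, hw, map_add, map_add, smul_add]
  | tmul c d =>
    have h : ∀ u : A ⊗[R] A, LinearMap.mul' R A (S.rTensor A (u * (c ⊗ₜ d))) =
        S c * LinearMap.mul' R A (S.rTensor A u) * d := by
      intro u
      induction u with
      | zero => simp
      | add u w hu hw => rw [add_mul, map_add, map_add, hu, hw, map_add, map_add, mul_add, add_mul]
      | tmul a b =>
        rw [Algebra.TensorProduct.tmul_mul_tmul, LinearMap.rTensor_tmul, LinearMap.rTensor_tmul,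
          LinearMap.mul'_apply, LinearMap.mul'_apply, hS]
        simp only [mul_assoc]
    rw [h, hu, LinearMap.rTensor_tmul, LinearMap.mul'_apply, ← Algebra.commutes, Algebra.smul_def,
      mul_assoc]

theorem antipode_right_mul (hS : ∀ a b, S (a * b) = S b * S a) {v : A ⊗[R] A} {r : R}
    (hv : LinearMap.mul' R A (S.lTensor A v) = algebraMap R A r) (u : A ⊗[R] A) :
    LinearMap.mul' R A (S.lTensor A (u * v)) = r • LinearMap.mul' R A (S.lTensor A u) := by
  induction u with
  | zero => simp
  | add u w hu hw => rw [add_mul, map_add, map_add, hu, hw, map_add, map_add, smul_add]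
  | tmul c d =>
    have h : ∀ v : A ⊗[R] A, LinearMap.mul' R A (S.lTensor A ((c ⊗ₜ d) * v)) =
        c * LinearMap.mul' R A (S.lTensor A v) * S d := by
      intro u
      induction u with
      | zero => simp
      | add u w hu hw => rw [mul_add, map_add, map_add, hu, hw, map_add, map_add, mul_add, add_mul]
      | tmul a b =>
        rw [Algebra.TensorProduct.tmul_mul_tmul, LinearMap.lTensor_tmul, LinearMap.lTensor_tmul,
          LinearMap.mul'_apply, LinearMap.mul'_apply, hS]
        simp only [mul_assoc]
    rw [h, hv, LinearMap.lTensor_tmul, LinearMap.mul'_apply, ← Algebra.commutes, Algebra.smul_def,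
      mul_assoc]

/-- An algebra generated by elements which are primitive for given algebra homomorphisms is a Hopf
algebra. -/
theorem isHopfData_of_primitive {s : Set A} (hs : Algebra.adjoin R s = ⊤)
    {Δ : A →ₐ[R] A ⊗[R] A} {ε : A →ₐ[R] R} (hS : ∀ a b, S (a * b) = S b * S a) (hS1 : S 1 = 1)
    (hΔ : ∀ x ∈ s, Δ x = x ⊗ₜ 1 + 1 ⊗ₜ x) (hε : ∀ x ∈ s, ε x = 0) (hSs : ∀ x ∈ s, S x = -x) :
    IsHopfData Δ ε S := by
  have hS1' : LinearMap.mul' R A (S.rTensor A 1) = 1 := by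
    rw [Algebra.TensorProduct.one_def, LinearMap.rTensor_tmul, LinearMap.mul'_apply, hS1, mul_one]
  have hS1'' : LinearMap.mul' R A (S.lTensor A 1) = 1 := by
    rw [Algebra.TensorProduct.one_def, LinearMap.lTensor_tmul, LinearMap.mul'_apply, hS1, mul_one]
  refine ⟨fun x => ?_, fun x => ?_, fun x => ?_, fun x => ?_, fun x => ?_⟩
  · have h : ((Algebra.TensorProduct.assoc R R R A A A).toAlgHom.comp
        (Algebra.TensorProduct.map Δ (AlgHom.id R A))).comp Δ =
        (Algebra.TensorProduct.map (AlgHom.id R A) Δ).comp Δ := by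
      refine AlgHom.ext_of_adjoin_eq_top hs fun y hy => ?_
      change Algebra.TensorProduct.assoc R R R A A A
          (Algebra.TensorProduct.map Δ (AlgHom.id R A) (Δ y)) =
        Algebra.TensorProduct.map (AlgHom.id R A) Δ (Δ y)
      rw [hΔ y hy, map_add, map_add, map_add, Algebra.TensorProduct.map_tmul,
        Algebra.TensorProduct.map_tmul, Algebra.TensorProduct.map_tmul,
        Algebra.TensorProduct.map_tmul, map_one Δ, hΔ y hy, Algebra.TensorProduct.one_def,
        TensorProduct.add_tmul, TensorProduct.tmul_add, map_add]
      simp only [Algebra.TensorProduct.assoc_tmul, AlgHom.id_apply]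
      abel
    exact DFunLike.congr_fun h x
  · have h : (Algebra.TensorProduct.map ε (AlgHom.id R A)).comp Δ =
        Algebra.TensorProduct.includeRight := by
      refine AlgHom.ext_of_adjoin_eq_top hs fun y hy => ?_
      rw [AlgHom.comp_apply, hΔ y hy, map_add, Algebra.TensorProduct.map_tmul,
        Algebra.TensorProduct.map_tmul, hε y hy, map_one ε, TensorProduct.zero_tmul, zero_add]
      rfl
    exact DFunLike.congr_fun h x
  · have h : (Algebra.TensorProduct.map (AlgHom.id R A) ε).comp Δ =
        Algebra.TensorProduct.includeLeft := by
      refine AlgHom.ext_of_adjoin_eq_top hs fun y hy => ?_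
      rw [AlgHom.comp_apply, hΔ y hy, map_add, Algebra.TensorProduct.map_tmul,
        Algebra.TensorProduct.map_tmul, hε y hy, map_one ε, TensorProduct.tmul_zero, add_zero]
      rfl
    exact DFunLike.congr_fun h x
  · have hx : x ∈ Algebra.adjoin R s := hs ▸ Algebra.mem_top
    induction hx using Algebra.adjoin_induction with
    | mem x hx =>
      rw [hΔ x hx, hε x hx, map_add, map_add, LinearMap.rTensor_tmul, LinearMap.rTensor_tmul,
        LinearMap.mul'_apply, LinearMap.mul'_apply, hSs x hx, hS1, map_zero]
      simp
    | algebraMap r =>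
      rw [AlgHom.commutes, AlgHom.commutes, Algebra.algebraMap_eq_smul_one, map_smul, map_smul,
        hS1', Algebra.algebraMap_eq_smul_one]
      rfl
    | add x y _ _ hx hy => rw [map_add, map_add, map_add, hx, hy, map_add, map_add]
    | mul x y _ _ hx hy =>
      rw [map_mul, antipode_left_mul hS hx, hy, map_mul, map_mul, Algebra.smul_def]
  · have hx : x ∈ Algebra.adjoin R s := hs ▸ Algebra.mem_top
    induction hx using Algebra.adjoin_induction with
    | mem x hx =>
      rw [hΔ x hx, hε x hx, map_add, map_add, LinearMap.lTensor_tmul, LinearMap.lTensor_tmul,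
        LinearMap.mul'_apply, LinearMap.mul'_apply, hSs x hx, hS1, map_zero]
      simp
    | algebraMap r =>
      rw [AlgHom.commutes, AlgHom.commutes, Algebra.algebraMap_eq_smul_one, map_smul, map_smul,
        hS1'', Algebra.algebraMap_eq_smul_one]
      rfl
    | add x y _ _ hx hy => rw [map_add, map_add, map_add, hx, hy, map_add, map_add]
    | mul x y _ _ hx hy =>
      rw [map_mul, antipode_right_mul hS hy, hx, map_mul, map_mul, Algebra.commutes,
        Algebra.smul_def]

end BaseHopf

/-! ### Extension of scalars to K[t]/(t^p - qt) -/

section ScalarExtension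

variable {K : Type*} [Field K] {n p : ℕ} [Fact p.Prime] [CharP K p] (q : K)

theorem monic_truncPoly : (Polynomial.X ^ p - Polynomial.C q * Polynomial.X : K[X]).Monic := by
  refine Polynomial.monic_X_pow_sub ?_
  refine (Polynomial.degree_C_mul_X_le q).trans_lt ?_
  exact_mod_cast (Fact.out : p.Prime).one_lt

theorem natDegree_truncPoly :
    (Polynomial.X ^ p - Polynomial.C q * Polynomial.X : K[X]).natDegree = p := by
  refine Polynomial.natDegree_eq_of_degree_eq_some ?_
  rw [Polynomial.degree_sub_eq_left_of_degree_lt, Polynomial.degree_X_pow]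
  rw [Polynomial.degree_X_pow]
  refine (Polynomial.degree_C_mul_X_le q).trans_lt ?_
  exact_mod_cast (Fact.out : p.Prime).one_lt

theorem finrank_truncPoly : Module.finrank K (TruncPoly K p q) = p := by
  rw [(AdjoinRoot.powerBasis' (monic_truncPoly q)).finrank, AdjoinRoot.powerBasis'_dim,
    natDegree_truncPoly]

theorem tvar_ne_zero : tvar K p q ≠ 0 := by
  refine AdjoinRoot.mk_ne_zero_of_natDegree_lt (monic_truncPoly q) Polynomial.X_ne_zero ?_
  rw [natDegree_truncPoly, Polynomial.natDegree_X]
  exact (Fact.out : p.Prime).one_lt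

theorem finrank_UTQ (hn : 3 ≤ n) :
    Module.finrank K (UTQ K n p q) = p ^ (1 + (n - 1) * (p ^ n - 1)) := by
  rw [Module.finrank_tensorProduct, finrank_truncPoly, finrank_RestrictedEnv hn, pow_add, pow_one]

theorem charP_truncPoly : CharP (TruncPoly K p q) p := by
  have : Nontrivial (TruncPoly K p q) := ⟨_, _, tvar_ne_zero q⟩
  exact charP_of_injective_algebraMap (algebraMap K (TruncPoly K p q)).injective p

/-- Characteristic p includes nontriviality, which is read off from the dimension. -/
theorem charP_UTQ (hn : 3 ≤ n) : CharP (UTQ K n p q) p := by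
  have : Nontrivial (UTQ K n p q) := by
    refine Module.nontrivial_of_finrank_pos (R := K) ?_
    rw [finrank_UTQ q hn]
    exact pow_pos (Fact.out : p.Prime).pos _
  exact charP_of_injective_algebraMap (algebraMap K (UTQ K n p q)).injective p

theorem isRestrictedMap_el : IsRestrictedMap (el q : Special K n p →ₗ[K] UTQ K n p q) :=
  isRestrictedMap_uι.map (Algebra.TensorProduct.includeRight :
    RestrictedEnv K n p →ₐ[K] UTQ K n p q)

theorem tmul_ne_zero_of_ne_zero {V W : Type*} [AddCommGroup V] [Module K V] [AddCommGroup W]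
    [Module K W] {v : V} {w : W} (hv : v ≠ 0) (hw : w ≠ 0) : v ⊗ₜ[K] w ≠ 0 := by
  obtain ⟨f, hf⟩ : ∃ f : Module.Dual K W, f w ≠ 0 := by
    by_contra! h
    exact hw ((Module.forall_dual_apply_eq_zero_iff K w).mp h)
  intro h
  have := congrArg (fun z => TensorProduct.rid K V (f.lTensor V z)) h
  simp [hf, hv] at this

theorem el_ne_zero {x : Special K n p} (hx : x ≠ 0) : el q x ≠ 0 := by
  have : Nontrivial (TruncPoly K p q) := ⟨_, _, tvar_ne_zero q⟩
  exact tmul_ne_zero_of_ne_zero one_ne_zero ((map_ne_zero_iff _ uι_injective).mpr hx)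

theorem tvar_smul_el_ne_zero {x : Special K n p} (hx : x ≠ 0) : tvar K p q • el q x ≠ 0 := by
  have h : tvar K p q • el q x = tvar K p q ⊗ₜ[K] uι K n p x := by
    rw [el_apply, TensorProduct.smul_tmul', smul_eq_mul, mul_one]
    rfl
  rw [h]
  exact tmul_ne_zero_of_ne_zero (tvar_ne_zero q) ((map_ne_zero_iff _ uι_injective).mpr hx)

theorem adjoin_range_el :
    Algebra.adjoin (TruncPoly K p q) (Set.range (el q : Special K n p →ₗ[K] UTQ K n p q)) = ⊤ := by
  refine eq_top_iff.mpr fun x _ => ?_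
  induction x using TensorProduct.induction_on with
  | zero => exact zero_mem _
  | add x y hx hy => exact add_mem (hx Algebra.mem_top) (hy Algebra.mem_top)
  | tmul r a =>
    have h1 : r ⊗ₜ[K] a = r • ((1 : TruncPoly K p q) ⊗ₜ[K] a) := by
      rw [TensorProduct.smul_tmul', smul_eq_mul, mul_one]
    rw [h1]
    refine Subalgebra.smul_mem _ ?_ r
    have ha : a ∈ Algebra.adjoin K (Set.range (uι K n p)) := by
      rw [adjoin_range_uι]
      exact Algebra.mem_top
    have h2 : Algebra.adjoin K (Set.range (uι K n p)) ≤
        ((Algebra.adjoin (TruncPoly K p q)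
          (Set.range (el q : Special K n p →ₗ[K] UTQ K n p q))).restrictScalars K).comap
          (Algebra.TensorProduct.includeRight : RestrictedEnv K n p →ₐ[K] UTQ K n p q) := by
      rw [Algebra.adjoin_le_iff]
      rintro _ ⟨y, rfl⟩
      exact Algebra.subset_adjoin ⟨y, rfl⟩
    exact h2 ha

variable {q}

/-- The extension of a restricted map to an algebra homomorphism over `K[t]/(t^p - q t)`. -/
noncomputable def IsRestrictedMap.liftUTQ {B : Type*} [Ring B] [Algebra K B]
    [Algebra (TruncPoly K p q) B] [IsScalarTower K (TruncPoly K p q) B]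
    {f : Special K n p →ₗ[K] B} (hf : IsRestrictedMap f) : UTQ K n p q →ₐ[TruncPoly K p q] B :=
  Algebra.TensorProduct.lift (Algebra.ofId (TruncPoly K p q) B) hf.lift
    fun r x => show Commute _ _ from Algebra.commutes r (hf.lift x)

theorem IsRestrictedMap.liftUTQ_el {B : Type*} [Ring B] [Algebra K B]
    [Algebra (TruncPoly K p q) B] [IsScalarTower K (TruncPoly K p q) B]
    {f : Special K n p →ₗ[K] B} (hf : IsRestrictedMap f) (x : Special K n p) :
    hf.liftUTQ (el q x) = f x := by
  refine (Algebra.TensorProduct.lift_tmul _ _ _ _ _).trans ?_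
  rw [map_one, one_mul]
  exact hf.lift_uι x

variable (q)

/-- The standard Hopf algebra data, for which the Lie algebra elements are primitive. -/
theorem exists_standard_hopfData (hp : 2 < p) :
    ∃ (Δ : UTQ K n p q →ₐ[TruncPoly K p q] UTQ K n p q ⊗[TruncPoly K p q] UTQ K n p q)
      (ε : UTQ K n p q →ₐ[TruncPoly K p q] TruncPoly K p q)
      (S : UTQ K n p q →ₗ[TruncPoly K p q] UTQ K n p q),
      IsHopfData Δ ε S ∧ (∀ a b, S (a * b) = S b * S a) ∧ S 1 = 1 ∧
      (∀ x, Δ (el q x) = el q x ⊗ₜ 1 + 1 ⊗ₜ el q x) ∧ (∀ x, ε (el q x) = 0) ∧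
      ∀ x, S (el q x) = -el q x := by
  have hel := isRestrictedMap_el (n := n) (p := p) q
  have hΔ := hel.primitive (TruncPoly K p q)
  have hε := isRestrictedMap_zero (K := K) (n := n) (p := p) (B := TruncPoly K p q)
  have hS := hel.negOp hp
  let S : UTQ K n p q →ₗ[TruncPoly K p q] UTQ K n p q :=
    (MulOpposite.opLinearEquiv (TruncPoly K p q)).symm.toLinearMap ∘ₗ
      (hS.liftUTQ : UTQ K n p q →ₐ[TruncPoly K p q] (UTQ K n p q)ᵐᵒᵖ).toLinearMap
  have h1 : ∀ a b, S (a * b) = S b * S a := fun a b =>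
    congrArg MulOpposite.unop (map_mul hS.liftUTQ a b)
  have h2 : S 1 = 1 := congrArg MulOpposite.unop (map_one hS.liftUTQ)
  have h3 : ∀ x, S (el q x) = -el q x := fun x =>
    congrArg MulOpposite.unop (hS.liftUTQ_el x)
  refine ⟨hΔ.liftUTQ, hε.liftUTQ, S, isHopfData_of_primitive (adjoin_range_el q) h1 h2 ?_ ?_ ?_,
    h1, h2, hΔ.liftUTQ_el, hε.liftUTQ_el, h3⟩
  · rintro _ ⟨x, rfl⟩
    exact hΔ.liftUTQ_el x
  · rintro _ ⟨x, rfl⟩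
    exact hε.liftUTQ_el x
  · rintro _ ⟨x, rfl⟩
    exact h3 x

end ScalarExtension

/-! ### Brackets among h(k,k'), e(k,k') and the generators -/

section LieOperators

variable {K : Type*} [Field K] {n p : ℕ} [Fact p.Prime] [CharP K p] (hn : 3 ≤ n)

theorem dOp_zero (k k' : Fin n) (x : Special K n p) : dOp hn k k' 0 x = x := by
  simp [dOp]

/-- The bound ℓ + 1 < p makes ℓ + 1 invertible; beyond it 1/(ℓ+1)! is only a default value. -/
theorem lie_eElt_dOp (k k' : Fin n) {ℓ : ℕ} (hℓ : ℓ + 1 < p) (x : Special K n p) :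
    ⁅(eElt hn k k' : Special K n p), dOp hn k k' ℓ x⁆ = ((ℓ + 1 : ℕ) : K) • dOp hn k k' (ℓ + 1) x := by
  have h1 : ((ℓ + 1 : ℕ) : K) ≠ 0 := by
    rw [Ne, CharP.cast_eq_zero_iff K p]
    exact fun h => absurd (Nat.le_of_dvd (Nat.succ_pos _) h) (not_le.mpr hℓ)
  rw [dOp, dOp, LinearMap.smul_apply, LinearMap.smul_apply, pow_succ', Module.End.mul_apply,
    LieAlgebra.ad_apply, lie_smul, smul_smul, Nat.factorial_succ, Nat.cast_mul, mul_inv,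
    mul_inv_cancel_left₀ h1]

/-- Each application of ad e raises the weight by the weight `s` of e. -/
theorem lie_dOp (k k' : Fin n) {h x : Special K n p} {s w : K}
    (he : ⁅h, (eElt hn k k' : Special K n p)⁆ = s • (eElt hn k k' : Special K n p)) (hx : ⁅h, x⁆ = w • x) (ℓ : ℕ) :
    ⁅h, dOp hn k k' ℓ x⁆ = (w + ℓ * s) • dOp hn k k' ℓ x := by
  have key : ⁅h, ((LieAlgebra.ad K (Special K n p) (eElt hn k k' : Special K n p)) ^ ℓ) x⁆ =
      (w + ℓ * s) • ((LieAlgebra.ad K (Special K n p) (eElt hn k k' : Special K n p)) ^ ℓ) x := by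
    induction ℓ with
    | zero => simpa using hx
    | succ ℓ ih =>
      rw [pow_succ', Module.End.mul_apply, LieAlgebra.ad_apply, leibniz_lie, ih, he, smul_lie,
        lie_smul, ← add_smul]
      congr 1
      push_cast
      ring
  rw [dOp, LinearMap.smul_apply, lie_smul, key, smul_comm]

theorem lie_hElt_gen {k k' : Fin n} (hk : k ≠ k') (i j : Fin n) (α : Fin n → ℕ) :
    ⁅(hElt hn k k' : Special K n p), (gen hn i j α : Special K n p)⁆ = (wt α i j k k' : K) • gen hn i j α :=
  Subtype.ext (lie_toral hk i j α)

theorem lie_hElt_eElt {k k' : Fin n} (hk : k ≠ k') (m m' : Fin n) :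
    ⁅(hElt hn k k' : Special K n p), (eElt hn m m' : Special K n p)⁆ =
      (wt (2 • eps m + eps m') m m' k k' : K) • (eElt hn m m' : Special K n p) := by
  rw [eElt, lie_smul, lie_hElt_gen hn hk, smul_comm]

theorem wt_two_eps_self {k k' : Fin n} (hk : k ≠ k') : wt (2 • eps k + eps k') k k' k k' = 1 := by
  simp [wt, eps, hk, hk.symm]

theorem wt_two_eps_of_ne {k k' m m' : Fin n} (hkm : k ≠ m) (hk'm : k' ≠ m) :
    wt (2 • eps m + eps m') m m' k k' = 0 := by
  simp only [wt, eps, Pi.add_apply, Pi.smul_apply, Pi.single_apply, if_neg hkm, if_neg hk'm,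
    if_neg hkm.symm, if_neg hk'm.symm, eq_comm (a := m')]
  split_ifs <;> simp

theorem wt_eps_add_eps (k k' m m' : Fin n) : wt (eps m + eps m') m m' k k' = 0 := by
  simp only [wt, eps, Pi.add_apply, Pi.single_apply, eq_comm (a := m'), eq_comm (a := m)]
  push_cast
  ring

theorem lie_hElt_eElt_self {k k' : Fin n} (hk : k ≠ k') :
    ⁅(hElt hn k k' : Special K n p), (eElt hn k k' : Special K n p)⁆ = (eElt hn k k' : Special K n p) := by
  rw [lie_hElt_eElt hn hk, wt_two_eps_self hk, Int.cast_one, one_smul]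

theorem lie_hElt_eElt_of_ne {k k' m m' : Fin n} (hk : k ≠ k') (hkm : k ≠ m) (hk'm : k' ≠ m) :
    ⁅(hElt hn k k' : Special K n p), (eElt hn m m' : Special K n p)⁆ = 0 := by
  rw [lie_hElt_eElt hn hk, wt_two_eps_of_ne hkm hk'm, Int.cast_zero, zero_smul]

theorem lie_hElt_hElt {k k' : Fin n} (hk : k ≠ k') (m m' : Fin n) :
    ⁅(hElt hn k k' : Special K n p), (hElt hn m m' : Special K n p)⁆ = 0 := by
  rw [hElt, hElt, ← hElt, lie_hElt_gen hn hk, wt_eps_add_eps, Int.cast_zero, zero_smul]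

theorem lie_eElt_eElt (hp : 2 < p) {k k' m m' : Fin n} (hkk' : k ≠ k') (hmm' : m ≠ m')
    (hkm : k ≠ m) (hkm' : k ≠ m') (hk'm : k' ≠ m) :
    ⁅(eElt hn k k' : Special K n p), (eElt hn m m' : Special K n p)⁆ = 0 :=
  Subtype.ext (lie_two_Dij hp hkk' hmm' hkm hkm' hk'm)

theorem coe_eElt_apply (hp : 2 < p) {k k' : Fin n} (hk : k ≠ k') {δ : Fin n → ℤ}
    {f : TruncDP K n p} (hf : HasWt δ f) :
    ((eElt hn k k' : Special K n p) : WittAlg K n p) f = ((δ k - 2 * δ k' : ℤ) : K) • (var k * f) :=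
  two_Dij_apply hp hk hf

theorem mono_ne_zero {α : Fin n → ℕ} (hα : ∀ l, α l < p) : (mono α : TruncDP K n p) ≠ 0 := by
  intro h
  have := congrArg (fun f : TruncDP K n p => f fun l => ⟨α l, hα l⟩) h
  rw [mono_apply, if_pos fun _ => rfl] at this
  exact one_ne_zero this

/-- It sends x_k to x_k² = 2x^(2ε_k), which is nonzero because p > 2. -/
theorem eElt_ne_zero (hp : 2 < p) {k k' : Fin n} (hk : k ≠ k') :
    (eElt hn k k' : Special K n p) ≠ 0 := by
  intro h
  have h1 := coe_eElt_apply (K := K) hn hp hk (hasWt_mono (p := p) (eps k))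
  have h2 : ∀ l, (2 • eps k) l < p := by
    intro l
    by_cases h : l = k
    · subst h; simpa [eps] using hp
    · simp only [Pi.smul_apply, eps, Pi.single_eq_of_ne h, smul_zero]; omega
  have h3 : (2 : K) ≠ 0 := by
    intro h0
    have := (CharP.cast_eq_zero_iff K p 2).mp (by exact_mod_cast h0)
    exact absurd (Nat.le_of_dvd two_pos this) (not_le.mpr hp)
  rw [h, ← two_smul_mono hp] at h1
  simp only [eps, Pi.single_eq_same, Pi.single_eq_of_ne hk.symm] at h1
  simp only [Nat.cast_one, Nat.cast_zero, mul_zero, sub_zero, Int.cast_one, one_smul] at h1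
  exact smul_ne_zero h3 (mono_ne_zero h2) h1.symm

end LieOperators

/-! ### The twist pairs inside u_{t,q}(S(n;1)) -/

section TwistedHopf

variable {K : Type*} [Field K] {n p : ℕ} [Fact p.Prime] [CharP K p] (hn : 3 ≤ n) (q : K)

theorem el_lie (x y : Special K n p) : el q ⁅x, y⁆ = el q x * el q y - el q y * el q x :=
  (isRestrictedMap_el q).lie x y

theorem commute_el {x y : Special K n p} (h : ⁅x, y⁆ = 0) : Commute (el q x) (el q y) := by
  have := el_lie q x y
  rw [h, map_zero] at this
  exact (sub_eq_zero.mp this.symm)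

/-- The relation is imposed only for increasing indices; otherwise h(k,k') = -h(k',k), and p is odd.
-/
theorem el_hElt_pow (hp : 2 < p) {k k' : Fin n} (hk : k ≠ k') :
    el q (hElt hn k k' : Special K n p) ^ p = el q (hElt hn k k' : Special K n p) := by
  rcases lt_or_gt_of_ne hk with h | h
  · exact (isRestrictedMap_el q).toral k k' h _ rfl
  · have h1 : (hElt hn k k' : Special K n p) = -hElt hn k' k := Subtype.ext <| by
      change Dij k k' (mono (eps k + eps k')) = -Dij k' k (mono (eps k' + eps k))
      rw [add_comm, Dij_swap]
    have hodd : Odd p := (Fact.out : p.Prime).odd_of_ne_two hp.ne'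
    rw [h1, map_neg]
    exact (hodd.neg_pow _).trans (congrArg Neg.neg
      ((isRestrictedMap_el q).toral k' k h (hElt hn k' k : Special K n p) rfl))

variable (K) in
theorem one_sub_pow_prime (p : ℕ) [Fact p.Prime] [CharP K p] {B : Type*} [Ring B] [Algebra K B]
    {x : B} (hx : x ^ p = 0) : (1 - x) ^ p = 1 := by
  have h := add_pow_prime_of_commute K p ((Commute.one_left x).sub_left (Commute.refl x))
  rw [sub_add_cancel, hx, add_zero, one_pow] at h
  exact h.symm

theorem oneSub_pow {k k' : Fin n} (hk : k ≠ k') : oneSub (K := K) (p := p) hn q k k' hk ^ p = 1 := by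
  refine Units.ext ?_
  rw [Units.val_pow_eq_pow_val, Units.val_one]
  refine one_sub_pow_prime K p ?_
  rw [smul_pow, eElt_pow hn q k k' hk, smul_zero]

/-- Commutation with the unit is t · ad e; this makes the elements t^ℓ d^(ℓ)(x) a divided power
family. -/
theorem el_mul_oneSub {k k' : Fin n} (hk : k ≠ k') (x : Special K n p) :
    el q x * oneSub hn q k k' hk - oneSub hn q k k' hk * el q x =
      tvar K p q • el q ⁅(eElt hn k k' : Special K n p), x⁆ := by
  rw [coe_oneSub, el_lie, mul_sub, sub_mul, mul_one, one_mul, mul_smul_comm, smul_mul_assoc,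
    smul_sub]
  abel

theorem commute_el_oneSub {k k' : Fin n} (hk : k ≠ k') {x : Special K n p}
    (h : ⁅(eElt hn k k' : Special K n p), x⁆ = 0) : Commute (el q x) (oneSub hn q k k' hk : UTQ K n p q) := by
  have := el_mul_oneSub hn q hk x
  rw [h, map_zero, smul_zero] at this
  exact sub_eq_zero.mp this

theorem comul_one_sub_smul {R A : Type*} [CommRing R] [Ring A] [Algebra R A]
    {Δ : A →ₐ[R] A ⊗[R] A} {x : A} (hx : Δ x = x ⊗ₜ 1 + 1 ⊗ₜ x) (r : R) :
    Δ (1 - r • x) = (1 - r • x) ⊗ₜ 1 + 1 ⊗ₜ (1 - r • x) - 1 := by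
  rw [map_sub, map_smul, hx, map_one, TensorProduct.sub_tmul, TensorProduct.tmul_sub, smul_add,
    TensorProduct.smul_tmul', TensorProduct.tmul_smul, Algebra.TensorProduct.one_def]
  abel

theorem counit_one_sub_smul {R A : Type*} [CommRing R] [Ring A] [Algebra R A]
    {ε : A →ₐ[R] R} {x : A} (hx : ε x = 0) (r : R) : ε (1 - r • x) = 1 := by
  rw [map_sub, map_smul, hx, map_one, smul_zero, sub_zero]

/-- The relation [h,e] = e gives [h,g] = -te = g - 1, and e^p = 0 gives g^p = 1. -/
theorem isPrimitivePair_oneSub (hp : 2 < p) {k k' : Fin n} (hk : k ≠ k')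
    {Δ : UTQ K n p q →ₐ[TruncPoly K p q] UTQ K n p q ⊗[TruncPoly K p q] UTQ K n p q}
    {ε : UTQ K n p q →ₐ[TruncPoly K p q] TruncPoly K p q}
    {S : UTQ K n p q →ₗ[TruncPoly K p q] UTQ K n p q}
    (hΔ : ∀ x, Δ (el q x) = el q x ⊗ₜ 1 + 1 ⊗ₜ el q x) (hε : ∀ x, ε (el q x) = 0)
    (hS : ∀ x, S (el q x) = -el q x) :
    IsPrimitivePair p Δ ε S (el q (hElt hn k k' : Special K n p)) (oneSub hn q k k' hk) where
  h_pow := el_hElt_pow hn q hp hk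
  g_pow := oneSub_pow hn q hk
  comm := by
    have h1 := el_mul_oneSub hn q hk (hElt hn k k' : Special K n p)
    rw [← lie_skew, lie_hElt_eElt_self hn hk, map_neg, smul_neg] at h1
    rw [sub_eq_iff_eq_add'.mp h1, add_sub_assoc]
    congr 1
    rw [coe_oneSub]
    abel
  comul_h := hΔ _
  comul_g := comul_one_sub_smul (hΔ _) _
  counit_h := hε _
  counit_g := counit_one_sub_smul (hε _) _
  antipode_h := hS _

theorem commute_one_sub_smul {R A : Type*} [CommRing R] [Ring A] [Algebra R A] {x y : A}
    (h : Commute x y) (r : R) : Commute (1 - r • x) y :=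
  (Commute.one_left _).sub_left (h.smul_left _)

/-- The conditions k ≠ m and k' ≠ m give e(m,m') weight zero under h(k,k'); k ≠ m and k ≠ m' do the
same for e(k,k') under h(m,m'). All three make the two e's commute. -/
theorem commutePairs_oneSub (hp : 2 < p) {k k' m m' : Fin n} (hkk' : k ≠ k') (hmm' : m ≠ m')
    (hkm : k ≠ m) (hkm' : k ≠ m') (hk'm : k' ≠ m) :
    CommutePairs (el q (hElt hn k k' : Special K n p)) (el q (hElt hn m m' : Special K n p))
      (oneSub hn q k k' hkk') (oneSub hn q m m' hmm') where
  hh := commute_el q (lie_hElt_hElt hn hkk' m m')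
  hg := commute_el_oneSub hn q hmm' (by
    rw [← lie_skew, lie_hElt_eElt_of_ne hn hkk' hkm hk'm, neg_zero])
  gh := (commute_el_oneSub hn q hkk' (by
    rw [← lie_skew, lie_hElt_eElt_of_ne hn hmm' hkm.symm hkm'.symm, neg_zero])).symm
  gg := by
    have h := (commute_el_oneSub hn q hmm' (x := (eElt hn k k' : Special K n p))
      (by rw [← lie_skew, lie_eElt_eElt hn hp hkk' hmm' hkm hkm' hk'm, neg_zero]))
    rw [coe_oneSub hn q k k' hkk']
    exact commute_one_sub_smul h _

theorem el_intCast_smul (z : ℤ) (x : Special K n p) :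
    el q ((z : K) • x) = (z : UTQ K n p q) * el q x := by
  rw [Int.cast_smul_eq_zsmul, map_zsmul]
  exact zsmul_eq_mul _ _

theorem el_natCast_smul (z : ℕ) (x : Special K n p) :
    el q ((z : K) • x) = (z : UTQ K n p q) * el q x := by
  rw [Nat.cast_smul_eq_nsmul, map_nsmul]
  exact nsmul_eq_mul _ _

theorem el_hElt_mul {k k' : Fin n} {x : Special K n p} (z : ℤ)
    [CharP (TruncPoly K p q) p] (h : ⁅(hElt hn k k' : Special K n p), x⁆ = (z : K) • x) :
    el q (hElt hn k k' : Special K n p) * el q x =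
      el q x * el q (hElt hn k k' : Special K n p) + primeScalar (TruncPoly K p q) (UTQ K n p q) (z : ZMod p) * el q x := by
  have h1 := el_lie q (hElt hn k k' : Special K n p) x
  rw [h, el_intCast_smul] at h1
  rw [map_intCast, h1]
  abel

theorem smul_commutator_eq {R A : Type*} [CommRing R] [Ring A] [Algebra R A] {x g y c : A} {t : R}
    (h : x * g - g * x = t • (c * y)) (s : R) :
    s • x * g - g * s • x = c * (s * t) • y := by
  rw [smul_mul_assoc, mul_smul_comm, ← smul_sub, h, smul_smul, mul_smul_comm]

/-- Each ad e carries one factor t. The operator for (m,m') does not change the weight under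
h(k,k'), so that weight depends on ℓ alone. -/
theorem isDoubleFamily_gen {k k' m m' : Fin n} (hkk' : k ≠ k') (hmm' : m ≠ m')
    (hkm : k ≠ m) (hk'm : k' ≠ m) [CharP (TruncPoly K p q) p] (i j : Fin n)
    (α : Fin n → ℕ) :
    IsPrimitivePair.IsDoubleFamily p (TruncPoly K p q) (el q (hElt hn k k' : Special K n p)) (el q (hElt hn m m' : Special K n p))
      (oneSub hn q k k' hkk') (oneSub hn q m m' hmm') (wt α i j k k') (wt α i j m m')
      fun ℓ r => tvar K p q ^ (ℓ + r) • el q (dOp hn k k' ℓ (dOp hn m m' r (gen hn i j α))) where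
  left r ℓ hℓ := by
    have h := el_mul_oneSub hn q hkk' (dOp hn k k' ℓ (dOp hn m m' r (gen hn i j α)))
    rw [lie_eElt_dOp hn k k' hℓ, el_natCast_smul] at h
    refine (smul_commutator_eq h _).trans ?_
    rw [← pow_succ, add_right_comm]
  right r hr := by
    have h := el_mul_oneSub hn q hmm' (dOp hn m m' r (gen hn i j α))
    rw [lie_eElt_dOp hn m m' hr, el_natCast_smul] at h
    simp only [dOp_zero]
    refine (smul_commutator_eq h _).trans ?_
    rw [← pow_succ, add_assoc]
  wt_left r ℓ _ := by
    have h0 : ⁅(hElt hn k k' : Special K n p), (eElt hn m m' : Special K n p)⁆ = (0 : K) • (eElt hn m m' : Special K n p) := by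
      rw [zero_smul, lie_hElt_eElt_of_ne hn hkk' hkm hk'm]
    have h1 : ⁅(hElt hn k k' : Special K n p), (eElt hn k k' : Special K n p)⁆ = (1 : K) • (eElt hn k k' : Special K n p) := by
      rw [one_smul, lie_hElt_eElt_self hn hkk']
    have h2 := lie_dOp hn k k' h1 (lie_dOp hn m m' h0 (lie_hElt_gen hn hkk' i j α) r) ℓ
    rw [mul_zero, add_zero, mul_one, ← Int.cast_natCast ℓ, ← Int.cast_add] at h2
    have h3 := el_hElt_mul hn q _ h2
    rw [Int.cast_add, Int.cast_natCast] at h3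
    rw [mul_smul_comm, h3, smul_add, smul_mul_assoc, mul_smul_comm]
  wt_right r _ := by
    simp only [dOp_zero]
    have h1 : ⁅(hElt hn m m' : Special K n p), (eElt hn m m' : Special K n p)⁆ = (1 : K) • (eElt hn m m' : Special K n p) := by
      rw [one_smul, lie_hElt_eElt_self hn hmm']
    have h2 := lie_dOp hn m m' h1 (lie_hElt_gen hn hmm' i j α) r
    rw [mul_one, ← Int.cast_natCast r, ← Int.cast_add] at h2
    have h3 := el_hElt_mul hn q _ h2
    rw [Int.cast_add, Int.cast_natCast] at h3
    rw [mul_smul_comm, h3, smul_add, smul_mul_assoc, mul_smul_comm]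

end TwistedHopf

/-! ### The twisted structure and its failure to be cocommutative -/

section Main

variable {K : Type*} [Field K] {n p : ℕ} [Fact p.Prime] [CharP K p] (hn : 3 ≤ n) (q : K)

theorem sign_smul_tmul {R A : Type*} [CommRing R] [Ring A] [Algebra R A] (a b c d : A) (t : R)
    (ℓ r : ℕ) : (((-1) ^ ℓ * a) * ((-1) ^ r * b)) ⊗ₜ[R] (c * t ^ (ℓ + r) • d) =
      ((-1) ^ (ℓ + r) * t ^ (ℓ + r)) • ((a * b) ⊗ₜ[R] (c * d)) := by
  have h : ∀ (s : ℕ) (x : A), (-1 : A) ^ s * x = ((-1 : R) ^ s) • x := fun s x => by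
    rw [Algebra.smul_def, map_pow, map_neg, map_one]
  rw [h, h, smul_mul_smul_comm, mul_smul_comm, TensorProduct.smul_tmul_smul, ← pow_add]

theorem smul_mul_mul {R A : Type*} [CommRing R] [Ring A] [Algebra R A] (t : R) (a b c : A) :
    t • a * b * c = t • (a * b * c) := by
  rw [smul_mul_assoc, smul_mul_assoc]

/-- The twisted Hopf algebra structure, with its values on the generators. -/
theorem exists_twisted_hopfStructure (hp : 2 < p) {k k' m m' : Fin n} (hkk' : k ≠ k')
    (hmm' : m ≠ m') (hkm : k ≠ m) (hkm' : k ≠ m') (hk'm : k' ≠ m) :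
    ∃ H : HopfStructure (TruncPoly K p q) (UTQ K n p q), ∀ (i j : Fin n) (α : Fin n → ℕ),
        H.comul (el q (gen hn i j α)) =
          el q (gen hn i j α) ⊗ₜ[TruncPoly K p q]
            (oneSubPow hn q k k' hkk' (wt α i j k k') *
              oneSubPow hn q m m' hmm' (wt α i j m m')) +
          ∑ r ∈ Finset.range p, ∑ ℓ ∈ Finset.range p,
            ((-1) ^ (ℓ + r) * tvar K p q ^ (ℓ + r)) •
              ((rising (el q (hElt hn k k')) 0 ℓ * rising (el q (hElt hn m m')) 0 r)
                ⊗ₜ[TruncPoly K p q]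
                (oneSubPow hn q k k' hkk' (-ℓ) *
                  oneSubPow hn q m m' hmm' (-r) *
                  el q (dOp hn k k' ℓ (dOp hn m m' r (gen hn i j α))))) ∧
        H.antipode (el q (gen hn i j α)) =
          -(oneSubPow hn q k k' hkk' (-wt α i j k k') *
              oneSubPow hn q m m' hmm' (-wt α i j m m') *
            ∑ r ∈ Finset.range p, ∑ ℓ ∈ Finset.range p,
              tvar K p q ^ (ℓ + r) •
                (el q (dOp hn k k' ℓ (dOp hn m m' r (gen hn i j α))) *
                  rising (el q (hElt hn k k')) 1 ℓ * rising (el q (hElt hn m m')) 1 r)) ∧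
        H.counit (el q (gen hn i j α)) = 0 := by
  have hR : CharP (TruncPoly K p q) p := charP_truncPoly q
  have hA : CharP (UTQ K n p q) p := charP_UTQ q hn
  obtain ⟨Δ, ε, S, H, hS, hS1, hΔ, hε, hSx⟩ := exists_standard_hopfData (K := K) (n := n) q hp
  have P₁ := isPrimitivePair_oneSub hn q hp hkk' hΔ hε hSx
  have P₂ := isPrimitivePair_oneSub hn q hp hmm' hΔ hε hSx
  have C := commutePairs_oneSub hn q hp hkk' hmm' hkm hkm' hk'm
  refine ⟨(IsTwistData.isHopfData H (IsPrimitivePair.isTwistData hS hS1 P₁ P₂ C)).toHopfStructure,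
    fun i j α => ?_⟩
  have hY := isDoubleFamily_gen hn q hkk' hmm' hkm hk'm i j α
  have h0 : tvar K p q ^ (0 + 0) • el q (dOp hn k k' 0 (dOp hn m m' 0 (gen hn i j α))) =
      el q (gen hn i j α) := by
    rw [dOp_zero, dOp_zero, add_zero, pow_zero, one_smul]
  refine ⟨?_, ?_, hε _⟩
  · have h1 := IsPrimitivePair.comul_eq hS hS1 P₁ P₂ C hY (by
      rw [h0]
      exact hΔ _)
    rw [h0] at h1
    refine h1.trans (congrArg₂ _ rfl (Finset.sum_congr rfl fun r _ =>
      Finset.sum_congr rfl fun ℓ _ => ?_))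
    exact sign_smul_tmul _ _ _ _ _ _ _
  · have h1 := IsPrimitivePair.antipode_eq H hS hS1 P₁ P₂ C hY (by
      rw [h0]
      exact hSx _)
    rw [h0] at h1
    refine h1.trans (congrArg Neg.neg (congrArg₂ _ rfl (Finset.sum_congr rfl fun r _ =>
      Finset.sum_congr rfl fun ℓ _ => ?_)))
    exact smul_mul_mul _ _ _ _

/-- The coefficient at `x_k` of `a · x_k`, for `a` in the restricted enveloping algebra. -/
noncomputable def diagCoeff (k : Fin n) : RestrictedEnv K n p →ₗ[K] K where
  toFun a := rep K n p a (var k) fun l => ⟨eps k l, eps_lt k l⟩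
  map_add' a b := by rw [map_add]; rfl
  map_smul' c a := by rw [map_smul]; rfl

theorem diagCoeff_hElt {k k' : Fin n} (hk : k ≠ k') :
    diagCoeff k (uι K n p (hElt hn k k')) = 1 := by
  change rep K n p (uι K n p (hElt hn k k')) (var k) _ = 1
  rw [rep_uι_apply]
  have h := Dij_toral_apply (K := K) hk (hasWt_mono (p := p) (eps k))
  simp only [eps, Pi.single_eq_same, Pi.single_eq_of_ne hk.symm, Nat.cast_one, Nat.cast_zero,
    sub_zero, Int.cast_one, one_smul] at h
  refine (congrFun h _).trans ?_
  rw [mono_apply, if_pos]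
  exact fun _ => rfl

/-- The image of e(k,k') has no x_k-component: e multiplies by x_k, so such a component could come
only from constants, which e kills. -/
theorem diagCoeff_eElt_mul (hp : 2 < p) {k k' : Fin n} (hk : k ≠ k') (a : RestrictedEnv K n p) :
    diagCoeff k (uι K n p (eElt hn k k') * a) = 0 := by
  let φ : TruncDP K n p →ₗ[K] K :=
    { toFun := fun f => (eElt hn k k' : Special K n p).1 f fun l => ⟨eps k l, eps_lt k l⟩
      map_add' := fun f g => by rw [map_add]; rfl
      map_smul' := fun c f => by rw [Derivation.map_smul]; rfl }
  have hφ : φ = 0 := by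
    refine linearMap_ext_mono fun γ => ?_
    change (eElt hn k k' : Special K n p).1 _ _ = 0
    have hγ := hasWt_mono (K := K) (p := p) fun i => (γ i : ℕ)
    rw [coe_eElt_apply hn hp hk hγ, TruncDP.smul_apply]
    by_contra hcon
    have h1 := hasWt_var_mul hγ k _ (right_ne_zero_of_mul hcon)
    have h2 : ∀ l, (γ l : ℕ) = 0 := fun l => by
      have := h1 l
      simp only [Pi.add_apply] at this
      omega
    refine left_ne_zero_of_mul hcon ?_
    simp [h2]
  have h : diagCoeff k (uι K n p (eElt hn k k') * a) = φ (rep K n p a (var k)) := by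
    change rep K n p (uι K n p (eElt hn k k') * a) (var k) _ = _
    rw [map_mul, Module.End.mul_apply, rep_uι_apply]
    rfl
  rw [h, hφ, LinearMap.zero_apply]

/-- In an algebra with an element `h` and a unit `g` for which `1 ⊗ h + h ⊗ g⁻¹` is symmetric,
a functional taking the value `1` at `h` and vanishing on `(1 - g) A` forces `g = 1`. -/
theorem eq_one_of_comm_comul {R A : Type*} [CommRing R] [Ring A] [Algebra R A] {h : A} {g : Aˣ}
    (hc : TensorProduct.comm R A A (1 ⊗ₜ h + h ⊗ₜ ((g⁻¹ : Aˣ) : A)) =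
      1 ⊗ₜ h + h ⊗ₜ ((g⁻¹ : Aˣ) : A)) (ψ : A →ₗ[R] R) (hψ : ψ h = 1)
    (hψ' : ∀ a, ψ ((1 - g) * a) = 0) : g = 1 := by
  have h1 : ψ ((g⁻¹ : Aˣ) : A) = ψ 1 := by
    have h2 := hψ' ((g⁻¹ : Aˣ) : A)
    rw [sub_mul, one_mul, Units.mul_inv, map_sub] at h2
    exact sub_eq_zero.mp h2
  have h3 := congrArg (fun z => TensorProduct.lid R A (ψ.rTensor A z)) hc
  simp only [map_add, TensorProduct.comm_tmul, LinearMap.rTensor_tmul, TensorProduct.lid_tmul, hψ,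
    h1, one_smul] at h3
  rw [add_comm] at h3
  have h4 : (1 : A) = ((g⁻¹ : Aˣ) : A) := add_left_cancel h3
  exact inv_eq_one.mp (Units.ext h4.symm)

theorem oneSub_ne_one (hp : 2 < p) {k k' : Fin n} (hk : k ≠ k') :
    oneSub (K := K) (p := p) hn q k k' hk ≠ 1 := by
  intro h
  have h1 := congrArg (fun g : (UTQ K n p q)ˣ => (g : UTQ K n p q)) h
  simp only [coe_oneSub, Units.val_one] at h1
  exact tvar_smul_el_ne_zero q (eElt_ne_zero hn hp hk) (sub_eq_self.mp h1)

/-- The functional `diagCoeff` with scalars extended to `K[t]/(t^p - q t)`. -/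
noncomputable def diagCoeffUTQ (k : Fin n) : UTQ K n p q →ₗ[TruncPoly K p q] TruncPoly K p q :=
  (TensorProduct.AlgebraTensorModule.rid K (TruncPoly K p q) (TruncPoly K p q)).toLinearMap ∘ₗ
    (diagCoeff k).baseChange (TruncPoly K p q)

theorem diagCoeffUTQ_tmul (k : Fin n) (r : TruncPoly K p q) (a : RestrictedEnv K n p) :
    diagCoeffUTQ q k (r ⊗ₜ a) = diagCoeff k a • r := rfl

theorem diagCoeffUTQ_hElt {k k' : Fin n} (hk : k ≠ k') :
    diagCoeffUTQ q k (el q (hElt hn k k' : Special K n p)) = 1 := by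
  refine (diagCoeffUTQ_tmul q k 1 (uι K n p (hElt hn k k'))).trans ?_
  rw [diagCoeff_hElt hn hk, one_smul]

theorem diagCoeffUTQ_one_sub_oneSub_mul (hp : 2 < p) {k k' : Fin n} (hk : k ≠ k')
    (a : UTQ K n p q) : diagCoeffUTQ q k ((1 - oneSub hn q k k' hk) * a) = 0 := by
  have h : ∀ a : UTQ K n p q, diagCoeffUTQ q k (el q (eElt hn k k' : Special K n p) * a) = 0 := by
    intro a
    induction a using TensorProduct.induction_on with
    | zero => rw [mul_zero, map_zero]
    | add x y hx hy => rw [mul_add, map_add, hx, hy, add_zero]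
    | tmul r a =>
      have h1 : el q (eElt hn k k' : Special K n p) * r ⊗ₜ[K] a =
          r ⊗ₜ[K] (uι K n p (eElt hn k k') * a) := by
        refine (Algebra.TensorProduct.tmul_mul_tmul _ _ _ _).trans ?_
        rw [one_mul]
        rfl
      rw [h1, diagCoeffUTQ_tmul, diagCoeff_eElt_mul hn hp hk, zero_smul]
  rw [coe_oneSub, sub_sub_cancel, smul_mul_assoc, map_smul, h, smul_zero]

theorem rising_one_zero {B : Type*} [Ring B] (x : B) : rising x 0 1 = x := by
  simp [rising]

theorem tmul_one_add_eq {R A : Type*} [CommRing R] [Ring A] [Algebra R A] {h e : A} {t : R}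
    {g : Aˣ} (hg : (g : A) = 1 - t • e) :
    h ⊗ₜ[R] (1 : A) + (1 ⊗ₜ h + (-1 * t) • (h ⊗ₜ (((g⁻¹ : Aˣ) : A) * -e))) =
      1 ⊗ₜ h + h ⊗ₜ ((g⁻¹ : Aˣ) : A) := by
  have h1 : ((g⁻¹ : Aˣ) : A) = 1 + ((g⁻¹ : Aˣ) : A) * t • e := by
    have h2 := Units.inv_mul g
    rw [hg, mul_sub, mul_one] at h2
    exact (sub_eq_iff_eq_add.mp h2)
  have h3 : (-1 * t) • (h ⊗ₜ[R] (((g⁻¹ : Aˣ) : A) * -e)) = h ⊗ₜ (((g⁻¹ : Aˣ) : A) * t • e) := by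
    rw [← TensorProduct.tmul_smul, mul_neg, neg_one_mul, neg_smul, smul_neg, neg_neg,
      mul_smul_comm]
  rw [h3, add_left_comm, ← TensorProduct.tmul_add, ← h1]

/-- The deformed coproduct of the toral element `h(k,k')`. -/
theorem deformed_comul_hElt {k k' m m' : Fin n} (hkk' : k ≠ k')
    (hmm' : m ≠ m') (hkm : k ≠ m) (hk'm : k' ≠ m) :
    (el q (hElt hn k k' : Special K n p) ⊗ₜ[TruncPoly K p q]
            (oneSubPow hn q k k' hkk' (wt (eps k + eps k') k k' k k') *
              oneSubPow hn q m m' hmm' (wt (eps k + eps k') k k' m m')) +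
          ∑ r ∈ Finset.range p, ∑ ℓ ∈ Finset.range p,
            ((-1) ^ (ℓ + r) * tvar K p q ^ (ℓ + r)) •
              ((rising (el q (hElt hn k k')) 0 ℓ * rising (el q (hElt hn m m')) 0 r)
                ⊗ₜ[TruncPoly K p q]
                (oneSubPow hn q k k' hkk' (-ℓ) *
                  oneSubPow hn q m m' hmm' (-r) *
                  el q (dOp hn k k' ℓ (dOp hn m m' r (hElt hn k k')))))) =
      1 ⊗ₜ el q (hElt hn k k') +
        el q (hElt hn k k') ⊗ₜ (((oneSub hn q k k' hkk')⁻¹ : (UTQ K n p q)ˣ) : UTQ K n p q) := by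
  have hd : ∀ r, r ≠ 0 → dOp hn m m' r (hElt hn k k' : Special K n p) = 0 := by
    intro r hr
    obtain ⟨r, rfl⟩ := Nat.exists_eq_succ_of_ne_zero hr
    rw [dOp, LinearMap.smul_apply, pow_succ, Module.End.mul_apply, LieAlgebra.ad_apply, ← lie_skew,
      lie_hElt_eElt_of_ne hn hkk' hkm hk'm, neg_zero, map_zero, smul_zero]
  have had : LieAlgebra.ad K (Special K n p) (eElt hn k k') (hElt hn k k') = -eElt hn k k' := by
    rw [LieAlgebra.ad_apply, ← lie_skew, lie_hElt_eElt_self hn hkk']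
  have hone : dOp hn k k' 1 (hElt hn k k' : Special K n p) = -eElt hn k k' := by
    rw [dOp, LinearMap.smul_apply, pow_one, had, Nat.factorial_one, Nat.cast_one, inv_one, one_smul]
  have htwo : ∀ ℓ, 2 ≤ ℓ → dOp hn k k' ℓ (hElt hn k k' : Special K n p) = 0 := by
    intro ℓ hℓ
    obtain ⟨ℓ, rfl⟩ := Nat.exists_eq_add_of_le' hℓ
    rw [dOp, LinearMap.smul_apply, pow_succ, pow_succ, Module.End.mul_apply, Module.End.mul_apply,
      had, map_neg, LieAlgebra.ad_apply,
      lie_self, neg_zero, map_zero, smul_zero]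
  have hw : wt (eps k + eps k') k k' m m' = 0 := wt_eps_add_eps m m' k k'
  have hw' : wt (eps k + eps k') k k' k k' = 0 := wt_eps_add_eps k k' k k'
  have hp := (Fact.out : p.Prime).two_le
  -- h(k,k') commutes with e(m,m'), so only r = 0 survives.
  rw [Finset.sum_eq_single 0]
  rotate_left
  · intro r _ hr
    refine Finset.sum_eq_zero fun ℓ _ => ?_
    rw [hd r hr, map_zero, map_zero, mul_zero, TensorProduct.tmul_zero, smul_zero]
  · intro h
    exact absurd (Finset.mem_range.mpr (by omega)) h
  -- ad e sends h to -e and then to 0, so only ℓ = 0 and ℓ = 1 survive; both lie in the range as p ≥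
  -- 2.
  rw [← Finset.sum_subset (Finset.range_mono hp), Finset.sum_range_succ, Finset.sum_range_one,
    dOp_zero, dOp_zero, hone, hw, hw', map_neg]
  rotate_left
  · intro ℓ _ hℓ
    rw [Finset.mem_range, not_lt] at hℓ
    rw [dOp_zero, htwo ℓ hℓ, map_zero, mul_zero, TensorProduct.tmul_zero, smul_zero]
  simp only [oneSubPow, Nat.cast_zero, neg_zero, Nat.cast_one, zpow_zero, zpow_neg_one,
    Units.val_one, rising_zero, rising_one_zero, mul_one, one_mul, add_zero, pow_zero, pow_one,
    one_smul]
  exact tmul_one_add_eq (coe_oneSub hn q k k' hkk')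

end Main

theorem theorem4p7 {K : Type*} [Field K] (p : ℕ) [Fact p.Prime] [CharP K p] (hp : 2 < p)
    (n : ℕ) (hn : 3 ≤ n) (q : K) (k k' m m' : Fin n)
    (hkk' : k ≠ k') (hmm' : m ≠ m') (hkm : k ≠ m) (hkm' : k ≠ m') (hk'm : k' ≠ m) :
    Module.finrank K (UTQ K n p q) = p ^ (1 + (n - 1) * (p ^ n - 1)) ∧
    (¬ ∀ a b : UTQ K n p q, a * b = b * a) ∧
    ∃ H : HopfStructure (TruncPoly K p q) (UTQ K n p q),
      (¬ ∀ a : UTQ K n p q, TensorProduct.comm (TruncPoly K p q) (UTQ K n p q) (UTQ K n p q)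
        (H.comul a) = H.comul a) ∧
      ∀ (i j : Fin n) (α : Fin n → ℕ), (∀ l, α l ≤ p - 1) →
        H.comul (el q (gen hn i j α)) =
          el q (gen hn i j α) ⊗ₜ[TruncPoly K p q]
            (oneSubPow hn q k k' hkk' (wt α i j k k') *
              oneSubPow hn q m m' hmm' (wt α i j m m')) +
          ∑ r ∈ Finset.range p, ∑ ℓ ∈ Finset.range p,
            ((-1) ^ (ℓ + r) * tvar K p q ^ (ℓ + r)) •
              ((rising (el q (hElt hn k k')) 0 ℓ * rising (el q (hElt hn m m')) 0 r)
                ⊗ₜ[TruncPoly K p q]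
                (oneSubPow hn q k k' hkk' (-ℓ) *
                  oneSubPow hn q m m' hmm' (-r) *
                  el q (dOp hn k k' ℓ (dOp hn m m' r (gen hn i j α))))) ∧
        H.antipode (el q (gen hn i j α)) =
          -(oneSubPow hn q k k' hkk' (-wt α i j k k') *
              oneSubPow hn q m m' hmm' (-wt α i j m m') *
            ∑ r ∈ Finset.range p, ∑ ℓ ∈ Finset.range p,
              tvar K p q ^ (ℓ + r) •
                (el q (dOp hn k k' ℓ (dOp hn m m' r (gen hn i j α))) *
                  rising (el q (hElt hn k k')) 1 ℓ * rising (el q (hElt hn m m')) 1 r)) ∧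
        H.counit (el q (gen hn i j α)) = 0 := by
  refine ⟨finrank_UTQ q hn, fun hcomm => ?_, ?_⟩
  -- Commutativity would make the image of [h,e] = e vanish.
  · have h := el_lie q (hElt hn k k' : Special K n p) (eElt hn k k')
    rw [lie_hElt_eElt_self hn hkk', hcomm, sub_self] at h
    exact el_ne_zero q (eElt_ne_zero hn hp hkk') h
  · obtain ⟨H, hH⟩ := exists_twisted_hopfStructure (K := K) hn q hp hkk' hmm' hkm hkm' hk'm
    refine ⟨H, fun hcocomm => ?_, fun i j α _ => hH i j α⟩
    have h1 : H.comul (el q (hElt hn k k')) = _ :=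
      (hH k k' (eps k + eps k')).1.trans (deformed_comul_hElt hn q hkk' hmm' hkm hk'm)
    have h2 := hcocomm (el q (hElt hn k k'))
    rw [h1] at h2
    exact oneSub_ne_one hn q hp hkk' (eq_one_of_comm_comul h2 (diagCoeffUTQ q k)
      (diagCoeffUTQ_hElt hn q hkk') (diagCoeffUTQ_one_sub_oneSub_mul hn q hp hkk'))
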